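/- **Theorem (Borel).** Let $\ell$ be a prime and let $H^*=\bigoplus_{n\ge 0}H^n$ be a graded-commutative $\mathbb F_\ell$-algebra with $H^0=\mathbb F_\ell$. Let $\{E_r^{*,*},d_r\}_{r\ge 2}$ be a first-quadrant spectral sequence of graded-commutative $H^*$-algebras: $d_r$ has bidegree $(r,1-r)$, is an $H^*$-linear derivation, and $E_{r+1}\cong H(E_r,d_r)$ as bigraded $H^*$-algebras; graded-commutativity and signs refer to the total degree $p+q$; and $H^n$ acts through the base degree, i.e. the unit maps are homomorphisms $H^n\to E_r^{n,0}$. Suppose that it converges to the $H^*$-algebra $H^*$. Put $V^*=E_2^{*,0}$, a graded $H^*$-algebra, and let $W^*$ be the $H^*$-subalgebra of $E_2$ generated by the column $E_2^{0,*}$. Suppose that (i) $E_2\cong W^*\otimes_{H^*}V^*$ as algebras, via multiplication, and (ii) $W^*$ has over $H^*$ an $\ell$-simple system of generators $\{x_i\}_{i\in I}$, each of which is transgressive. That is, $I$ is totally ordered, $x_i\in E_2^{0,|x_i|}$, and $W^*$ is a free left $H^*$-module on the monomials $x_{i_1}^{m_1}\cdots x_{i_k}^{m_k}$ with $i_1<\dots<i_k$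 and $0\le m_j<\ell$, where $m_j\le 1$ if $|x_{i_j}|$ is odd; and each $x_i$ survives to $E_{|x_i|+1}$. Here an element $x\in E_2^{p,q}$ is called transgressive if it survives to $E_{q+1}$, and an element $y\in E_2^{p+q+1,0}$ represents its transgression $\tau(x)$ if $d_{q+1}[x]=[y]$ in $E_{q+1}^{p+q+1,0}$. Let $y_i\in V^{|x_i|+1}$ be any representatives of $\tau(x_i)$. If $\ell\neq 2$, suppose also that for each $j$ with $|x_j|$ even the element $y_j\otimes x_j^{\ell-1}\in E_2^{|x_j|+1,(\ell-1)|x_j|}$ is transgressive, and let $z_j\in V^{\ell|x_j|+2}$ be any representative of $\tau(y_j\otimes x_j^{\ell-1})$. Then $V^*$ is the tensor product over $\mathbb F_\ell$ of $H^*$ and the free graded-commutative $\mathbb F_\ell$-algebra on the $y_i$ ($i\in I$) and, when $\ell\ne 2$, the $z_j$ ($|x_j|$ even). In detail: sending the generators of that free algebra $S$ to the $y_i,z_j\in V^*$ defines an algebra map $\varphi\colon S\to V^*$, and $H^*\otimes_{\mathbb F_\ell} S\to V^*$, $h\otimes s\mapsto h\,\varphi(s)$, is an isomorphism. -/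

import Mathlib

open scoped TensorProduct

universe u v w

/-- Graded-commutativity: `a * b = (-1)^{|a||b|} b * a` for homogeneous `a`, `b`, where the
component of index `i` has degree `deg i`. -/
def IsGradedCommutative {F : Type u} {A : Type v} {ι : Type w} [CommRing F] [Ring A] [Algebra F A]
    (deg : ι → ℕ) (𝒜 : ι → Submodule F A) : Prop :=
  ∀ i j, ∀ a ∈ 𝒜 i, ∀ b ∈ 𝒜 j, a * b = (-1 : F) ^ (deg i * deg j) • (b * a)

/-- A first-quadrant spectral sequence `(E_r, d_r)`, `r ≥ 2`, of bigraded, graded-commutative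
`H^*`-algebras. The page `E_r = ⨁ E_r^{p,q}` is an algebra `E r` with its decomposition
`gr r (p, q)`, `p, q ≥ 0`; `H^n` acts through `E_r^{n,0}`. The entries `E 0`, `E 1` play no role. -/
structure SpectralSeq {F : Type} [Field F] {H : Type u} [Ring H] [Algebra F H]
    (𝓗 : ℕ → Submodule F H) where
  E : ℕ → Type v
  [ring : ∀ r, Ring (E r)]
  [algebra : ∀ r, Algebra F (E r)]
  gr : ∀ r, ℕ × ℕ → Submodule F (E r)
  [graded : ∀ r, GradedAlgebra (gr r)]
  /-- Graded-commutativity with respect to the total degree. -/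
  comm : ∀ r, 2 ≤ r → IsGradedCommutative (fun i : ℕ × ℕ => i.1 + i.2) (gr r)
  /-- The differential, of bidegree `(r, 1 - r)`; it vanishes if its target leaves the quadrant. -/
  d : ∀ r, E r →ₗ[F] E r
  d_mem : ∀ r, 2 ≤ r → ∀ p q q', q' + r = q + 1 → ∀ x ∈ gr r (p, q), d r x ∈ gr r (p + r, q')
  d_zero : ∀ r, 2 ≤ r → ∀ p q, q + 1 < r → ∀ x ∈ gr r (p, q), d r x = 0
  d_d : ∀ r, 2 ≤ r → ∀ x, d r (d r x) = 0
  leibniz : ∀ r, 2 ≤ r → ∀ p q, ∀ x ∈ gr r (p, q), ∀ y,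
    d r (x * y) = d r x * y + (-1 : F) ^ (p + q) • (x * d r y)
  /-- The passage from cycles of `d_r` to `E_{r+1}`; it identifies `E_{r+1}` with
  `ker d_r / im d_r` as a bigraded algebra. -/
  π : ∀ r, LinearMap.ker (d r) →ₗ[F] E (r + 1)
  π_surjective : ∀ r, 2 ≤ r → Function.Surjective (π r)
  π_eq_zero_iff : ∀ r, 2 ≤ r → ∀ x, π r x = 0 ↔ ∃ e, d r e = x
  π_one : ∀ r, 2 ≤ r → ∀ x : LinearMap.ker (d r), (x : E r) = 1 → π r x = 1
  π_mul : ∀ r, 2 ≤ r → ∀ x y z : LinearMap.ker (d r), (z : E r) = x * y → π r z = π r x * π r y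
  π_mem : ∀ r, 2 ≤ r → ∀ i, ∀ x : LinearMap.ker (d r), (x : E r) ∈ gr r i → π r x ∈ gr (r + 1) i
  /-- The `H^*`-algebra structure. By the Leibniz rule, `d_η` says that `d_r` is `H^*`-linear
  (with the usual sign). -/
  η : ∀ r, H →ₐ[F] E r
  η_mem : ∀ r, 2 ≤ r → ∀ n, ∀ h ∈ 𝓗 n, η r h ∈ gr r (n, 0)
  d_η : ∀ r, 2 ≤ r → ∀ h, d r (η r h) = 0
  π_η : ∀ r, 2 ≤ r → ∀ h, ∀ x : LinearMap.ker (d r), (x : E r) = η r h → π r x = η (r + 1) h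

attribute [instance] SpectralSeq.ring SpectralSeq.algebra SpectralSeq.graded

namespace SpectralSeq

variable {F : Type} [Field F] {H : Type u} [Ring H] [Algebra F H] {𝓗 : ℕ → Submodule F H}

/-- Convergence of a first-quadrant spectral sequence of `H^*`-algebras to a graded `H^*`-algebra
`A^*` with structure map `unit`: a finite decreasing multiplicative filtration
`A^n = F^0 A^n ⊇ F^1 A^n ⊇ ⋯ ⊇ F^{n+1} A^n = 0`, and isomorphisms
`F^p A^{p+q} / F^{p+1} A^{p+q} ≅ E_∞^{p,q}` of `H^*`-algebras. Here `E_∞^{p,q}` is `E_r^{p,q}` for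
any `r > max (p, q + 1)` (the transition maps between these are induced by `π`). -/
structure Convergence (S : SpectralSeq.{u, v} 𝓗) {A : Type w} [Ring A] [Algebra F A]
    (𝒜 : ℕ → Submodule F A) (unit : H →ₐ[F] A) where
  Fil : ℕ → ℕ → Submodule F A
  fil_zero : ∀ n, Fil 0 n = 𝒜 n
  fil_succ_le : ∀ p n, Fil (p + 1) n ≤ Fil p n
  fil_bot : ∀ n, Fil (n + 1) n = ⊥
  fil_mul : ∀ p n p' n', ∀ a ∈ Fil p n, ∀ b ∈ Fil p' n', a * b ∈ Fil (p + p') (n + n')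
  φ : ∀ r p q, Fil p (p + q) →ₗ[F] S.E r
  φ_mem : ∀ r p q, max p (q + 1) < r → ∀ a, φ r p q a ∈ S.gr r (p, q)
  φ_surjective : ∀ r p q, max p (q + 1) < r → ∀ e ∈ S.gr r (p, q), ∃ a, φ r p q a = e
  φ_eq_zero_iff : ∀ r p q, max p (q + 1) < r →
    ∀ a, φ r p q a = 0 ↔ (a : A) ∈ Fil (p + 1) (p + q)
  φ_π : ∀ r p q, max p (q + 1) < r → ∀ a, ∀ x : LinearMap.ker (S.d r),
    (x : S.E r) = φ r p q a → S.π r x = φ (r + 1) p q a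
  φ_mul : ∀ r p q p' q', max (p + p') (q + q' + 1) < r →
    ∀ (a : Fil p (p + q)) (b : Fil p' (p' + q')) (c : Fil (p + p') (p + p' + (q + q'))),
      (c : A) = a * b → φ r (p + p') (q + q') c = φ r p q a * φ r p' q' b
  unit_mem : ∀ n, ∀ h ∈ 𝓗 n, unit h ∈ Fil n n
  φ_unit : ∀ r n, max n 1 < r → ∀ h ∈ 𝓗 n, ∀ a : Fil n (n + 0),
    (a : A) = unit h → φ r n 0 a = S.η r h

/-- The spectral sequence converges to the `H^*`-algebra `H^*` itself. -/
def ConvergesToBase (S : SpectralSeq.{u, v} 𝓗) : Prop :=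
  Nonempty (S.Convergence 𝓗 (AlgHom.id F H))

/-- The algebra `V^* = E_2^{*,0}`. -/
def V (S : SpectralSeq.{u, v} 𝓗) : Subalgebra F (S.E 2) :=
  (⨆ p, S.gr 2 (p, 0)).toSubalgebra
    (Submodule.mem_iSup_of_mem 0 (SetLike.GradedOne.one_mem (A := S.gr 2)))
    (by
      intro a b ha hb
      induction ha using Submodule.iSup_induction' with
      | zero => simp
      | add a a' _ _ h h' => rw [add_mul]; exact add_mem h h'
      | mem p a ha =>
        induction hb using Submodule.iSup_induction' with
        | zero => simp
        | add b b' _ _ h h' => rw [mul_add]; exact add_mem h h'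
        | mem p' b hb =>
          exact Submodule.mem_iSup_of_mem (p + p') (SetLike.GradedMul.mul_mem ha hb))

/-- The `H^*`-algebra `W^*` given by the column `E_2^{0,*}`: the `H^*`-subalgebra of `E_2` which
that column generates. -/
def W (S : SpectralSeq.{u, v} 𝓗) : Subalgebra F (S.E 2) :=
  Algebra.adjoin F (Set.range (S.η 2) ∪ ⋃ q, (S.gr 2 (0, q) : Set (S.E 2)))

theorem η_mem_V [GradedAlgebra 𝓗] (S : SpectralSeq.{u, v} 𝓗) (h : H) : S.η 2 h ∈ S.V := by
  classical
  rw [← DirectSum.sum_support_decompose 𝓗 h, map_sum]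
  exact sum_mem fun n _ => Submodule.mem_iSup_of_mem (p := fun p => S.gr 2 (p, 0)) n
    (S.η_mem 2 le_rfl n _ (SetLike.coe_mem _))

theorem η_mem_W (S : SpectralSeq.{u, v} 𝓗) (h : H) : S.η 2 h ∈ S.W :=
  Algebra.subset_adjoin (Or.inl ⟨h, rfl⟩)

/-- The structure map of the `H^*`-algebra `V^*`. -/
def toV [GradedAlgebra 𝓗] (S : SpectralSeq.{u, v} 𝓗) : H →ₐ[F] S.V :=
  (S.η 2).codRestrict S.V S.η_mem_V

/-- The structure map of the `H^*`-algebra `W^*`. -/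
def toW (S : SpectralSeq.{u, v} 𝓗) : H →ₐ[F] S.W :=
  (S.η 2).codRestrict S.W S.η_mem_W

/-- The relations `w h ⊗ v = w ⊗ h v` defining `W^* ⊗_{H^*} V^*` as a quotient of
`W^* ⊗_F V^*`. -/
def balance [GradedAlgebra 𝓗] (S : SpectralSeq.{u, v} 𝓗) : Submodule F (S.W ⊗[F] S.V) :=
  Submodule.span F
    {t | ∃ (w : S.W) (h : H) (v : S.V), t = (w * S.toW h) ⊗ₜ[F] v - w ⊗ₜ[F] (S.toV h * v)}

/-- The multiplication map `W^* ⊗_F V^* → E_2`. -/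
noncomputable def mulWV (S : SpectralSeq.{u, v} 𝓗) : S.W ⊗[F] S.V →ₗ[F] S.E 2 :=
  LinearMap.mul' F (S.E 2) ∘ₗ TensorProduct.map S.W.val.toLinearMap S.V.val.toLinearMap

theorem balance_le_ker [GradedAlgebra 𝓗] (S : SpectralSeq.{u, v} 𝓗) :
    S.balance ≤ LinearMap.ker S.mulWV := by
  refine Submodule.span_le.2 ?_
  rintro _ ⟨w, h, v, rfl⟩
  simp [mulWV, toW, toV, mul_assoc]

/-- `E_2 ≅ W^* ⊗_{H^*} V^*` as algebras: multiplication induces a bijection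
`W^* ⊗_{H^*} V^* → E_2`. (`E_2` being graded-commutative, this bijection is multiplicative for the
product `(w ⊗ v)(w' ⊗ v') = (-1)^{|v||w'|} w w' ⊗ v v'`.) -/
def SplitsE2 [GradedAlgebra 𝓗] (S : SpectralSeq.{u, v} 𝓗) : Prop :=
  Function.Bijective (S.balance.liftQ S.mulWV S.balance_le_ker)

/-- `S.Survives x r e`: the element `x` of `E_2` survives to the page `E_r` (`r ≥ 2`), i.e. it is
successively a cycle for `d_2, …, d_{r-1}`, and its class in `E_r` is `e`. -/
inductive Survives (S : SpectralSeq.{u, v} 𝓗) (x : S.E 2) : (r : ℕ) → S.E r → Prop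
  | base : Survives S x 2 x
  | step {r : ℕ} {e : S.E r} (he : S.d r e = 0) (h : Survives S x r e) :
      Survives S x (r + 1) (S.π r ⟨e, he⟩)

/-- `x ∈ E_2^{p,q}` is transgressive and `y ∈ E_2^{p+q+1,0}` represents its transgression `τ(x)`:
`x` survives to `E_{q+1}` and `d_{q+1}` maps its class to the class of `y`.
(This forces `q ≥ 1`, as `Survives` only reaches pages `r ≥ 2`.) -/
def Transgresses (S : SpectralSeq.{u, v} 𝓗) (p q : ℕ) (x y : S.E 2) : Prop :=
  x ∈ S.gr 2 (p, q) ∧ y ∈ S.gr 2 (p + q + 1, 0) ∧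
    ∃ e f : S.E (q + 1), S.Survives x (q + 1) e ∧ S.Survives y (q + 1) f ∧ S.d (q + 1) e = f

end SpectralSeq

/-- The monomial `x_{i_1}^{m_1} ⋯ x_{i_k}^{m_k}` with `i_1 < ⋯ < i_k`. -/
def orderedMonomial {I : Type w} [LinearOrder I] {A : Type v} [Monoid A] (x : I → A)
    (m : I →₀ ℕ) : A :=
  ((m.support.sort (· ≤ ·)).map fun i => x i ^ m i).prod

/-- The exponents `m` with `0 ≤ m_i < ℓ`, and `m_i ≤ 1` if `deg x_i` is odd. -/
abbrev SimpleExponent (ℓ : ℕ) {I : Type w} (deg : I → ℕ) : Type w :=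
  {m : I →₀ ℕ // ∀ i, m i < ℓ ∧ (Odd (deg i) → m i ≤ 1)}

/-- The totally ordered family `x_i`, of degrees `deg i`, is an `ℓ`-simple system of generators of
the `H`-algebra `A` (with structure map `unit`): `A` is a free left `H`-module on the monomials
with exponents in `SimpleExponent ℓ deg`. -/
def IsSimpleSystem (ℓ : ℕ) {H : Type u} {A : Type v} [Ring H] [Ring A] (unit : H →+* A)
    {I : Type w} [LinearOrder I] (deg : I → ℕ) (x : I → A) : Prop :=
  Function.Bijective fun c : SimpleExponent ℓ deg →₀ H =>
    c.sum fun m h => unit h * orderedMonomial x m.1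

/-- The relations `a b = (-1)^{|a||b|} b a` between generators. -/
inductive FreeGCRel (F : Type u) [CommRing F] {G : Type v} (deg : G → ℕ) :
    FreeAlgebra F G → FreeAlgebra F G → Prop
  | swap (a b : G) : FreeGCRel F deg (FreeAlgebra.ι F a * FreeAlgebra.ι F b)
      ((-1 : F) ^ (deg a * deg b) • (FreeAlgebra.ι F b * FreeAlgebra.ι F a))

/-- The free graded-commutative `F`-algebra on generators `g` of degree `deg g`. (Over a field of
odd characteristic: exterior on the odd generators, polynomial on the even ones; in
characteristic 2: polynomial on all generators.) -/
abbrev FreeGC (F : Type u) [CommRing F] {G : Type v} (deg : G → ℕ) : Type (max u v) :=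
  RingQuot (FreeGCRel F deg)

/-- The generator `g` of the free graded-commutative algebra. -/
def FreeGC.gen (F : Type u) [CommRing F] {G : Type v} (deg : G → ℕ) (g : G) : FreeGC F deg :=
  RingQuot.mkAlgHom F (FreeGCRel F deg) (FreeAlgebra.ι F g)

/-- The indices `j` with `ℓ ≠ 2` and `deg x_j` even. -/
abbrev EvenIndex (ℓ : ℕ) {I : Type w} (deg : I → ℕ) : Type w :=
  {j : I // ℓ ≠ 2 ∧ Even (deg j)}

/-- The degrees of the generators: `|y_i| = |x_i| + 1` and `|z_j| = ℓ |x_j| + 2`. -/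
def genDeg (ℓ : ℕ) {I : Type w} (deg : I → ℕ) : I ⊕ EvenIndex ℓ deg → ℕ
  | .inl i => deg i + 1
  | .inr j => ℓ * deg j.1 + 2

/-- For algebra maps `f : A → C`, `g : B → C`, the map `A ⊗ B → C`, `a ⊗ b ↦ f a * g b`. It is
multiplicative for the graded tensor product if `f` and `g` are degree-preserving and `C` is
graded-commutative. -/
noncomputable def tensorToAlg {F : Type*} [CommRing F] {A B C : Type*} [Ring A] [Ring B] [Ring C]
    [Algebra F A] [Algebra F B] [Algebra F C] (f : A →ₐ[F] C) (g : B →ₐ[F] C) :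
    A ⊗[F] B →ₗ[F] C :=
  LinearMap.mul' F C ∘ₗ TensorProduct.map f.toLinearMap g.toLinearMap

/-! The theorem is proved by comparing the given spectral sequence with a model with an explicit
basis, following Zeeman.

For a generator `x_i` of degree `n`, let the elementary complex be `Λ(x_i) ⊗ P(y_i)` if `n` is odd
or `ℓ = 2`, and `P(x_i)/(x_i^ℓ) ⊗ Λ(y_i) ⊗ P(z_i)` otherwise. In the first case `d x_i = y_i` on page
`n + 1` leaves only `1`. In the second case `d x_i^a = a x_i^{a-1} y_i` on page `n + 1` leaves the
monomials `z_i^c` and `x_i^{ℓ-1} y_i z_i^c`, and `d (x_i^{ℓ-1} y_i) = z_i` on page `(ℓ - 1) n + 1`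
leaves only `1`. The model is the tensor product of all elementary complexes and of `H`. Its basis
is indexed by *cells*, namely pairs of an exponent vector and an element of a homogeneous basis of
`H`. On each page a differential pairs off basis elements in each factor, so that a contraction
acting on the first factor in which a basis element is paired off computes the homology of the
tensor product: it has the cells that are paired off in no factor as a basis
(`MatchingFamily.sub_diff_contraction_mem`).

Cells are sent to products in `E_2`. This is not multiplicative, since `x_i^ℓ` need not vanish in
`E_2`, but it commutes with the differentials (`TransgressiveFamily.diffRel_cellMap`), where
`d_r [x] = [x']` is treated as the relation `DiffRel` between elements of `E_2` that survive to
`E_r`. So no maps of pages have to be chosen. On the limit page the model has only the basis of `H`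
left, and there it agrees with `E_∞ = H`.

Zeeman's argument (`CellularModel.comparison`) shows that if the model agrees with `E_2` in base
degrees `< N`, then it agrees with `E_2^{N,0}`. As `E_2 = W ⊗_H V` is a free right `V`-module on the
monomials in the `x_i` (`bijective_sum_mul`), agreement with `E_2^{n,0}` implies agreement with
`E_2^{n,q}` for all `q`. By induction, the products of the monomials in the `y_i`, `z_i` with a basis
of `H` form a basis of `V` (`TransgressiveFamily.base_row`). The ordered monomials span the free
graded-commutative algebra (`FreeGC.span_monomial`), so that, up to signs, `h ⊗ s ↦ h φ(s)` maps a
spanning set bijectively to a basis. -/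

namespace SpectralSeq

variable {F : Type} [Field F] {H : Type u} [Ring H] [Algebra F H] {𝓗 : ℕ → Submodule F H}
  (S : SpectralSeq.{u, v} 𝓗)

/-! ### Homogeneous cycles and boundaries -/

theorem proj_of_mem {r : ℕ} {i : ℕ × ℕ} {x : S.E r} (hx : x ∈ S.gr r i) :
    GradedAlgebra.proj (S.gr r) i x = x := by
  rw [GradedAlgebra.proj_apply, DirectSum.decompose_of_mem_same _ hx]

theorem proj_of_mem_ne {r : ℕ} {i j : ℕ × ℕ} {x : S.E r} (hx : x ∈ S.gr r i) (hij : i ≠ j) :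
    GradedAlgebra.proj (S.gr r) j x = 0 := by
  rw [GradedAlgebra.proj_apply, DirectSum.decompose_of_mem_ne _ hx hij]

theorem proj_mem {r : ℕ} (i : ℕ × ℕ) (x : S.E r) :
    GradedAlgebra.proj (S.gr r) i x ∈ S.gr r i := by
  rw [GradedAlgebra.proj_apply]; exact SetLike.coe_mem _

theorem induction_gr {r : ℕ} {motive : S.E r → Prop} (zero : motive 0)
    (mem : ∀ p q, ∀ x ∈ S.gr r (p, q), motive x)
    (add : ∀ x y, motive x → motive y → motive (x + y)) (x : S.E r) : motive x :=
  DirectSum.Decomposition.inductionOn (S.gr r) zero (fun {i} m => mem i.1 i.2 m m.2) add x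

theorem proj_d {r : ℕ} (hr : 2 ≤ r) {p q q' : ℕ} (hq : q' + r = q + 1) (x : S.E r) :
    GradedAlgebra.proj (S.gr r) (p + r, q') (S.d r x) =
      S.d r (GradedAlgebra.proj (S.gr r) (p, q) x) := by
  induction x using S.induction_gr with
  | zero => simp
  | add x y hx hy => simp only [map_add, hx, hy]
  | mem a b x hx =>
    by_cases hab : (a, b) = (p, q)
    · obtain ⟨rfl, rfl⟩ := Prod.mk.inj hab
      rw [S.proj_of_mem hx, S.proj_of_mem (S.d_mem r hr _ _ _ hq _ hx)]
    · rw [S.proj_of_mem_ne hx hab, map_zero]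
      rcases lt_or_ge (b + 1) r with hb | hb
      · rw [S.d_zero r hr a b hb x hx, map_zero]
      · obtain ⟨b', hb'⟩ := Nat.exists_eq_add_of_le' hb
        refine S.proj_of_mem_ne (S.d_mem r hr a b b' hb'.symm x hx) fun h => hab ?_
        simp only [Prod.mk.injEq] at h ⊢
        omega

theorem proj_d_of_lt {r : ℕ} (hr : 2 ≤ r) {p q : ℕ} (hp : p < r) (x : S.E r) :
    GradedAlgebra.proj (S.gr r) (p, q) (S.d r x) = 0 := by
  induction x using S.induction_gr with
  | zero => simp
  | add x y hx hy => simp only [map_add, hx, hy, add_zero]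
  | mem a b x hx =>
    rcases lt_or_ge (b + 1) r with hb | hb
    · rw [S.d_zero r hr a b hb x hx, map_zero]
    · obtain ⟨b', hb'⟩ := Nat.exists_eq_add_of_le' hb
      refine S.proj_of_mem_ne (S.d_mem r hr a b b' hb'.symm x hx) fun h => ?_
      simp only [Prod.mk.injEq] at h
      omega

theorem exists_boundary {r : ℕ} (hr : 2 ≤ r) {p q : ℕ} {z : S.E r} (hz : z ∈ S.gr r (p, q))
    {e : S.E r} (he : S.d r e = z) :
    z = 0 ∨ ∃ p₀ q₀, p₀ + r = p ∧ q₀ + 1 = q + r ∧ ∃ e₀ ∈ S.gr r (p₀, q₀), S.d r e₀ = z := by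
  rcases lt_or_ge p r with hp | hp
  · left
    rw [← S.proj_of_mem hz, ← he, S.proj_d_of_lt hr hp]
  · right
    obtain ⟨p₀, rfl⟩ := Nat.exists_eq_add_of_le' hp
    refine ⟨p₀, q + r - 1, rfl, by omega, _, S.proj_mem _ e, ?_⟩
    rw [← S.proj_d hr (q' := q) (by omega), he, S.proj_of_mem hz]

theorem d_proj_eq_zero {r : ℕ} (hr : 2 ≤ r) {x : S.E r} (hx : S.d r x = 0) (i : ℕ × ℕ) :
    S.d r (GradedAlgebra.proj (S.gr r) i x) = 0 := by
  rcases lt_or_ge (i.2 + 1) r with hb | hb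
  · exact S.d_zero r hr i.1 i.2 hb _ (S.proj_mem i x)
  · obtain ⟨b', hb'⟩ := Nat.exists_eq_add_of_le' hb
    rw [show i = (i.1, i.2) from rfl, ← S.proj_d hr hb'.symm, hx, map_zero]

/-- A homogeneous class of `E_{r+1}` is the class of a homogeneous cycle. -/
theorem exists_cycle {r : ℕ} (hr : 2 ≤ r) {i : ℕ × ℕ} {e : S.E (r + 1)}
    (he : e ∈ S.gr (r + 1) i) :
    ∃ x ∈ S.gr r i, ∃ hx : S.d r x = 0, S.π r ⟨x, hx⟩ = e := by
  classical
  obtain ⟨⟨x, hx⟩, rfl⟩ := S.π_surjective r hr e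
  have hx' : S.d r x = 0 := hx
  refine ⟨_, S.proj_mem i x, S.d_proj_eq_zero hr hx' i, ?_⟩
  let c : ℕ × ℕ → LinearMap.ker (S.d r) := fun j =>
    ⟨GradedAlgebra.proj (S.gr r) j x, S.d_proj_eq_zero hr hx' j⟩
  have hc : ∀ j, S.π r (c j) ∈ S.gr (r + 1) j := fun j => S.π_mem r hr j _ (S.proj_mem j x)
  have hsum : (⟨x, hx⟩ : LinearMap.ker (S.d r)) =
      ∑ j ∈ insert i (DirectSum.decompose (S.gr r) x).support, c j := by
    apply Subtype.ext
    rw [AddSubmonoidClass.coe_finsetSum]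
    refine (DirectSum.sum_support_decompose (S.gr r) x).symm.trans ?_
    refine Finset.sum_subset_zero_on_sdiff (Finset.subset_insert _ _) (fun j hj => ?_)
      fun j _ => rfl
    simp only [Finset.mem_sdiff, DFinsupp.mem_support_iff, not_not] at hj
    simp [c, GradedAlgebra.proj_apply, hj.2]
  change S.π r (c i) = _
  rw [← S.proj_of_mem he, hsum, map_sum, map_sum, Finset.sum_eq_single i]
  · exact (S.proj_of_mem (hc i)).symm
  · exact fun j _ hj => S.proj_of_mem_ne (hc j) hj
  · exact fun h => absurd (Finset.mem_insert_self _ _) h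

theorem d_mul_of_cycle {r : ℕ} (hr : 2 ≤ r) (x : S.E r) {y : S.E r} (hy : S.d r y = 0) :
    S.d r (x * y) = S.d r x * y := by
  induction x using S.induction_gr with
  | zero => simp
  | add a b ha hb => simp only [add_mul, map_add, ha, hb]
  | mem p q x hx => rw [S.leibniz r hr p q x hx, hy, mul_zero, smul_zero, add_zero]

/-! ### Elements of `E_2` surviving to `E_r` -/

variable {S}

theorem Survives.two_le {x : S.E 2} {r : ℕ} {e : S.E r} (h : S.Survives x r e) : 2 ≤ r := by
  induction h with
  | base => exact le_rfl
  | step _ _ ih => omega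

theorem Survives.inversion {x : S.E 2} {s : ℕ} {e : S.E s} (h : S.Survives x s e) :
    (s = 2 ∧ HEq e x) ∨ ∃ r, ∃ e₀, ∃ h₀ : S.d r e₀ = 0,
      s = r + 1 ∧ S.Survives x r e₀ ∧ HEq e (S.π r ⟨e₀, h₀⟩) := by
  cases h with
  | base => exact .inl ⟨rfl, HEq.rfl⟩
  | step he h => exact .inr ⟨_, _, he, rfl, h, HEq.rfl⟩

theorem survives_two_iff {x e : S.E 2} : S.Survives x 2 e ↔ e = x := by
  constructor
  · intro h
    rcases h.inversion with ⟨-, h⟩ | ⟨r, e₀, h₀, hr, h, -⟩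
    · exact eq_of_heq h
    · have := h.two_le; omega
  · rintro rfl; exact .base

theorem survives_succ_iff {x : S.E 2} {r : ℕ} (hr : 2 ≤ r) {e : S.E (r + 1)} :
    S.Survives x (r + 1) e ↔
      ∃ e₀, ∃ h₀ : S.d r e₀ = 0, S.Survives x r e₀ ∧ S.π r ⟨e₀, h₀⟩ = e := by
  constructor
  · intro h
    rcases h.inversion with ⟨h, -⟩ | ⟨r, e₀, h₀, hr, h, he⟩
    · omega
    · obtain rfl := Nat.succ_injective hr
      exact ⟨e₀, h₀, h, (eq_of_heq he).symm⟩
  · rintro ⟨e₀, h₀, h, rfl⟩; exact .step h₀ h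

theorem Survives.unique {x : S.E 2} {r : ℕ} {e e' : S.E r} (h : S.Survives x r e)
    (h' : S.Survives x r e') : e = e' := by
  have hr := h.two_le
  induction r, hr using Nat.le_induction with
  | base => rw [survives_two_iff.1 h, survives_two_iff.1 h']
  | succ r hr ih =>
    obtain ⟨e₀, h₀, hx, rfl⟩ := (survives_succ_iff hr).1 h
    obtain ⟨e₁, h₁, hx', rfl⟩ := (survives_succ_iff hr).1 h'
    obtain rfl := ih hx hx'
    rfl

theorem Survives.add {x y : S.E 2} {r : ℕ} {e f : S.E r} (h : S.Survives x r e)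
    (h' : S.Survives y r f) : S.Survives (x + y) r (e + f) := by
  have hr := h.two_le
  induction r, hr using Nat.le_induction with
  | base => rw [survives_two_iff.1 h, survives_two_iff.1 h']; exact .base
  | succ r hr ih =>
    obtain ⟨e₀, h₀, hx, rfl⟩ := (survives_succ_iff hr).1 h
    obtain ⟨e₁, h₁, hx', rfl⟩ := (survives_succ_iff hr).1 h'
    rw [← map_add]
    exact .step (by rw [map_add, h₀, h₁, add_zero]) (ih hx hx')

theorem Survives.smul {x : S.E 2} {r : ℕ} {e : S.E r} (h : S.Survives x r e) (c : F) :
    S.Survives (c • x) r (c • e) := by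
  have hr := h.two_le
  induction r, hr using Nat.le_induction with
  | base => rw [survives_two_iff.1 h]; exact .base
  | succ r hr ih =>
    obtain ⟨e₀, h₀, hx, rfl⟩ := (survives_succ_iff hr).1 h
    rw [← map_smul]
    exact .step (by rw [map_smul, h₀, smul_zero]) (ih hx)

theorem Survives.sub {x y : S.E 2} {r : ℕ} {e f : S.E r} (h : S.Survives x r e)
    (h' : S.Survives y r f) : S.Survives (x - y) r (e - f) := by
  simpa [sub_eq_add_neg] using h.add (h'.smul (-1))

theorem survives_zero {r : ℕ} (hr : 2 ≤ r) : S.Survives (0 : S.E 2) r 0 := by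
  induction r, hr using Nat.le_induction with
  | base => exact .base
  | succ r hr ih =>
    have h := ih.step (map_zero _)
    rwa [show (⟨0, map_zero _⟩ : LinearMap.ker (S.d r)) = 0 from rfl, map_zero] at h

theorem Survives.mul {x y : S.E 2} {r : ℕ} {e f : S.E r} (h : S.Survives x r e)
    (h' : S.Survives y r f) : S.Survives (x * y) r (e * f) := by
  have hr := h.two_le
  induction r, hr using Nat.le_induction with
  | base => rw [survives_two_iff.1 h, survives_two_iff.1 h']; exact .base
  | succ r hr ih =>
    obtain ⟨e₀, h₀, hx, rfl⟩ := (survives_succ_iff hr).1 h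
    obtain ⟨e₁, h₁, hx', rfl⟩ := (survives_succ_iff hr).1 h'
    have h₂ : S.d r (e₀ * e₁) = 0 := by rw [S.d_mul_of_cycle hr _ h₁, h₀, zero_mul]
    rw [← S.π_mul r hr _ _ ⟨_, h₂⟩ rfl]
    exact .step h₂ (ih hx hx')

theorem Survives.mem {x : S.E 2} {r : ℕ} {e : S.E r} (h : S.Survives x r e) {i : ℕ × ℕ}
    (hx : x ∈ S.gr 2 i) : e ∈ S.gr r i := by
  have hr := h.two_le
  induction r, hr using Nat.le_induction with
  | base => rwa [survives_two_iff.1 h]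
  | succ r hr ih =>
    obtain ⟨e₀, h₀, hx', rfl⟩ := (survives_succ_iff hr).1 h
    exact S.π_mem r hr i _ (ih hx')

theorem survives_η {r : ℕ} (hr : 2 ≤ r) (h : H) : S.Survives (S.η 2 h) r (S.η r h) := by
  induction r, hr using Nat.le_induction with
  | base => exact .base
  | succ r hr ih =>
    rw [← S.π_η r hr h ⟨_, S.d_η r hr h⟩ rfl]
    exact .step _ ih

/-! ### The differentials as relations on `E_2` -/

variable (S) in
/-- `S.DiffRel r x x'`: the elements `x`, `x'` of `E_2` survive to `E_r`, and `d_r [x] = [x']`. -/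
def DiffRel (r : ℕ) (x x' : S.E 2) : Prop :=
  ∃ e, S.Survives x r e ∧ S.Survives x' r (S.d r e)

theorem DiffRel.add {r : ℕ} {x x' y y' : S.E 2} (h : S.DiffRel r x x') (h' : S.DiffRel r y y') :
    S.DiffRel r (x + y) (x' + y') := by
  obtain ⟨e, h₁, h₂⟩ := h
  obtain ⟨f, h₃, h₄⟩ := h'
  exact ⟨e + f, h₁.add h₃, by rw [map_add]; exact h₂.add h₄⟩

theorem DiffRel.smul {r : ℕ} {x x' : S.E 2} (h : S.DiffRel r x x') (c : F) :
    S.DiffRel r (c • x) (c • x') := by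
  obtain ⟨e, h₁, h₂⟩ := h
  exact ⟨c • e, h₁.smul c, by rw [map_smul]; exact h₂.smul c⟩

theorem diffRel_zero {r : ℕ} (hr : 2 ≤ r) : S.DiffRel r (0 : S.E 2) 0 :=
  ⟨0, survives_zero hr, by rw [map_zero]; exact survives_zero hr⟩

theorem Survives.diffRel_zero {r : ℕ} {x : S.E 2} {e : S.E r} (h : S.Survives x r e)
    (he : S.d r e = 0) : S.DiffRel r x 0 :=
  ⟨e, h, by rw [he]; exact survives_zero h.two_le⟩

/-- The Leibniz rule. -/
theorem DiffRel.mul {r : ℕ} {x x' y y' : S.E 2} {p q : ℕ} (hx : x ∈ S.gr 2 (p, q))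
    (h : S.DiffRel r x x') (h' : S.DiffRel r y y') :
    S.DiffRel r (x * y) (x' * y + (-1 : F) ^ (p + q) • (x * y')) := by
  obtain ⟨e, h₁, h₂⟩ := h
  obtain ⟨f, h₃, h₄⟩ := h'
  refine ⟨e * f, h₁.mul h₃, ?_⟩
  rw [S.leibniz r h₁.two_le p q e (h₁.mem hx)]
  exact (h₂.mul h₃).add ((h₁.mul h₄).smul _)

theorem DiffRel.mul_zero {r : ℕ} {x x' y : S.E 2} (h : S.DiffRel r x x')
    (h' : S.DiffRel r y 0) : S.DiffRel r (x * y) (x' * y) := by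
  obtain ⟨e, h₁, h₂⟩ := h
  obtain ⟨f, h₃, h₄⟩ := h'
  refine ⟨e * f, h₁.mul h₃, ?_⟩
  rw [S.d_mul_of_cycle h₁.two_le e (h₄.unique (survives_zero h₁.two_le))]
  exact h₂.mul h₃

theorem diffRel_one {r : ℕ} (hr : 2 ≤ r) : S.DiffRel r (1 : S.E 2) 0 := by
  rw [← map_one (S.η 2)]
  exact (survives_η hr 1).diffRel_zero (S.d_η r hr 1)

theorem DiffRel.pow_zero {r : ℕ} (hr : 2 ≤ r) {x : S.E 2} (h : S.DiffRel r x 0) (n : ℕ) :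
    S.DiffRel r (x ^ n) 0 := by
  induction n with
  | zero => rw [_root_.pow_zero]; exact diffRel_one hr
  | succ n ih => rw [pow_succ]; simpa using ih.mul_zero h

theorem diffRel_η {r : ℕ} (hr : 2 ≤ r) (h : H) : S.DiffRel r (S.η 2 h) 0 :=
  (survives_η hr h).diffRel_zero (S.d_η r hr h)

/-- Elements of the base row are permanent cycles. -/
theorem diffRel_of_mem_row {r : ℕ} (hr : 2 ≤ r) {p : ℕ} {x : S.E 2} (hx : x ∈ S.gr 2 (p, 0)) :
    S.DiffRel r x 0 := by
  suffices ∃ e, S.Survives x r e by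
    obtain ⟨e, he⟩ := this
    exact he.diffRel_zero (S.d_zero r hr p 0 (by omega) e (he.mem hx))
  induction r, hr using Nat.le_induction with
  | base => exact ⟨x, .base⟩
  | succ r hr ih =>
    obtain ⟨e, he⟩ := ih
    exact ⟨_, .step (S.d_zero r hr p 0 (by omega) e (he.mem hx)) he⟩

theorem Survives.diffRel_of_lt {r s : ℕ} (hr : 2 ≤ r) {x : S.E 2} {e : S.E s}
    (h : S.Survives x s e) (hrs : r < s) : S.DiffRel r x 0 := by
  induction s, hrs using Nat.le_induction with
  | base =>
    obtain ⟨e₀, h₀, hx, -⟩ := (survives_succ_iff hr).1 h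
    exact hx.diffRel_zero h₀
  | succ s hs ih =>
    obtain ⟨e₀, h₀, hx, -⟩ := (survives_succ_iff (by omega)).1 h
    exact ih hx

theorem Transgresses.diffRel {p q : ℕ} {x y : S.E 2} (h : S.Transgresses p q x y) :
    S.DiffRel (q + 1) x y := by
  obtain ⟨-, -, e, f, h₁, h₂, rfl⟩ := h
  exact ⟨e, h₁, h₂⟩

theorem Transgresses.diffRel_of_lt {p q : ℕ} {x y : S.E 2} (h : S.Transgresses p q x y) {r : ℕ}
    (hr : 2 ≤ r) (hrq : r < q + 1) : S.DiffRel r x 0 := by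
  obtain ⟨-, -, e, f, h₁, h₂, rfl⟩ := h
  exact h₁.diffRel_of_lt hr hrq

theorem Transgresses.pos {p q : ℕ} {x y : S.E 2} (h : S.Transgresses p q x y) : 1 ≤ q := by
  obtain ⟨-, -, e, f, h₁, -⟩ := h
  have := h₁.two_le
  omega

end SpectralSeq

/-! ### Comparison of a spectral sequence with a cellular model -/

theorem supported_induction {F : Type*} [Field F] {J : Type*} {T : Set J}
    {motive : (J →₀ F) → Prop} (zero : motive 0)
    (single : ∀ j ∈ T, motive (Finsupp.single j 1))
    (add : ∀ m n, motive m → motive n → motive (m + n))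
    (smul : ∀ (c : F) m, motive m → motive (c • m))
    {m : J →₀ F} (hm : m ∈ Finsupp.supported F F T) : motive m := by
  rw [Finsupp.supported_eq_span_single] at hm
  induction hm using Submodule.span_induction with
  | mem x hx => obtain ⟨j, hj, rfl⟩ := hx; exact single j hj
  | zero => exact zero
  | add x y _ _ hx hy => exact add _ _ hx hy
  | smul c x _ hx => exact smul _ _ hx

namespace SpectralSeq

variable {F : Type} [Field F] {H : Type u} [Ring H] [Algebra F H] {𝓗 : ℕ → Submodule F H}
  (S : SpectralSeq.{u, v} 𝓗)

/-- A model of a spectral sequence with a basis: page `E'_r` of the model is the vector space on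
the cells in `alive r`, with differential `D r`; the alive cells form a decreasing sequence of
sets, and those surviving to page `r + 1` are cycles of `D r` representing its homology. The map
`f` to `E_2` commutes with all differentials, and is an isomorphism on the limit page. -/
structure CellularModel (J : Type*) where
  f : (J →₀ F) →ₗ[F] S.E 2
  bideg : J → ℕ × ℕ
  alive : ℕ → Set J
  D : ℕ → (J →₀ F) →ₗ[F] (J →₀ F)
  f_mem : ∀ j ∈ alive 2, f (Finsupp.single j 1) ∈ S.gr 2 (bideg j)
  alive_succ_subset : ∀ r, 2 ≤ r → alive (r + 1) ⊆ alive r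
  diffRel : ∀ r, 2 ≤ r → ∀ j ∈ alive r,
    S.DiffRel r (f (Finsupp.single j 1)) (f (D r (Finsupp.single j 1)))
  D_mem : ∀ r, 2 ≤ r → ∀ j ∈ alive r, D r (Finsupp.single j 1) ∈ Finsupp.supported F F
    {k | k ∈ alive r ∧ k ∉ alive (r + 1) ∧ (bideg k).1 = (bideg j).1 + r ∧
      (bideg k).2 + r = (bideg j).2 + 1}
  D_D : ∀ r, 2 ≤ r → ∀ m ∈ Finsupp.supported F F (alive r), D r (D r m) = 0
  D_eq_zero : ∀ r, 2 ≤ r → ∀ j ∈ alive (r + 1), D r (Finsupp.single j 1) = 0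
  exact : ∀ r, 2 ≤ r → ∀ p q,
    ∀ m ∈ Finsupp.supported F F {j | j ∈ alive r ∧ bideg j = (p, q)}, D r m = 0 →
    ∃ w ∈ Finsupp.supported F F
        {k | k ∈ alive r ∧ (bideg k).1 + r = p ∧ (bideg k).2 + 1 = q + r},
      m - D r w ∈ Finsupp.supported F F {j | j ∈ alive (r + 1) ∧ bideg j = (p, q)}
  limit_injective : ∀ r p q, max p (q + 1) < r → 2 ≤ r →
    ∀ m ∈ Finsupp.supported F F {j | j ∈ alive r ∧ bideg j = (p, q)},
      S.Survives (f m) r 0 → m = 0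
  limit_surjective : ∀ r p q, max p (q + 1) < r → 2 ≤ r → ∀ e ∈ S.gr r (p, q),
    ∃ m ∈ Finsupp.supported F F {j | j ∈ alive r ∧ bideg j = (p, q)}, S.Survives (f m) r e

namespace CellularModel

variable {S} {J : Type*} (M : S.CellularModel J)

/-- The bigraded pieces `E'_r^{p,q}` of the model. -/
def page (r p q : ℕ) : Submodule F (J →₀ F) :=
  Finsupp.supported F F {j | j ∈ M.alive r ∧ M.bideg j = (p, q)}

/-- Injectivity of `E'_r^{p,q} → E_r^{p,q}`. -/
def Inj (r p q : ℕ) : Prop := ∀ m ∈ M.page r p q, S.Survives (M.f m) r 0 → m = 0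

/-- Surjectivity of `E'_r^{p,q} → E_r^{p,q}`. -/
def Surj (r p q : ℕ) : Prop := ∀ e ∈ S.gr r (p, q), ∃ m ∈ M.page r p q, S.Survives (M.f m) r e

variable {M}

theorem alive_antitone {r s : ℕ} (hr : 2 ≤ r) (hrs : r ≤ s) : M.alive s ⊆ M.alive r := by
  induction s, hrs using Nat.le_induction with
  | base => exact subset_rfl
  | succ s hs ih => exact (M.alive_succ_subset s (hr.trans hs)).trans ih

theorem page_le_supported {r p q : ℕ} : M.page r p q ≤ Finsupp.supported F F (M.alive r) :=
  Finsupp.supported_mono fun _ h => h.1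

theorem page_succ_le {r p q : ℕ} (hr : 2 ≤ r) : M.page (r + 1) p q ≤ M.page r p q :=
  Finsupp.supported_mono fun _ h => ⟨M.alive_succ_subset r hr h.1, h.2⟩

theorem f_mem_gr {r p q : ℕ} (hr : 2 ≤ r) {m : J →₀ F} (hm : m ∈ M.page r p q) :
    M.f m ∈ S.gr 2 (p, q) := by
  refine supported_induction (motive := fun m => M.f m ∈ S.gr 2 (p, q)) (by simp) ?_ ?_ ?_ hm
  · rintro j ⟨hj, hpq⟩
    exact hpq ▸ M.f_mem j (alive_antitone le_rfl hr hj)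
  · intro m n hm hn; rw [map_add]; exact add_mem hm hn
  · intro c m hm; rw [map_smul]; exact Submodule.smul_mem _ _ hm

theorem diffRel_f {r : ℕ} (hr : 2 ≤ r) {m : J →₀ F}
    (hm : m ∈ Finsupp.supported F F (M.alive r)) : S.DiffRel r (M.f m) (M.f (M.D r m)) := by
  refine supported_induction (motive := fun m => S.DiffRel r (M.f m) (M.f (M.D r m)))
    ?_ (M.diffRel r hr) ?_ ?_ hm
  · simpa using diffRel_zero hr
  · intro m n hm hn; simpa using hm.add hn
  · intro c m hm; simpa using hm.smul c

theorem survives_D {r : ℕ} {m : J →₀ F} (hm : m ∈ Finsupp.supported F F (M.alive r))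
    {e : S.E r} (h : S.Survives (M.f m) r e) : S.Survives (M.f (M.D r m)) r (S.d r e) := by
  obtain ⟨e', h₁, h₂⟩ := diffRel_f h.two_le hm
  rwa [h.unique h₁]

theorem D_mem_page {r p q q' : ℕ} (hr : 2 ≤ r) (hq : q' + r = q + 1) {m : J →₀ F}
    (hm : m ∈ M.page r p q) : M.D r m ∈ M.page r (p + r) q' := by
  refine supported_induction (motive := fun m => M.D r m ∈ M.page r (p + r) q')
    (by simp) ?_ ?_ ?_ hm
  · rintro j ⟨hj, hpq⟩
    refine Finsupp.supported_mono ?_ (M.D_mem r hr j hj)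
    rintro k ⟨h₁, -, h₂, h₃⟩
    rw [hpq] at h₂ h₃
    exact ⟨h₁, Prod.ext h₂ (by simp only at h₃ ⊢; omega)⟩
  · intro m n hm hn; rw [map_add]; exact add_mem hm hn
  · intro c m hm; rw [map_smul]; exact Submodule.smul_mem _ _ hm

theorem D_eq_zero_of_lt {r p q : ℕ} (hr : 2 ≤ r) (hq : q + 1 < r) {m : J →₀ F}
    (hm : m ∈ M.page r p q) : M.D r m = 0 := by
  refine supported_induction (motive := fun m => M.D r m = 0) (by simp) ?_ ?_ ?_ hm
  · rintro j ⟨hj, hpq⟩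
    have h := M.D_mem r hr j hj
    rw [Finsupp.mem_supported'] at h
    ext k
    refine h k ?_
    rintro ⟨-, -, -, h₃⟩
    rw [hpq] at h₃
    simp only at h₃
    omega
  · intro m n hm hn; rw [map_add, hm, hn, add_zero]
  · intro c m hm; rw [map_smul, hm, smul_zero]

theorem D_eq_zero_of_succ {r p q : ℕ} (hr : 2 ≤ r) {m : J →₀ F}
    (hm : m ∈ M.page (r + 1) p q) : M.D r m = 0 := by
  refine supported_induction (motive := fun m => M.D r m = 0) (by simp) ?_ ?_ ?_ hm
  · rintro j ⟨hj, -⟩; exact M.D_eq_zero r hr j hj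
  · intro m n hm hn; rw [map_add, hm, hn, add_zero]
  · intro c m hm; rw [map_smul, hm, smul_zero]

/-- Differentials involve only cells that do not survive to the next page. -/
theorem D_mem_dead {r : ℕ} (hr : 2 ≤ r) {m : J →₀ F}
    (hm : m ∈ Finsupp.supported F F (M.alive r)) :
    M.D r m ∈ Finsupp.supported F F (M.alive (r + 1))ᶜ := by
  refine supported_induction
    (motive := fun m => M.D r m ∈ Finsupp.supported F F (M.alive (r + 1))ᶜ)
    (by simp) ?_ ?_ ?_ hm
  · intro j hj
    exact Finsupp.supported_mono (fun k hk => hk.2.1) (M.D_mem r hr j hj)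
  · intro m n hm hn; rw [map_add]; exact add_mem hm hn
  · intro c m hm; rw [map_smul]; exact Submodule.smul_mem _ _ hm

/-- The homology of `E'_r` is `E'_{r+1}`: a cycle is homologous to a cycle on `alive (r + 1)`. -/
theorem exists_reduction {r p q : ℕ} (hr : 2 ≤ r) {m : J →₀ F} (hm : m ∈ M.page r p q)
    (hD : M.D r m = 0) : ∃ w ∈ Finsupp.supported F F (M.alive r),
      m - M.D r w ∈ M.page (r + 1) p q ∧
      (w = 0 ∨ ∃ p₀ q₀, p₀ + r = p ∧ q₀ + 1 = q + r ∧ w ∈ M.page r p₀ q₀) := by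
  obtain ⟨w, hw, h⟩ := M.exact r hr p q m hm hD
  refine ⟨w, Finsupp.supported_mono (fun _ h => h.1) hw, h, ?_⟩
  rcases lt_or_ge p r with hp | hp
  · left
    rw [Finsupp.mem_supported'] at hw
    ext k
    refine hw k ?_
    rintro ⟨-, h, -⟩
    omega
  · right
    obtain ⟨p₀, rfl⟩ := Nat.exists_eq_add_of_le' hp
    refine ⟨p₀, q + r - 1, rfl, by omega, Finsupp.supported_mono ?_ hw⟩
    rintro k ⟨h₁, h₂, h₃⟩
    exact ⟨h₁, Prod.ext (by simp only; omega) (by simp only; omega)⟩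

/-- If `m` is a cycle with class `x`, then a reduction `m - D w` of it has class `π x`. -/
theorem survives_reduction {r : ℕ} (hr : 2 ≤ r) {m w : J →₀ F} {x : S.E r} (hx : S.d r x = 0)
    (hm : S.Survives (M.f m) r x) (hw : w ∈ Finsupp.supported F F (M.alive r)) :
    S.Survives (M.f (m - M.D r w)) (r + 1) (S.π r ⟨x, hx⟩) := by
  obtain ⟨g, h₁, h₂⟩ := diffRel_f hr hw
  have hd : S.d r (x - S.d r g) = 0 := by rw [map_sub, hx, S.d_d r hr, sub_zero]
  have key : S.π r ⟨x, hx⟩ = S.π r ⟨x - S.d r g, hd⟩ := by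
    rw [← sub_eq_zero, ← map_sub, S.π_eq_zero_iff r hr]
    exact ⟨g, by simp⟩
  rw [key, map_sub]
  exact .step hd (hm.sub h₂)

/-- If the class of `m` vanishes on page `r + 1`, it is a boundary on page `r`, and `m` is a boundary
of the model. As `m` consists of surviving cells, it is zero. -/
theorem inj_succ {r p q : ℕ} (hr : 2 ≤ r) (hi : M.Inj r p q)
    (hs : ∀ p₀ q₀, p₀ + r = p → M.Surj r p₀ q₀) : M.Inj (r + 1) p q := by
  intro m hm h
  obtain ⟨e₀, h₀, hx, hπ⟩ := (survives_succ_iff hr).1 h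
  obtain ⟨g, hg⟩ := (S.π_eq_zero_iff r hr _).1 hπ
  have he₀ : e₀ ∈ S.gr r (p, q) := hx.mem (f_mem_gr (by omega) hm)
  rcases S.exists_boundary hr he₀ hg with rfl | ⟨p₀, q₀, hp, hq, b, hb, rfl⟩
  · exact hi m (page_succ_le hr hm) hx
  · obtain ⟨w, hw, hwg⟩ := hs p₀ q₀ hp b hb
    have hw' := page_le_supported hw
    have hDw : M.D r w ∈ M.page r p q := hp ▸ D_mem_page hr hq.symm hw
    have hmw : m = M.D r w := by
      refine sub_eq_zero.1 (hi _ (sub_mem (page_succ_le hr hm) hDw) ?_)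
      have := hx.sub (survives_D hw' hwg)
      rwa [sub_self, ← map_sub] at this
    ext j
    by_cases hj : j ∈ M.alive (r + 1)
    · rw [hmw]
      exact (Finsupp.mem_supported' F _).1 (D_mem_dead hr hw') j (fun h => h hj)
    · exact (Finsupp.mem_supported' F _).1 hm j (fun h => hj h.1)

theorem surj_succ {r p q : ℕ} (hr : 2 ≤ r) (hs : M.Surj r p q)
    (hi : ∀ q', q' + r = q + 1 → M.Inj r (p + r) q') : M.Surj (r + 1) p q := by
  intro e he
  obtain ⟨x, hx, hdx, rfl⟩ := S.exists_cycle hr he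
  obtain ⟨m, hm, hmx⟩ := hs x hx
  have hD : M.D r m = 0 := by
    rcases lt_or_ge (q + 1) r with hq | hq
    · exact D_eq_zero_of_lt hr hq hm
    · obtain ⟨q', hq'⟩ := Nat.exists_eq_add_of_le' hq
      refine hi q' hq'.symm _ (D_mem_page hr hq'.symm hm) ?_
      rw [← hdx]
      exact survives_D (page_le_supported hm) hmx
  obtain ⟨w, hw, h, -⟩ := exists_reduction hr hm hD
  exact ⟨_, h, survives_reduction hr hdx hmx hw⟩

/-- The isomorphism `E'_2 ≅ E_2` in base degrees `< N` propagates to the later pages. -/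
theorem forward {N : ℕ} (hi : ∀ p < N, ∀ q, M.Inj 2 p q) (hs : ∀ p < N, ∀ q, M.Surj 2 p q)
    {r : ℕ} (hr : 2 ≤ r) :
    (∀ p < N, ∀ q, M.Inj r p q) ∧ ∀ p, p + r ≤ N → ∀ q, M.Surj r p q := by
  induction r, hr using Nat.le_induction with
  | base => exact ⟨hi, fun p hp => hs p (by omega)⟩
  | succ r hr ih =>
    exact ⟨fun p hp q => inj_succ hr (ih.1 p hp q) fun p₀ q₀ h => ih.2 p₀ (by omega) q₀,
      fun p hp q => surj_succ hr (ih.2 p (by omega) q) fun q' _ => ih.1 (p + r) (by omega) q'⟩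

/-- A permanent cycle whose class on page `r + 1` comes from the model comes from the model on
page `r` if the incoming differential does. -/
theorem surj_of_succ {r p q : ℕ} (hr : 2 ≤ r) (hq : q + 1 < r) (h : M.Surj (r + 1) p q)
    (hs : ∀ p₀ q₀, p₀ + r = p → M.Surj r p₀ q₀) : M.Surj r p q := by
  intro e he
  have hde := S.d_zero r hr p q hq e he
  obtain ⟨m, hm, hme⟩ := h _ (S.π_mem r hr _ ⟨e, hde⟩ he)
  obtain ⟨e', h', hme', hπ⟩ := (survives_succ_iff hr).1 hme
  have hπ' : S.π r (⟨e, hde⟩ - ⟨e', h'⟩) = 0 := by rw [map_sub, hπ, sub_self]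
  obtain ⟨g, hg⟩ := (S.π_eq_zero_iff r hr _).1 hπ'
  have hg' : S.d r g = e - e' := hg
  have hmem : e - e' ∈ S.gr r (p, q) :=
    sub_mem he (hme'.mem (f_mem_gr (by omega) hm))
  rcases S.exists_boundary hr hmem hg' with h0 | ⟨p₀, q₀, hp, hq₀, g, hg, hgz⟩
  · exact ⟨m, page_succ_le hr hm, by rwa [sub_eq_zero.1 h0]⟩
  · obtain ⟨w, hw, hwg⟩ := hs p₀ q₀ hp g hg
    refine ⟨m + M.D r w,
      add_mem (page_succ_le hr hm) (hp ▸ D_mem_page hr hq₀.symm hw), ?_⟩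
    have := hme'.add (survives_D (page_le_supported hw) hwg)
    rwa [hgz, add_sub_cancel, ← map_add] at this

/-- Descending induction from the limit page: no differential leaves `E_r^{p,q}` if `q + 1 < r`. -/
theorem surj_backward {N p q : ℕ} (hs : ∀ r, 2 ≤ r → ∀ p, p + r ≤ N → ∀ q, M.Surj r p q)
    (hp : p ≤ N) {r : ℕ} (hr : 2 ≤ r) (hq : q + 1 < r) : M.Surj r p q := by
  have hlim : M.Surj (max p (q + 1) + 1 + r) p q :=
    M.limit_surjective _ p q (by omega) (by omega)
  generalize max p (q + 1) + 1 = k at hlim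
  induction k generalizing r with
  | zero => rwa [zero_add] at hlim
  | succ k ih =>
    refine surj_of_succ hr hq (ih (by omega) (by omega) ?_) fun p₀ q₀ h => hs r hr p₀ (by omega) q₀
    rwa [show k + (r + 1) = k + 1 + r by omega]

/-- The descending step for injectivity in the base row: an element that vanishes in `E_r^{N,0}` is a
boundary `D w` of the model, and the class of `w` is then a cycle. -/
theorem inj_of_succ {N r : ℕ} (hr : 2 ≤ r) (hi : ∀ p < N, ∀ q, M.Inj r p q)
    (hs : ∀ p, p + r ≤ N → ∀ q, M.Surj r p q)
    (hs' : ∀ p ≤ N, ∀ q, q + 1 < r + 1 → M.Surj (r + 1) p q)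
    (h : M.Inj (r + 1) N 0) : M.Inj r N 0 := by
  intro a ha hfa
  obtain ⟨w, hw, haw, hw'⟩ := exists_reduction hr ha (D_eq_zero_of_lt hr (by omega) ha)
  have haw' : a = M.D r w := by
    refine sub_eq_zero.1 (h _ haw ?_)
    have := survives_reduction hr (map_zero _) hfa hw
    rwa [show (⟨0, map_zero _⟩ : LinearMap.ker (S.d r)) = 0 from rfl, map_zero] at this
  rcases hw' with rfl | ⟨p₀, q₀, hp₀, hq₀, hwp⟩
  · rw [haw', map_zero]
  obtain ⟨e, h₁, h₂⟩ := diffRel_f hr hw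
  have hde : S.d r e = 0 := by
    rw [← haw'] at h₂
    exact h₂.unique hfa
  have hegr : e ∈ S.gr r (p₀, q₀) := h₁.mem (f_mem_gr hr hwp)
  -- The class of `w` on page `r + 1` is in bidegree `(N - r, r - 1)`, which is too low to support
  -- a further differential, so that it comes from a cycle `c` of the model.
  obtain ⟨c, hc, hce⟩ := hs' p₀ (by omega) q₀ (by omega) _ (S.π_mem r hr _ ⟨e, hde⟩ hegr)
  obtain ⟨e', h', hce', hπ⟩ := (survives_succ_iff hr).1 hce
  have hπ' : S.π r (⟨e, hde⟩ - ⟨e', h'⟩) = 0 := by rw [map_sub, hπ, sub_self]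
  obtain ⟨g, hg⟩ := (S.π_eq_zero_iff r hr _).1 hπ'
  have hg' : S.d r g = e - e' := hg
  have hmem : e - e' ∈ S.gr r (p₀, q₀) :=
    sub_mem hegr (hce'.mem (f_mem_gr (by omega) hc))
  have hc' := page_succ_le hr hc
  have hDc := D_eq_zero_of_succ hr hc
  rcases S.exists_boundary hr hmem hg' with h0 | ⟨p₁, q₁, hp₁, hq₁, g, hg, hgz⟩
  · have hwc : w = c := by
      refine sub_eq_zero.1 (hi p₀ (by omega) q₀ _ (sub_mem hwp hc') ?_)
      have := h₁.sub hce'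
      rwa [h0, ← map_sub] at this
    rw [haw', hwc, hDc]
  · obtain ⟨b, hb, hbg⟩ := hs p₁ (by omega) q₁ g hg
    have hb' := page_le_supported hb
    have hwc : w - c = M.D r b := by
      refine sub_eq_zero.1 (hi p₀ (by omega) q₀ _
        (sub_mem (sub_mem hwp hc') (hp₁ ▸ D_mem_page hr hq₁.symm hb)) ?_)
      have := (h₁.sub hce').sub (survives_D hb' hbg)
      rwa [hgz, sub_self, ← map_sub, ← map_sub] at this
    rw [haw', show w = M.D r b + c by rw [← hwc, sub_add_cancel], map_add, hDc,
      M.D_D r hr b hb', add_zero]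

/-- Zeeman's comparison argument: an isomorphism `E'_2 ≅ E_2` in base degrees `< N` extends to the
base row in degree `N`. -/
theorem comparison {N : ℕ} (hi : ∀ p < N, ∀ q, M.Inj 2 p q) (hs : ∀ p < N, ∀ q, M.Surj 2 p q) :
    M.Inj 2 N 0 ∧ M.Surj 2 N 0 := by
  have hs₁ : ∀ r, 2 ≤ r → ∀ p, p + r ≤ N → ∀ q, M.Surj r p q := fun r hr => (forward hi hs hr).2
  refine ⟨?_, surj_backward hs₁ le_rfl le_rfl (by omega)⟩
  suffices ∀ k r, 2 ≤ r → M.Inj (k + r) N 0 → M.Inj r N 0 from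
    this (max N 1 + 1) 2 le_rfl (M.limit_injective _ N 0 (by omega) (by omega))
  intro k
  induction k with
  | zero => intro r _ h; rwa [zero_add] at h
  | succ k ih =>
    intro r hr h
    refine inj_of_succ hr (forward hi hs hr).1 (hs₁ r hr)
      (fun p hp q hq => surj_backward hs₁ hp (by omega) hq) (ih (r + 1) (by omega) ?_)
    rwa [show k + (r + 1) = k + 1 + r by omega]

end CellularModel

end SpectralSeq

/-! ### Tensor products of elementary complexes -/

/-- A family, indexed by `i : I`, of based complexes with basis `L`, each of which is a sum of
complexes `F → F` and `F` with zero differential: the differential of a basis element `l ∈ src i`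
is `coef i l • up i l`, and that of the other basis elements is zero. The function `down` is
inverse to `up`, and `ε i l` is the sign of the degree of `l`. The basis element `0` represents the
unit. -/
structure MatchingFamily (F : Type*) [Field F] (I L : Type*) [Zero L] where
  ε : I → L → F
  src : I → Set L
  tgt : I → Set L
  up : I → L → L
  down : I → L → L
  coef : I → L → F
  ε_zero : ∀ i, ε i 0 = 1
  ε_mul_self : ∀ i l, ε i l * ε i l = 1
  up_mem : ∀ i, ∀ l ∈ src i, up i l ∈ tgt i
  down_mem : ∀ i, ∀ l ∈ tgt i, down i l ∈ src i
  down_up : ∀ i, ∀ l ∈ src i, down i (up i l) = l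
  up_down : ∀ i, ∀ l ∈ tgt i, up i (down i l) = l
  notMem_tgt : ∀ i, ∀ l ∈ src i, l ∉ tgt i
  zero_notMem_src : ∀ i, 0 ∉ src i
  zero_notMem_tgt : ∀ i, 0 ∉ tgt i
  coef_ne_zero : ∀ i, ∀ l ∈ src i, coef i l ≠ 0
  ε_up : ∀ i, ∀ l ∈ src i, ε i (up i l) = -ε i l

namespace MatchingFamily

variable {F : Type*} [Field F] {I L : Type*} [Zero L] (C : MatchingFamily F I L) (β : Type*)

theorem ε_down (i : I) {l : L} (h : l ∈ C.tgt i) : C.ε i (C.down i l) = -C.ε i l := by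
  have := C.ε_up i _ (C.down_mem i l h)
  rw [C.up_down i l h] at this
  rw [this, neg_neg]

theorem ne_zero_of_mem_src {k : I} {l : L} (h : l ∈ C.src k) : l ≠ 0 :=
  fun h0 => C.zero_notMem_src k (h0 ▸ h)

theorem ne_zero_of_mem_tgt {k : I} {l : L} (h : l ∈ C.tgt k) : l ≠ 0 :=
  fun h0 => C.zero_notMem_tgt k (h0 ▸ h)

variable [LinearOrder I]

/-- The sign of the part of `m` to the left of `k`. -/
noncomputable def sgn (m : I →₀ L) (k : I) : F :=
  m.prod fun j l => if j < k then C.ε j l else 1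

theorem sgn_update (m : I →₀ L) (i k : I) (l : L) :
    C.sgn (m.update i l) k * C.ε i (m i) ^ (if i < k then 1 else 0) =
      C.sgn m k * C.ε i l ^ (if i < k then 1 else 0) := by
  classical
  have h0 : ∀ j : I, (if j < k then C.ε j 0 else 1) = 1 := fun j => by simp [C.ε_zero]
  unfold sgn
  rw [← Finsupp.mul_prod_erase' m i _ h0,
    ← Finsupp.mul_prod_erase' (m.update i l) i _ h0, Finsupp.erase_update_eq_erase,
    Finsupp.update_apply, if_pos rfl]
  split_ifs <;> ring

theorem sgn_update_of_le (m : I →₀ L) {i k : I} (l : L) (h : k ≤ i) :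
    C.sgn (m.update i l) k = C.sgn m k := by
  simpa [h.not_gt] using C.sgn_update m i k l

theorem sgn_update_of_lt (m : I →₀ L) {i k : I} (l : L) (h : i < k)
    (hl : C.ε i l = -C.ε i (m i)) : C.sgn (m.update i l) k = -C.sgn m k := by
  have h₁ := C.sgn_update m i k l
  rw [if_pos h, pow_one, pow_one, hl] at h₁
  have h₂ := C.ε_mul_self i (m i)
  linear_combination C.ε i (m i) * h₁ + (-C.sgn m k - C.sgn (m.update i l) k) * h₂

theorem sgn_mul_self (m : I →₀ L) (k : I) : C.sgn m k * C.sgn m k = 1 := by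
  unfold sgn
  rw [← Finsupp.prod_mul]
  refine Finset.prod_eq_one fun j _ => ?_
  dsimp only
  split_ifs
  · exact C.ε_mul_self _ _
  · exact one_mul _

open Classical in
/-- The contribution of the factor `k` to the differential of the basis element `m`. -/
noncomputable def term (k : I) (m : (I →₀ L) × β) : (I →₀ L) × β →₀ F :=
  if m.1 k ∈ C.src k then
    Finsupp.single (m.1.update k (C.up k (m.1 k)), m.2) (C.sgn m.1 k * C.coef k (m.1 k))
  else 0

/-- The operator `term k` extended linearly. -/
noncomputable def partialDiff (k : I) : ((I →₀ L) × β →₀ F) →ₗ[F] ((I →₀ L) × β →₀ F) :=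
  Finsupp.linearCombination F (C.term β k)

/-- The differential of the tensor product of the complexes, with trivial coefficients `β`. -/
noncomputable def diff : ((I →₀ L) × β →₀ F) →ₗ[F] ((I →₀ L) × β →₀ F) :=
  Finsupp.linearCombination F fun m => ∑ k ∈ m.1.support, C.term β k m

variable {β}

theorem diff_single (m : (I →₀ L) × β) (c : F) :
    C.diff β (Finsupp.single m c) = c • ∑ k ∈ m.1.support, C.term β k m := by
  simp [diff]

theorem partialDiff_single (k : I) (m : (I →₀ L) × β) (c : F) :
    C.partialDiff β k (Finsupp.single m c) = c • C.term β k m := by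
  simp [partialDiff]

theorem term_of_mem {k : I} {m : I →₀ L} (b : β) (h : m k ∈ C.src k) : C.term β k (m, b) =
    Finsupp.single (m.update k (C.up k (m k)), b) (C.sgn m k * C.coef k (m k)) := if_pos h

theorem term_of_notMem {k : I} {m : I →₀ L} (b : β) (h : m k ∉ C.src k) :
    C.term β k (m, b) = 0 := if_neg h

theorem support_update {k : I} {m : I →₀ L} {l : L} (h : m k ≠ 0) (h' : l ≠ 0) :
    (m.update k l).support = m.support := by
  classical
  ext j
  simp only [Finsupp.mem_support_iff, Finsupp.update_apply]
  split_ifs with hj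
  · subst hj; simp [h, h']
  · rfl

theorem support_update_up {k : I} {m : I →₀ L} (h : m k ∈ C.src k) :
    (m.update k (C.up k (m k))).support = m.support :=
  support_update (C.ne_zero_of_mem_src h) (C.ne_zero_of_mem_tgt (C.up_mem k _ h))

theorem update_apply_of_ne {m : I →₀ L} {i j : I} {l : L} (h : j ≠ i) : m.update i l j = m j := by
  classical
  rw [Finsupp.update_apply, if_neg h]

theorem update_apply_self {m : I →₀ L} {i : I} {l : L} : m.update i l i = l := by
  classical
  rw [Finsupp.update_apply, if_pos rfl]

theorem diff_term {k : I} (m : (I →₀ L) × β) :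
    C.diff β (C.term β k m) = ∑ k' ∈ m.1.support, C.partialDiff β k' (C.term β k m) := by
  obtain ⟨m, b⟩ := m
  by_cases h : m k ∈ C.src k
  · rw [C.term_of_mem b h, diff_single, C.support_update_up h, Finset.smul_sum]
    exact Finset.sum_congr rfl fun k' _ => (C.partialDiff_single _ _ _).symm
  · simp [C.term_of_notMem b h]

theorem partialDiff_term_self (k : I) (m : (I →₀ L) × β) :
    C.partialDiff β k (C.term β k m) = 0 := by
  obtain ⟨m, b⟩ := m
  by_cases h : m k ∈ C.src k
  · rw [C.term_of_mem b h, partialDiff_single, C.term_of_notMem b, smul_zero]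
    rw [update_apply_self]
    exact fun h' => C.notMem_tgt k _ h' (C.up_mem k _ h)
  · rw [C.term_of_notMem b h, map_zero]

theorem partialDiff_term_of_lt {k k' : I} (hk : k < k') (m : (I →₀ L) × β) :
    C.partialDiff β k' (C.term β k m) + C.partialDiff β k (C.term β k' m) = 0 := by
  obtain ⟨m, b⟩ := m
  by_cases h : m k ∈ C.src k
  · by_cases h' : m k' ∈ C.src k'
    · have e : (m.update k (C.up k (m k))) k' = m k' := update_apply_of_ne hk.ne'
      have e' : (m.update k' (C.up k' (m k'))) k = m k := update_apply_of_ne hk.ne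
      rw [C.term_of_mem b h, C.term_of_mem b h', partialDiff_single, partialDiff_single,
        C.term_of_mem b (by rwa [e]), C.term_of_mem b (by rwa [e']), e, e',
        C.sgn_update_of_lt m _ hk (C.ε_up k _ h), C.sgn_update_of_le m _ hk.le,
        Finsupp.update_comm m hk.ne, Finsupp.smul_single, Finsupp.smul_single,
        ← Finsupp.single_add, ← Finsupp.single_zero]
      congr 1
      simp only [smul_eq_mul]
      ring
    · rw [C.term_of_notMem b h', map_zero, add_zero, C.term_of_mem b h, partialDiff_single,
        C.term_of_notMem b (by rwa [update_apply_of_ne hk.ne']), smul_zero]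
  · rw [C.term_of_notMem b h, map_zero, zero_add]
    by_cases h' : m k' ∈ C.src k'
    · rw [C.term_of_mem b h', partialDiff_single,
        C.term_of_notMem b (by rwa [update_apply_of_ne hk.ne]), smul_zero]
    · rw [C.term_of_notMem b h', map_zero]

theorem partialDiff_term_comm (k k' : I) (m : (I →₀ L) × β) :
    C.partialDiff β k' (C.term β k m) + C.partialDiff β k (C.term β k' m) = 0 := by
  rcases lt_trichotomy k k' with h | rfl | h
  · exact C.partialDiff_term_of_lt h m
  · rw [partialDiff_term_self, add_zero]
  · rw [add_comm]; exact C.partialDiff_term_of_lt h m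

/-- The contributions of two different factors anticommute, and that of one factor squares to zero. -/
theorem diff_diff (x : (I →₀ L) × β →₀ F) : C.diff β (C.diff β x) = 0 := by
  induction x using Finsupp.induction_linear with
  | zero => simp
  | add x y hx hy => rw [map_add, map_add, hx, hy, add_zero]
  | single m c =>
    rw [diff_single, map_smul, map_sum]
    simp only [diff_term]
    rw [← Finset.sum_product', Finset.sum_involution (fun a _ => a.swap), smul_zero]
    · exact fun a _ => C.partialDiff_term_comm _ _ _
    · rintro ⟨a, a'⟩ _ hne h
      obtain rfl : a' = a := congrArg Prod.fst h
      exact hne (C.partialDiff_term_self _ _)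
    · intro a ha
      simp only [Finset.mem_product, Prod.fst_swap, Prod.snd_swap] at ha ⊢
      exact ha.symm
    · exact fun a _ => Prod.swap_swap a

/-- `i` is the first index at which `m` is matched. -/
def IsFirst (m : I →₀ L) (i : I) : Prop :=
  (m i ∈ C.src i ∨ m i ∈ C.tgt i) ∧ ∀ j < i, m j ∉ C.src j ∧ m j ∉ C.tgt j

/-- `m` is matched at no index. -/
def IsCritical (m : I →₀ L) : Prop := ∀ i, m i ∉ C.src i ∧ m i ∉ C.tgt i

theorem IsFirst.unique {m : I →₀ L} {i j : I} (hi : C.IsFirst m i) (hj : C.IsFirst m j) :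
    i = j := by
  rcases lt_trichotomy i j with h | h | h
  · have := hj.2 i h; have := hi.1; tauto
  · exact h
  · have := hi.2 j h; have := hj.1; tauto

theorem exists_isFirst {m : I →₀ L} (h : ¬C.IsCritical m) : ∃ i, C.IsFirst m i := by
  classical
  let s := m.support.filter fun i => m i ∈ C.src i ∨ m i ∈ C.tgt i
  have hmem : ∀ i, i ∈ s ↔ m i ∈ C.src i ∨ m i ∈ C.tgt i := by
    intro i
    simp only [s, Finset.mem_filter, Finsupp.mem_support_iff, and_iff_right_iff_imp]
    rintro (h | h)
    · exact C.ne_zero_of_mem_src h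
    · exact C.ne_zero_of_mem_tgt h
  have hs : s.Nonempty := by
    simp only [IsCritical, not_forall] at h
    obtain ⟨i, hi⟩ := h
    exact ⟨i, (hmem i).2 (by tauto)⟩
  refine ⟨s.min' hs, (hmem _).1 (s.min'_mem hs), fun j hj => ?_⟩
  have : j ∉ s := fun h => (s.min'_le j h).not_gt hj
  rw [hmem] at this
  tauto

open Classical in
/-- The value at a basis element of the contraction inverting the differential of the factor at
the first matched index. -/
noncomputable def contractionTerm (m : (I →₀ L) × β) : (I →₀ L) × β →₀ F :=
  if h : ∃ i, C.IsFirst m.1 i ∧ m.1 i ∈ C.tgt i then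
    Finsupp.single (m.1.update h.choose (C.down h.choose (m.1 h.choose)), m.2)
      (C.sgn m.1 h.choose * (C.coef h.choose (C.down h.choose (m.1 h.choose)))⁻¹)
  else 0

/-- The contraction of the tensor product complex onto the span of the critical elements. -/
noncomputable def contraction : ((I →₀ L) × β →₀ F) →ₗ[F] ((I →₀ L) × β →₀ F) :=
  Finsupp.linearCombination F C.contractionTerm

theorem contraction_single (m : (I →₀ L) × β) (c : F) :
    C.contraction (Finsupp.single m c) = c • C.contractionTerm m := by
  simp [contraction]

theorem contractionTerm_of_tgt {m : I →₀ L} (b : β) {i : I} (hi : C.IsFirst m i)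
    (h : m i ∈ C.tgt i) : C.contractionTerm (m, b) =
      Finsupp.single (m.update i (C.down i (m i)), b)
        (C.sgn m i * (C.coef i (C.down i (m i)))⁻¹) := by
  have h' : ∃ i, C.IsFirst m i ∧ m i ∈ C.tgt i := ⟨i, hi, h⟩
  obtain rfl : i = h'.choose := hi.unique C h'.choose_spec.1
  exact dif_pos h'

theorem contractionTerm_of_src {m : I →₀ L} (b : β) {i : I} (hi : C.IsFirst m i)
    (h : m i ∈ C.src i) : C.contractionTerm (m, b) = 0 := by
  refine dif_neg ?_
  rintro ⟨j, hj, hj'⟩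
  obtain rfl := hi.unique C hj
  exact C.notMem_tgt _ _ h hj'

theorem contractionTerm_of_isCritical {m : I →₀ L} (b : β) (h : C.IsCritical m) :
    C.contractionTerm (m, b) = 0 := by
  refine dif_neg ?_
  rintro ⟨j, -, hj⟩
  exact (h j).2 hj

theorem isFirst_update {m : I →₀ L} {i k : I} (hi : C.IsFirst m i) (hik : i < k) (l : L) :
    C.IsFirst (m.update k l) i := by
  refine ⟨by rw [update_apply_of_ne hik.ne]; exact hi.1, fun j hj => ?_⟩
  rw [update_apply_of_ne (hj.trans hik).ne]
  exact hi.2 j hj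

theorem isFirst_update_self {m : I →₀ L} {i : I} (hi : C.IsFirst m i) {l : L}
    (hl : l ∈ C.src i ∨ l ∈ C.tgt i) : C.IsFirst (m.update i l) i := by
  refine ⟨by rwa [update_apply_self], fun j hj => ?_⟩
  rw [update_apply_of_ne hj.ne]
  exact hi.2 j hj

theorem contraction_term_of_src {m : I →₀ L} (b : β) {i : I} (hi : C.IsFirst m i)
    (h : m i ∈ C.src i) (k : I) (hk : k ≠ i) : C.contraction (C.term β k (m, b)) = 0 := by
  by_cases hks : m k ∈ C.src k
  · have hik : i < k := by
      refine lt_of_le_of_ne (not_lt.1 fun h => (hi.2 k h).1 hks) hk.symm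
    rw [C.term_of_mem b hks, contraction_single,
      C.contractionTerm_of_src b (C.isFirst_update hi hik _), smul_zero]
    rwa [update_apply_of_ne hik.ne]
  · rw [C.term_of_notMem b hks, map_zero]

theorem contraction_term_self {m : I →₀ L} (b : β) {i : I} (hi : C.IsFirst m i)
    (h : m i ∈ C.src i) : C.contraction (C.term β i (m, b)) = Finsupp.single (m, b) 1 := by
  have ht := C.up_mem i _ h
  rw [C.term_of_mem b h, contraction_single,
    C.contractionTerm_of_tgt b (C.isFirst_update_self hi (.inr ht)) (by rwa [update_apply_self]),
    update_apply_self, C.down_up i _ h, C.sgn_update_of_le _ _ le_rfl, Finsupp.smul_single]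
  congr 1
  · rw [Finsupp.update_idem, Finsupp.update_self]
  · have := C.coef_ne_zero i _ h
    rw [smul_eq_mul]
    field_simp
    rw [pow_two, C.sgn_mul_self]

theorem contraction_term_of_tgt {m : I →₀ L} (b : β) {i : I} (hi : C.IsFirst m i)
    (h : m i ∈ C.tgt i) (k : I) (hk : k ≠ i) :
    (C.sgn m i * (C.coef i (C.down i (m i)))⁻¹) •
      C.term β k (m.update i (C.down i (m i)), b) + C.contraction (C.term β k (m, b)) = 0 := by
  have e : (m.update i (C.down i (m i))) k = m k := update_apply_of_ne hk
  by_cases hks : m k ∈ C.src k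
  · have hik : i < k := by
      refine lt_of_le_of_ne (not_lt.1 fun h => (hi.2 k h).1 hks) hk.symm
    have e' : (m.update k (C.up k (m k))) i = m i := update_apply_of_ne hik.ne
    rw [C.term_of_mem b hks, contraction_single,
      C.contractionTerm_of_tgt b (C.isFirst_update hi hik _) (by rwa [e']), e',
      C.term_of_mem b (by rwa [e]), e, C.sgn_update_of_lt m _ hik (C.ε_down i h),
      C.sgn_update_of_le m _ hik.le, Finsupp.update_comm m hk, Finsupp.smul_single,
      Finsupp.smul_single, ← Finsupp.single_add, ← Finsupp.single_zero]
    congr 1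
    simp only [smul_eq_mul]
    ring
  · rw [C.term_of_notMem b hks, C.term_of_notMem b (by rwa [e]), map_zero, smul_zero, add_zero]

theorem diff_single_of_isCritical {m : I →₀ L} (h : C.IsCritical m) (b : β) (c : F) :
    C.diff β (Finsupp.single (m, b) c) = 0 := by
  rw [diff_single, Finset.sum_eq_zero, smul_zero]
  exact fun k _ => C.term_of_notMem b (h k).1

theorem homotopy_of_not_isCritical {m : I →₀ L} (h : ¬C.IsCritical m) (b : β) :
    C.diff β (C.contraction (Finsupp.single (m, b) 1)) +
      C.contraction (C.diff β (Finsupp.single (m, b) 1)) = Finsupp.single (m, b) 1 := by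
  classical
  obtain ⟨i, hi⟩ := C.exists_isFirst h
  rw [diff_single, contraction_single, one_smul, one_smul, map_sum]
  rcases hi.1 with hs | ht
  · rw [C.contractionTerm_of_src b hi hs, map_zero, zero_add, Finset.sum_eq_single i]
    · exact C.contraction_term_self b hi hs
    · exact fun k _ hk => C.contraction_term_of_src b hi hs k hk
    · exact fun h => absurd (Finsupp.notMem_support_iff.1 h) (C.ne_zero_of_mem_src hs)
  · have hd := C.down_mem i _ ht
    have hmem : i ∈ m.support := Finsupp.mem_support_iff.2 (C.ne_zero_of_mem_tgt ht)
    rw [C.contractionTerm_of_tgt b hi ht, diff_single,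
      support_update (C.ne_zero_of_mem_tgt ht) (C.ne_zero_of_mem_src hd), Finset.smul_sum,
      ← Finset.sum_add_distrib, Finset.sum_eq_single i]
    · rw [C.term_of_notMem b (m := m) fun h => C.notMem_tgt i _ h ht, map_zero, add_zero,
        C.term_of_mem b (by rwa [update_apply_self]), update_apply_self, C.up_down i _ ht,
        C.sgn_update_of_le _ _ le_rfl, Finsupp.smul_single]
      congr 1
      · rw [Finsupp.update_idem, Finsupp.update_self]
      · have := C.coef_ne_zero i _ hd
        rw [smul_eq_mul]
        field_simp
        rw [pow_two, C.sgn_mul_self]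
    · exact fun k _ hk => C.contraction_term_of_tgt b hi ht k hk
    · exact fun h => absurd hmem h

/-- A cycle is homologous to a combination of critical elements. -/
theorem sub_diff_contraction_mem {T : Set ((I →₀ L) × β)} {z : (I →₀ L) × β →₀ F}
    (hz : z ∈ Finsupp.supported F F T) (hd : C.diff β z = 0) :
    z - C.diff β (C.contraction z) ∈
      Finsupp.supported F F {m | m ∈ T ∧ C.IsCritical m.1} := by
  suffices z - C.diff β (C.contraction z) - C.contraction (C.diff β z) ∈
      Finsupp.supported F F {m | m ∈ T ∧ C.IsCritical m.1} by
    rwa [hd, map_zero, sub_zero] at this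
  clear hd
  refine supported_induction (motive := fun z =>
    z - C.diff β (C.contraction z) - C.contraction (C.diff β z) ∈
      Finsupp.supported F F {m | m ∈ T ∧ C.IsCritical m.1}) (by simp) ?_ ?_ ?_ hz
  · rintro ⟨m, b⟩ hm
    by_cases hc : C.IsCritical m
    · rw [C.diff_single_of_isCritical hc, contraction_single,
        C.contractionTerm_of_isCritical b hc]
      simpa using Finsupp.single_mem_supported F (1 : F)
        (show (m, b) ∈ {m | m ∈ T ∧ C.IsCritical m.1} from ⟨hm, hc⟩)
    · rw [sub_sub, C.homotopy_of_not_isCritical hc b, sub_self]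
      exact zero_mem _
  · intro x y hx hy
    have := add_mem hx hy
    rw [map_add, map_add, map_add, map_add]
    convert this using 1
    abel
  · intro c x hx
    have := Submodule.smul_mem _ c hx
    simpa only [smul_sub, map_smul] using this

theorem diff_single_mem {m : I →₀ L} {b : β} {T : Set ((I →₀ L) × β)}
    (h : ∀ i, m i ∈ C.src i → (m.update i (C.up i (m i)), b) ∈ T) :
    C.diff β (Finsupp.single (m, b) 1) ∈ Finsupp.supported F F T := by
  rw [diff_single, one_smul]
  refine sum_mem fun k _ => ?_
  by_cases hk : m k ∈ C.src k
  · rw [C.term_of_mem b hk]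
    exact Finsupp.single_mem_supported _ _ (h k hk)
  · rw [C.term_of_notMem b hk]
    exact zero_mem _

theorem contraction_mem {T T' : Set ((I →₀ L) × β)}
    (h : ∀ m b, (m, b) ∈ T → ∀ i, m i ∈ C.tgt i → (m.update i (C.down i (m i)), b) ∈ T')
    {z : (I →₀ L) × β →₀ F} (hz : z ∈ Finsupp.supported F F T) :
    C.contraction z ∈ Finsupp.supported F F T' := by
  refine supported_induction (motive := fun z => C.contraction z ∈ Finsupp.supported F F T')
    (by simp) ?_ ?_ ?_ hz
  · rintro ⟨m, b⟩ hm
    rw [contraction_single, one_smul]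
    by_cases hc : ∃ i, C.IsFirst m i ∧ m i ∈ C.tgt i
    · obtain ⟨i, hi, ht⟩ := hc
      rw [C.contractionTerm_of_tgt b hi ht]
      exact Finsupp.single_mem_supported _ _ (h m b hm i ht)
    · rw [contractionTerm, dif_neg hc]
      exact zero_mem _
  · intro x y hx hy; rw [map_add]; exact add_mem hx hy
  · intro c x hx; rw [map_smul]; exact Submodule.smul_mem _ _ hx

end MatchingFamily

/-! ### Ordered products -/

/-- The product of `a i`, `i ∈ s`, in increasing order of `i`. -/
def orderedProd {I : Type*} [LinearOrder I] {A : Type*} [Monoid A] (s : Finset I) (a : I → A) :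
    A :=
  ((s.sort (· ≤ ·)).map a).prod

section orderedProd

variable {I : Type*} [LinearOrder I] {A : Type*}

theorem orderedMonomial_eq [Monoid A] (x : I → A) (m : I →₀ ℕ) :
    orderedMonomial x m = orderedProd m.support fun i => x i ^ m i := rfl

@[simp]
theorem orderedProd_empty [Monoid A] (a : I → A) : orderedProd ∅ a = 1 := by
  simp [orderedProd]

theorem orderedProd_insert [Monoid A] (a : I → A) {s : Finset I} {i : I} (h : ∀ j ∈ s, i < j) :
    orderedProd (insert i s) a = a i * orderedProd s a := by
  rw [orderedProd, Finset.sort_insert _ (fun j hj => (h j hj).le) fun hi => (h i hi).false,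
    List.map_cons, List.prod_cons, orderedProd]

theorem orderedProd_congr [Monoid A] {a b : I → A} {s : Finset I} (h : ∀ i ∈ s, a i = b i) :
    orderedProd s a = orderedProd s b := by
  unfold orderedProd
  congr 1
  exact List.map_congr_left fun i hi => h i ((Finset.mem_sort _).1 hi)

theorem orderedProd_subset [Monoid A] (a : I → A) {s t : Finset I} (hst : s ⊆ t)
    (h : ∀ i ∈ t, i ∉ s → a i = 1) : orderedProd s a = orderedProd t a := by
  induction t using Finset.induction_on_min generalizing s with
  | empty => rw [Finset.subset_empty.1 hst]
  | insert i t hi ih =>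
    have hit : i ∉ t := fun h => (hi i h).false
    rw [orderedProd_insert a hi]
    by_cases his : i ∈ s
    · have hs : ∀ j ∈ s.erase i, i < j := fun j hj =>
        hi j (Finset.mem_of_mem_insert_of_ne (hst (Finset.mem_of_mem_erase hj))
          (Finset.ne_of_mem_erase hj))
      rw [← Finset.insert_erase his, orderedProd_insert a hs]
      congr 1
      refine ih (fun j hj => ?_) fun j hj hjs => ?_
      · exact Finset.mem_of_mem_insert_of_ne (hst (Finset.mem_of_mem_erase hj))
          (Finset.ne_of_mem_erase hj)
      · refine h j (Finset.mem_insert_of_mem hj) fun hjs' => hjs ?_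
        exact Finset.mem_erase.2 ⟨fun hij => hit (hij ▸ hj), hjs'⟩
    · rw [h i (Finset.mem_insert_self _ _) his, one_mul]
      refine ih (fun j hj => ?_) fun j hj hjs => h j (Finset.mem_insert_of_mem hj) hjs
      exact Finset.mem_of_mem_insert_of_ne (hst hj) fun hij => his (hij ▸ hj)

theorem map_orderedProd [Monoid A] {B : Type*} [Monoid B] {G : Type*} [FunLike G A B]
    [MonoidHomClass G A B] (g : G) (a : I → A) (s : Finset I) :
    g (orderedProd s a) = orderedProd s fun i => g (a i) := by
  simp only [orderedProd, map_list_prod, List.map_map]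
  rfl

theorem orderedProd_mem_graded {R : Type*} [CommRing R] [Ring A] [Algebra R A] {ι : Type*}
    [AddCommMonoid ι] [DecidableEq ι] (𝒜 : ι → Submodule R A) [GradedAlgebra 𝒜] {a : I → A}
    {d : I → ι} {s : Finset I} (h : ∀ i ∈ s, a i ∈ 𝒜 (d i)) :
    orderedProd s a ∈ 𝒜 (∑ i ∈ s, d i) := by
  induction s using Finset.induction_on_min with
  | empty => simpa using SetLike.GradedOne.one_mem (A := 𝒜)
  | insert i s hi ih =>
    rw [orderedProd_insert a hi, Finset.sum_insert fun h => (hi i h).false]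
    exact SetLike.GradedMul.mul_mem (h i (Finset.mem_insert_self _ _))
      (ih fun j hj => h j (Finset.mem_insert_of_mem hj))

/-- `a` and `b` agree up to a sign. -/
def EqUpToSign (F : Type*) [CommRing F] [Ring A] [Algebra F A] (a b : A) : Prop :=
  ∃ n : ℕ, a = (-1 : F) ^ n • b

variable {F : Type*} [CommRing F] [Ring A] [Algebra F A]

namespace EqUpToSign

theorem refl (a : A) : EqUpToSign F a a := ⟨0, by simp⟩

theorem trans {a b c : A} (h : EqUpToSign F a b) (h' : EqUpToSign F b c) : EqUpToSign F a c := by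
  obtain ⟨n, rfl⟩ := h
  obtain ⟨m, rfl⟩ := h'
  exact ⟨n + m, by rw [smul_smul, pow_add]⟩

theorem symm {a b : A} (h : EqUpToSign F a b) : EqUpToSign F b a := by
  obtain ⟨n, rfl⟩ := h
  exact ⟨n, by rw [smul_smul, ← mul_pow]; simp⟩

theorem mul_left {a b : A} (h : EqUpToSign F a b) (c : A) : EqUpToSign F (c * a) (c * b) := by
  obtain ⟨n, rfl⟩ := h
  exact ⟨n, mul_smul_comm _ _ _⟩

theorem mul_right {a b : A} (h : EqUpToSign F a b) (c : A) : EqUpToSign F (a * c) (b * c) := by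
  obtain ⟨n, rfl⟩ := h
  exact ⟨n, smul_mul_assoc _ _ _⟩

/-- `c` commutes up to a sign with a product if it commutes up to a sign with the factors. -/
theorem comm_mul {a b c : A} (h : EqUpToSign F (c * a) (a * c))
    (h' : EqUpToSign F (c * b) (b * c)) : EqUpToSign F (c * (a * b)) (a * b * c) := by
  rw [← mul_assoc, mul_assoc a b c]
  exact (h.mul_right b).trans (by rw [mul_assoc]; exact h'.mul_left a)

theorem comm_pow {a c : A} (h : EqUpToSign F (c * a) (a * c)) (n : ℕ) :
    EqUpToSign F (c * a ^ n) (a ^ n * c) := by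
  induction n with
  | zero => simpa using refl c
  | succ n ih => rw [pow_succ]; exact comm_mul ih h

end EqUpToSign

theorem EqUpToSign.comm_orderedProd {a : I → A} {c : A} {s : Finset I}
    (h : ∀ i ∈ s, EqUpToSign F (c * a i) (a i * c)) :
    EqUpToSign F (c * orderedProd s a) (orderedProd s a * c) := by
  induction s using Finset.induction_on_min with
  | empty => simpa using refl c
  | insert i s hi ih =>
    rw [orderedProd_insert a hi]
    exact comm_mul (h i (Finset.mem_insert_self _ _))
      (ih fun j hj => h j (Finset.mem_insert_of_mem hj))

theorem orderedProd_mul {a b : I → A} {s : Finset I}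
    (h : ∀ i ∈ s, ∀ j ∈ s, EqUpToSign F (b i * a j) (a j * b i)) :
    EqUpToSign F (orderedProd s fun i => a i * b i) (orderedProd s a * orderedProd s b) := by
  induction s using Finset.induction_on_min with
  | empty => simpa using EqUpToSign.refl 1
  | insert i s hi ih =>
    rw [orderedProd_insert _ hi, orderedProd_insert _ hi, orderedProd_insert _ hi]
    have h₁ := ih fun k hk j hj => h k (Finset.mem_insert_of_mem hk) j (Finset.mem_insert_of_mem hj)
    have h₂ : EqUpToSign F (b i * orderedProd s a) (orderedProd s a * b i) :=
      EqUpToSign.comm_orderedProd fun j hj =>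
        h i (Finset.mem_insert_self _ _) j (Finset.mem_insert_of_mem hj)
    refine (h₁.mul_left (a i * b i)).trans ?_
    have := (h₂.mul_left (a i)).mul_right (orderedProd s b)
    simpa only [mul_assoc] using this

/-- A factor that commutes up to signs can be moved into an ordered product. -/
theorem mul_orderedProd {a : I → A} {c : A} {s : Finset I}
    (h : ∀ i ∈ s, EqUpToSign F (c * a i) (a i * c)) {i : I} (hi : i ∈ s) :
    EqUpToSign F (c * orderedProd s a) (orderedProd s (Function.update a i (c * a i))) := by
  induction s using Finset.induction_on_min with
  | empty => exact absurd hi (Finset.notMem_empty i)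
  | insert k s hk ih =>
    rw [orderedProd_insert _ hk, orderedProd_insert _ hk]
    rcases eq_or_ne i k with rfl | hik
    · rw [Function.update_self, mul_assoc,
        orderedProd_congr (b := a) (a := Function.update a i _) fun j hj =>
          Function.update_of_ne (hk j hj).ne' _ _]
      exact EqUpToSign.refl _
    · rw [Function.update_of_ne hik.symm]
      have h₁ := ih (fun j hj => h j (Finset.mem_insert_of_mem hj))
        (Finset.mem_of_mem_insert_of_ne hi hik)
      have h₂ := (h k (Finset.mem_insert_self _ _)).mul_right (orderedProd s a)
      rw [mul_assoc, mul_assoc] at h₂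
      exact h₂.trans (h₁.mul_left (a k))

end orderedProd

namespace SpectralSeq

variable {F : Type} [Field F] {H : Type u} [Ring H] [Algebra F H] {𝓗 : ℕ → Submodule F H}
  {S : SpectralSeq.{u, v} 𝓗}

theorem eqUpToSign_comm {i j : ℕ × ℕ} {a b : S.E 2} (ha : a ∈ S.gr 2 i) (hb : b ∈ S.gr 2 j) :
    EqUpToSign F (a * b) (b * a) :=
  ⟨_, S.comm 2 le_rfl i j a ha b hb⟩

/-- The Leibniz rule for ordered products. -/
theorem diffRel_orderedProd {I : Type*} [LinearOrder I] {r : ℕ} (hr : 2 ≤ r) {a a' : I → S.E 2}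
    {d : I → ℕ × ℕ} {s : Finset I} (hd : ∀ i ∈ s, a i ∈ S.gr 2 (d i))
    (h : ∀ i ∈ s, S.DiffRel r (a i) (a' i)) :
    S.DiffRel r (orderedProd s a) (∑ i ∈ s,
      (∏ j ∈ s, if j < i then (-1 : F) ^ ((d j).1 + (d j).2) else 1) •
        orderedProd s (Function.update a i (a' i))) := by
  induction s using Finset.induction_on_min with
  | empty => simpa using diffRel_one hr
  | insert i s hi ih =>
    have his : i ∉ s := fun h => (hi i h).false
    have h₁ := ih (fun j hj => hd j (Finset.mem_insert_of_mem hj))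
      fun j hj => h j (Finset.mem_insert_of_mem hj)
    have h₂ := (h i (Finset.mem_insert_self _ _)).mul (p := (d i).1) (q := (d i).2)
      (hd i (Finset.mem_insert_self _ _)) h₁
    rw [orderedProd_insert a hi]
    convert h₂ using 1
    rw [Finset.sum_insert his, Finset.mul_sum, Finset.smul_sum]
    congr 1
    · rw [orderedProd_insert _ hi, Function.update_self, Finset.prod_eq_one, one_smul,
        orderedProd_congr (b := a) (a := Function.update a i _) fun j hj =>
          Function.update_of_ne (hi j hj).ne' _ _]
      intro j hj
      rw [if_neg]
      rcases Finset.mem_insert.1 hj with rfl | hj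
      · exact lt_irrefl _
      · exact (hi j hj).not_gt
    · refine Finset.sum_congr rfl fun k hk => ?_
      rw [orderedProd_insert _ hi, Function.update_of_ne (hi k hk).ne, Finset.prod_insert his,
        if_pos (hi k hk), mul_smul_comm, smul_smul]

end SpectralSeq

/-! ### The elementary complexes -/

namespace BorelModel

/-- The generators `x_i` whose elementary complex is `Λ(x_i) ⊗ P(y_i)`: those of odd degree, and
all generators if `ℓ = 2`. For the others it is `P(x_i)/(x_i^ℓ) ⊗ Λ(y_i) ⊗ P(z_i)`. -/
def Plain (ℓ n : ℕ) : Prop := ℓ = 2 ∨ Odd n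

/-- The exponents `(a, b, c)` of the monomials `x^a y^b z^c` forming a basis of the elementary
complex of a generator `x` of degree `n`. -/
def valid (ℓ n : ℕ) : Set (ℕ × ℕ × ℕ) :=
  {l | (Plain ℓ n ∧ l.1 ≤ 1 ∧ l.2.2 = 0) ∨ (¬Plain ℓ n ∧ l.1 < ℓ ∧ l.2.1 ≤ 1)}

/-- The monomials that survive to page `r`: all of them as long as `r ≤ n + 1`, then, if `x` is not
plain, the `z^c` and `x^{ℓ-1} y z^c` as long as `r ≤ (ℓ - 1) n + 1`, and finally only `1`. -/
def alive (ℓ n r : ℕ) : Set (ℕ × ℕ × ℕ) :=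
  {l | l = 0 ∨ (r ≤ n + 1 ∧ l ∈ valid ℓ n) ∨
    (¬Plain ℓ n ∧ r ≤ (ℓ - 1) * n + 1 ∧ ((l.1 = 0 ∧ l.2.1 = 0) ∨ (l.1 = ℓ - 1 ∧ l.2.1 = 1)))}

/-- The monomials with nonzero differential on page `r`. -/
def src (ℓ n r : ℕ) : Set (ℕ × ℕ × ℕ) :=
  {l | (r = n + 1 ∧ l ∈ valid ℓ n ∧ l.1 ≠ 0 ∧ (Plain ℓ n ∨ l.2.1 = 0)) ∨
    (¬Plain ℓ n ∧ r = (ℓ - 1) * n + 1 ∧ l.1 = ℓ - 1 ∧ l.2.1 = 1)}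

/-- The monomials that are, up to a factor, differentials on page `r`. -/
def tgt (ℓ n r : ℕ) : Set (ℕ × ℕ × ℕ) :=
  {l | (r = n + 1 ∧ l ∈ valid ℓ n ∧ l.2.1 ≠ 0 ∧
      (Plain ℓ n ∧ l.1 = 0 ∨ ¬Plain ℓ n ∧ l.1 + 1 < ℓ)) ∨
    (¬Plain ℓ n ∧ r = (ℓ - 1) * n + 1 ∧ l.1 = 0 ∧ l.2.1 = 0 ∧ l.2.2 ≠ 0)}

/-- The differential `x^a y^b z^c ↦ x^{a-1} y^{b+1} z^c` or `x^{ℓ-1} y z^c ↦ z^{c+1}`, up to a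
factor. -/
def up (n r : ℕ) (l : ℕ × ℕ × ℕ) : ℕ × ℕ × ℕ :=
  if r = n + 1 then (l.1 - 1, l.2.1 + 1, l.2.2) else (0, 0, l.2.2 + 1)

/-- The inverse of `up`. -/
def down (ℓ n r : ℕ) (l : ℕ × ℕ × ℕ) : ℕ × ℕ × ℕ :=
  if r = n + 1 then (l.1 + 1, l.2.1 - 1, l.2.2) else (ℓ - 1, 1, l.2.2 - 1)

/-- The factor in the differential. -/
def coef (ℓ n r : ℕ) (l : ℕ × ℕ × ℕ) : ZMod ℓ := if r = n + 1 then (l.1 : ZMod ℓ) else 1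

/-- The bidegree of `x^a y^b z^c`. -/
def bideg (ℓ n : ℕ) (l : ℕ × ℕ × ℕ) : ℕ × ℕ :=
  (l.2.1 * (n + 1) + l.2.2 * (ℓ * n + 2), l.1 * n)

theorem succ_le_of_not_plain {ℓ n : ℕ} (hℓ : 2 ≤ ℓ) (hn : 1 ≤ n) (h : ¬Plain ℓ n) :
    3 ≤ ℓ ∧ n + 1 ≤ (ℓ - 1) * n := by
  have h3 : 3 ≤ ℓ := by
    by_contra h'
    exact h (.inl (by omega))
  refine ⟨h3, ?_⟩
  have : 2 * n ≤ (ℓ - 1) * n := Nat.mul_le_mul_right n (by omega)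
  omega

theorem up_mem {ℓ n r : ℕ} (hℓ : 2 ≤ ℓ) (hn : 1 ≤ n) {l : ℕ × ℕ × ℕ} (h : l ∈ src ℓ n r) :
    up n r l ∈ tgt ℓ n r := by
  have h₁ := succ_le_of_not_plain hℓ hn
  obtain ⟨a, b, c⟩ := l
  simp only [src, tgt, up, valid, Set.mem_ofPred_eq] at *
  by_cases hp : Plain ℓ n <;> simp only [hp, true_and, false_and, not_true, not_false_eq_true,
    or_false, false_or, true_or, and_true, true_implies, false_implies] at * <;> grind

theorem down_mem {ℓ n r : ℕ} (hℓ : 2 ≤ ℓ) (hn : 1 ≤ n) {l : ℕ × ℕ × ℕ} (h : l ∈ tgt ℓ n r) :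
    down ℓ n r l ∈ src ℓ n r := by
  have h₁ := succ_le_of_not_plain hℓ hn
  obtain ⟨a, b, c⟩ := l
  simp only [src, tgt, down, valid, Set.mem_ofPred_eq] at *
  by_cases hp : Plain ℓ n <;> simp only [hp, true_and, false_and, not_true, not_false_eq_true,
    or_false, false_or, true_or, and_true, true_implies, false_implies] at * <;> grind

theorem down_up {ℓ n r : ℕ} (hℓ : 2 ≤ ℓ) (hn : 1 ≤ n) {l : ℕ × ℕ × ℕ} (h : l ∈ src ℓ n r) :
    down ℓ n r (up n r l) = l := by
  have h₁ := succ_le_of_not_plain hℓ hn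
  obtain ⟨a, b, c⟩ := l
  simp only [src, down, up, valid, Set.mem_ofPred_eq] at *
  by_cases hp : Plain ℓ n <;> simp only [hp, true_and, false_and, not_true, not_false_eq_true,
    or_false, false_or, true_or, and_true, true_implies, false_implies] at * <;> grind

theorem up_down {ℓ n r : ℕ} (hℓ : 2 ≤ ℓ) (hn : 1 ≤ n) {l : ℕ × ℕ × ℕ} (h : l ∈ tgt ℓ n r) :
    up n r (down ℓ n r l) = l := by
  have h₁ := succ_le_of_not_plain hℓ hn
  obtain ⟨a, b, c⟩ := l
  simp only [tgt, down, up, valid, Set.mem_ofPred_eq] at *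
  by_cases hp : Plain ℓ n <;> simp only [hp, true_and, false_and, not_true, not_false_eq_true,
    or_false, false_or, true_implies, false_implies] at * <;> grind

theorem notMem_tgt {ℓ n r : ℕ} (hℓ : 2 ≤ ℓ) (hn : 1 ≤ n) {l : ℕ × ℕ × ℕ} (h : l ∈ src ℓ n r) :
    l ∉ tgt ℓ n r := by
  have h₁ := succ_le_of_not_plain hℓ hn
  obtain ⟨a, b, c⟩ := l
  simp only [src, tgt, valid, Set.mem_ofPred_eq] at *
  by_cases hp : Plain ℓ n <;> simp only [hp, true_and, false_and, not_true, not_false_eq_true,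
    or_false, false_or, true_or, and_true, true_implies, false_implies] at * <;> grind

theorem zero_notMem_src {ℓ n r : ℕ} : (0 : ℕ × ℕ × ℕ) ∉ src ℓ n r := by
  simp [src]

theorem zero_notMem_tgt {ℓ n r : ℕ} : (0 : ℕ × ℕ × ℕ) ∉ tgt ℓ n r := by
  simp [tgt]

theorem coef_ne_zero {ℓ n r : ℕ} [Fact ℓ.Prime] {l : ℕ × ℕ × ℕ} (h : l ∈ src ℓ n r) :
    coef ℓ n r l ≠ 0 := by
  have hℓ := (Fact.out : ℓ.Prime).two_le
  unfold coef
  split_ifs with hr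
  · rw [Ne, ZMod.natCast_eq_zero_iff]
    have : 0 < l.1 ∧ l.1 < ℓ := by
      simp only [src, valid, Set.mem_ofPred_eq] at h
      grind
    exact fun hd => absurd (Nat.le_of_dvd this.1 hd) (by omega)
  · exact one_ne_zero

theorem bideg_up {ℓ n r : ℕ} (hℓ : 2 ≤ ℓ) (hn : 1 ≤ n) {l : ℕ × ℕ × ℕ} (h : l ∈ src ℓ n r) :
    (bideg ℓ n (up n r l)).1 = (bideg ℓ n l).1 + r ∧
      (bideg ℓ n (up n r l)).2 + r = (bideg ℓ n l).2 + 1 := by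
  obtain ⟨k, rfl⟩ := Nat.exists_eq_add_of_le' (show 1 ≤ ℓ by omega)
  have h₁ := succ_le_of_not_plain hℓ hn
  obtain ⟨a, b, c⟩ := l
  by_cases hr : r = n + 1
  · have ha : a ≠ 0 := by
      simp only [src, Set.mem_ofPred_eq] at h
      grind
    obtain ⟨a, rfl⟩ := Nat.exists_eq_succ_of_ne_zero ha
    subst hr
    simp only [bideg, up, if_true, Nat.succ_eq_add_one, Nat.add_sub_cancel]
    constructor <;> ring
  · have : r = k * n + 1 ∧ a = k ∧ b = 1 := by
      simp only [src, Set.mem_ofPred_eq, Nat.add_sub_cancel] at h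
      grind
    obtain ⟨rfl, rfl, rfl⟩ := this
    simp only [bideg, up, if_neg hr]
    constructor <;> ring

theorem alive_succ_iff {ℓ n r : ℕ} (hℓ : 2 ≤ ℓ) (hn : 1 ≤ n) {l : ℕ × ℕ × ℕ} :
    l ∈ alive ℓ n (r + 1) ↔ l ∈ alive ℓ n r ∧ l ∉ src ℓ n r ∧ l ∉ tgt ℓ n r := by
  have h₁ := succ_le_of_not_plain hℓ hn
  obtain ⟨a, b, c⟩ := l
  simp only [src, tgt, alive, valid, Set.mem_ofPred_eq, Prod.mk_eq_zero] at *
  generalize (ℓ - 1) * n = N at *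
  by_cases hp : Plain ℓ n <;> simp only [hp, true_and, false_and, not_true, not_false_eq_true,
    or_false, false_or, true_or, and_true, true_implies, false_implies] at * <;> omega

theorem src_subset_alive {ℓ n r : ℕ} : src ℓ n r ⊆ alive ℓ n r := by
  intro l h
  simp only [src, alive, Set.mem_ofPred_eq] at *
  grind

theorem tgt_subset_alive {ℓ n r : ℕ} : tgt ℓ n r ⊆ alive ℓ n r := by
  intro l h
  simp only [tgt, alive, Set.mem_ofPred_eq] at *
  grind

/-- A monomial `≠ 1` does not survive beyond the pages at which differentials can leave from or arrive
at its bidegree. -/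
theorem le_of_mem_alive {ℓ n r : ℕ} (hℓ : 2 ≤ ℓ) (hn : 1 ≤ n) {l : ℕ × ℕ × ℕ}
    (h : l ∈ alive ℓ n r) (h0 : l ≠ 0) :
    r ≤ (bideg ℓ n l).1 ∨ r ≤ (bideg ℓ n l).2 + 1 := by
  obtain ⟨a, b, c⟩ := l
  have hℓn : (ℓ - 1) * n + 1 ≤ ℓ * n + 2 ∧ n + 1 ≤ ℓ * n + 2 :=
    ⟨by have := Nat.mul_le_mul_right n (Nat.sub_le ℓ 1); omega, by nlinarith⟩
  simp only [bideg]
  have hb : b ≠ 0 → n + 1 ≤ b * (n + 1) := fun h => Nat.le_mul_of_pos_left _ (by omega)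
  have hc : c ≠ 0 → ℓ * n + 2 ≤ c * (ℓ * n + 2) := fun h => Nat.le_mul_of_pos_left _ (by omega)
  have ha : a ≠ 0 → n ≤ a * n := fun h => Nat.le_mul_of_pos_left _ (by omega)
  have ha' : a = ℓ - 1 → a * n = (ℓ - 1) * n := fun h => by rw [h]
  simp only [alive, Set.mem_ofPred_eq, Prod.mk_eq_zero, ne_eq] at h h0
  generalize (ℓ - 1) * n = N at *
  generalize ℓ * n = N' at *
  generalize a * n = N₁ at *
  generalize b * (n + 1) = N₂ at *
  generalize c * (N' + 2) = N₃ at *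
  rcases h with h | ⟨h, -⟩ | ⟨-, h, h'⟩ <;> omega

variable (ℓ : ℕ) [Fact ℓ.Prime] {I : Type*}

/-- The elementary complexes of all generators, on page `r`. -/
def matching {deg : I → ℕ} (hdeg : ∀ i, 1 ≤ deg i) (r : ℕ) :
    MatchingFamily (ZMod ℓ) I (ℕ × ℕ × ℕ) where
  ε i l := (-1) ^ ((bideg ℓ (deg i) l).1 + (bideg ℓ (deg i) l).2)
  src i := src ℓ (deg i) r
  tgt i := tgt ℓ (deg i) r
  up i := up (deg i) r
  down i := down ℓ (deg i) r
  coef i := coef ℓ (deg i) r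
  ε_zero i := by simp [bideg]
  ε_mul_self i l := by rw [← mul_pow]; simp
  up_mem i l := up_mem (Fact.out : ℓ.Prime).two_le (hdeg i)
  down_mem i l := down_mem (Fact.out : ℓ.Prime).two_le (hdeg i)
  down_up i l := down_up (Fact.out : ℓ.Prime).two_le (hdeg i)
  up_down i l := up_down (Fact.out : ℓ.Prime).two_le (hdeg i)
  notMem_tgt i l := notMem_tgt (Fact.out : ℓ.Prime).two_le (hdeg i)
  zero_notMem_src i := zero_notMem_src
  zero_notMem_tgt i := zero_notMem_tgt
  coef_ne_zero i l := coef_ne_zero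
  ε_up i l h := by
    obtain ⟨h₁, h₂⟩ := bideg_up (Fact.out : ℓ.Prime).two_le (hdeg i) h
    have key : (bideg ℓ (deg i) (up (deg i) r l)).1 + (bideg ℓ (deg i) (up (deg i) r l)).2 =
        (bideg ℓ (deg i) l).1 + (bideg ℓ (deg i) l).2 + 1 := by omega
    rw [key, pow_succ, mul_neg_one]

end BorelModel

namespace SpectralSeq

/-! ### The limit page of a spectral sequence converging to its base -/

section Convergence

variable {F : Type} [Field F] {H : Type u} [Ring H] [Algebra F H] {𝓗 : ℕ → Submodule F H}
  {S : SpectralSeq.{u, v} 𝓗}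

theorem Convergence.fil_antitone {A : Type w} [Ring A] [Algebra F A] {𝒜 : ℕ → Submodule F A}
    {unit : H →ₐ[F] A} (c : S.Convergence 𝒜 unit) {p p' n : ℕ} (h : p ≤ p') :
    c.Fil p' n ≤ c.Fil p n := by
  induction p', h using Nat.le_induction with
  | base => exact le_rfl
  | succ p' _ ih => exact (c.fil_succ_le p' n).trans ih

theorem Convergence.mem_fil (c : S.Convergence 𝓗 (AlgHom.id F H)) {p q : ℕ} {a : H}
    (h : a ∈ c.Fil p (p + q)) : a ∈ 𝓗 (p + q) := by
  rw [← c.fil_zero]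
  exact c.fil_antitone (Nat.zero_le p) h

/-- As the unit `H → H` is the identity, all of `H^n` lies in filtration `n`, so that `E_∞` is
concentrated in the base row. -/
theorem limit_eq_zero (conv : S.ConvergesToBase) {r p q : ℕ} (hr : max p (q + 1) < r)
    (hq : q ≠ 0) {e : S.E r} (he : e ∈ S.gr r (p, q)) : e = 0 := by
  obtain ⟨c⟩ := conv
  obtain ⟨a, rfl⟩ := c.φ_surjective r p q hr e he
  rw [c.φ_eq_zero_iff r p q hr]
  exact c.fil_antitone (show p + 1 ≤ p + q by omega) (c.unit_mem _ _ (c.mem_fil a.2))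

theorem exists_η_eq (conv : S.ConvergesToBase) {r p : ℕ} (hr : max p 1 < r) {e : S.E r}
    (he : e ∈ S.gr r (p, 0)) : ∃ h ∈ 𝓗 p, S.η r h = e := by
  obtain ⟨c⟩ := conv
  obtain ⟨a, rfl⟩ := c.φ_surjective r p 0 hr e he
  have ha : (a : H) ∈ 𝓗 p := c.mem_fil a.2
  exact ⟨a, ha, (c.φ_unit r p hr _ ha a rfl).symm⟩

theorem eq_zero_of_η_eq_zero (conv : S.ConvergesToBase) {r p : ℕ} (hr : max p 1 < r) {h : H}
    (hh : h ∈ 𝓗 p) (h0 : S.η r h = 0) : h = 0 := by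
  obtain ⟨c⟩ := conv
  rw [← c.φ_unit r p hr h hh ⟨h, c.unit_mem p h hh⟩ rfl, c.φ_eq_zero_iff r p 0 hr] at h0
  have : h ∈ c.Fil (p + 1) p := h0
  rwa [c.fil_bot, Submodule.mem_bot] at this

end Convergence

end SpectralSeq

namespace BorelModel

theorem alive_subset_valid {ℓ n r : ℕ} (hℓ : 2 ≤ ℓ) : alive ℓ n r ⊆ valid ℓ n := by
  intro l h
  obtain ⟨a, b, c⟩ := l
  have h3 : ¬Plain ℓ n → 3 ≤ ℓ := fun h => by
    by_contra h'
    exact h (.inl (by omega))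
  simp only [alive, valid, Set.mem_ofPred_eq, Prod.mk_eq_zero] at *
  by_cases hp : Plain ℓ n <;> simp only [hp, true_and, false_and, not_true, not_false_eq_true,
    or_false, false_or, true_implies, false_implies] at * <;> omega

theorem valid_subset_alive_two {ℓ n : ℕ} (hn : 1 ≤ n) : valid ℓ n ⊆ alive ℓ n 2 :=
  fun _ h => .inr (.inl ⟨by omega, h⟩)

theorem zero_mem_valid {ℓ n : ℕ} (hℓ : 2 ≤ ℓ) : (0 : ℕ × ℕ × ℕ) ∈ valid ℓ n :=
  alive_subset_valid (r := 0) hℓ (.inl rfl)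

theorem even_of_not_plain {ℓ n : ℕ} (h : ¬Plain ℓ n) : Even n := by
  rw [← Nat.not_odd_iff_even]
  exact fun h' => h (.inr h')

theorem not_plain_iff {ℓ n : ℕ} : ¬Plain ℓ n ↔ ℓ ≠ 2 ∧ Even n := by
  rw [Plain, not_or, Nat.not_odd_iff_even]

theorem eq_zero_of_eq_neg_one_smul {F A : Type*} [Field F] [AddCommGroup A] [Module F A]
    (h2 : (2 : F) ≠ 0) {a : A} (h : a = (-1 : F) • a) : a = 0 := by
  have : (2 : F) • a = 0 := by
    rw [two_smul]
    nth_rewrite 1 [h]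
    rw [neg_one_smul, neg_add_cancel]
  exact (smul_eq_zero_iff_right h2).1 this

theorem two_ne_zero_of_not_plain {ℓ : ℕ} [Fact ℓ.Prime] {n : ℕ} (h : ¬Plain ℓ n) :
    (2 : ZMod ℓ) ≠ 0 := by
  have : ((2 : ℕ) : ZMod ℓ) ≠ 0 := by
    rw [Ne, ZMod.natCast_eq_zero_iff]
    intro hd
    refine h (.inl ?_)
    exact (Nat.dvd_prime Nat.prime_two).1 hd |>.resolve_left (Fact.out : ℓ.Prime).one_lt.ne'
  exact_mod_cast this

end BorelModel

namespace SpectralSeq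

open BorelModel

variable {ℓ : ℕ} [Fact ℓ.Prime] {H : Type u} [Ring H] [Algebra (ZMod ℓ) H]
  {𝓗 : ℕ → Submodule (ZMod ℓ) H} (S : SpectralSeq.{u, v} 𝓗) {I : Type w}

/-- Transgressive elements `x i` in the fibre column with representatives `y i` of their
transgressions, and representatives `z i` of the transgressions of `y i * x i ^ (ℓ - 1)` for those
`i` that are not plain. For plain `i` the value of `z i` is irrelevant. -/
structure TransgressiveFamily (deg : I → ℕ) where
  x : I → S.E 2
  y : I → S.E 2
  z : I → S.E 2
  transgresses_x : ∀ i, S.Transgresses 0 (deg i) (x i) (y i)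
  transgresses_z : ∀ i, ¬Plain ℓ (deg i) →
    S.Transgresses (deg i + 1) ((ℓ - 1) * deg i) (y i * x i ^ (ℓ - 1)) (z i)

namespace TransgressiveFamily

variable {S} {deg : I → ℕ} (T : S.TransgressiveFamily deg)

/-- The monomial `x_i^a y_i^b z_i^c` in `E_2`. -/
def loc (i : I) (l : ℕ × ℕ × ℕ) : S.E 2 := T.x i ^ l.1 * (T.y i ^ l.2.1 * T.z i ^ l.2.2)

include T in
theorem one_le_deg (i : I) : 1 ≤ deg i := (T.transgresses_x i).pos

theorem loc_zero (i : I) : T.loc i 0 = 1 := by simp [loc]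

theorem x_mem (i : I) : T.x i ∈ S.gr 2 (0, deg i) := (T.transgresses_x i).1

theorem y_mem (i : I) : T.y i ∈ S.gr 2 (deg i + 1, 0) := by
  simpa using (T.transgresses_x i).2.1

theorem z_mem {i : I} (hi : ¬Plain ℓ (deg i)) : T.z i ∈ S.gr 2 (ℓ * deg i + 2, 0) := by
  have h := (T.transgresses_z i hi).2.1
  obtain ⟨k, hk⟩ := Nat.exists_eq_add_of_le' (show 1 ≤ ℓ from (Fact.out : ℓ.Prime).one_le)
  have e : deg i + 1 + (ℓ - 1) * deg i + 1 = ℓ * deg i + 2 := by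
    rw [hk, Nat.add_sub_cancel]; ring
  rwa [e] at h

theorem x_pow_mem (i : I) (a : ℕ) : T.x i ^ a ∈ S.gr 2 (0, a * deg i) := by
  simpa using SetLike.pow_mem_graded a (T.x_mem i)

theorem y_pow_mem (i : I) (b : ℕ) : T.y i ^ b ∈ S.gr 2 (b * (deg i + 1), 0) := by
  simpa using SetLike.pow_mem_graded b (T.y_mem i)

theorem z_pow_mem {i : I} {l : ℕ × ℕ × ℕ} (h : l ∈ valid ℓ (deg i)) :
    T.z i ^ l.2.2 ∈ S.gr 2 (l.2.2 * (ℓ * deg i + 2), 0) := by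
  rcases h with ⟨-, -, hc⟩ | ⟨hi, -⟩
  · rw [hc, pow_zero, zero_mul]
    exact SetLike.GradedOne.one_mem
  · simpa using SetLike.pow_mem_graded l.2.2 (T.z_mem hi)

theorem base_mem {i : I} {l : ℕ × ℕ × ℕ} (h : l ∈ valid ℓ (deg i)) :
    T.y i ^ l.2.1 * T.z i ^ l.2.2 ∈ S.gr 2 ((bideg ℓ (deg i) l).1, 0) :=
  SetLike.GradedMul.mul_mem (T.y_pow_mem i l.2.1) (T.z_pow_mem h)

theorem loc_mem {i : I} {l : ℕ × ℕ × ℕ} (h : l ∈ valid ℓ (deg i)) :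
    T.loc i l ∈ S.gr 2 (bideg ℓ (deg i) l) := by
  have := SetLike.GradedMul.mul_mem (T.x_pow_mem i l.1) (T.base_mem h)
  simpa [bideg, loc] using this

/-- A generator `y_i` of odd degree has square zero if `ℓ ≠ 2`. -/
theorem y_mul_y {i : I} (hi : ¬Plain ℓ (deg i)) : T.y i * T.y i = 0 := by
  have h := S.comm 2 le_rfl _ _ _ (T.y_mem i) _ (T.y_mem i)
  have hodd : Odd ((deg i + 1 + 0) * (deg i + 1 + 0)) := by
    have := (even_of_not_plain hi).add_one
    exact Odd.mul this this
  rw [hodd.neg_one_pow] at h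
  exact eq_zero_of_eq_neg_one_smul (two_ne_zero_of_not_plain hi) h

theorem x_mul_y {i : I} (hi : Even (deg i)) : T.x i * T.y i = T.y i * T.x i := by
  have h := S.comm 2 le_rfl _ _ _ (T.x_mem i) _ (T.y_mem i)
  have heven : Even ((0 + deg i) * (deg i + 1 + 0)) := by
    rw [zero_add]; exact hi.mul_right _
  rwa [heven.neg_one_pow, one_smul] at h

theorem diffRel_base {r : ℕ} (hr : 2 ≤ r) {i : I} {l : ℕ × ℕ × ℕ} (h : l ∈ valid ℓ (deg i)) :
    S.DiffRel r (T.y i ^ l.2.1 * T.z i ^ l.2.2) 0 :=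
  diffRel_of_mem_row hr (T.base_mem h)

/-- `d (x^a) = a x^{a-1} y` if the degree of `x` is even. -/
theorem diffRel_x_pow {i : I} (hi : Even (deg i)) (a : ℕ) :
    S.DiffRel (deg i + 1) (T.x i ^ a) ((a : ZMod ℓ) • (T.x i ^ (a - 1) * T.y i)) := by
  have hr : 2 ≤ deg i + 1 := by have := T.one_le_deg i; omega
  induction a with
  | zero => simpa using diffRel_one hr
  | succ a ih =>
    have h := ih.mul (T.x_pow_mem i a) (T.transgresses_x i).diffRel
    rw [pow_succ]
    convert h using 1
    have heven : Even (0 + a * deg i) := by rw [zero_add]; exact hi.mul_left _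
    rw [heven.neg_one_pow, one_smul, Nat.add_sub_cancel, smul_mul_assoc, mul_assoc,
      ← T.x_mul_y hi, ← mul_assoc]
    rcases a with _ | a
    · simp
    · rw [Nat.add_sub_cancel, ← pow_succ, Nat.cast_succ (a + 1), add_smul, one_smul]

/-- The differentials of the monomials `x_i^a y_i^b z_i^c` in `E_2` are those of the elementary
complex. -/
theorem diffRel_loc {r : ℕ} (hr : 2 ≤ r) {i : I} {l : ℕ × ℕ × ℕ}
    (hl : l ∈ alive ℓ (deg i) r) : ∃ c : ZMod ℓ, (l ∈ src ℓ (deg i) r → c = coef ℓ (deg i) r l) ∧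
      (l ∉ src ℓ (deg i) r → c = 0) ∧
      S.DiffRel r (T.loc i l) (c • T.loc i (up (deg i) r l)) := by
  have hℓ := (Fact.out : ℓ.Prime).two_le
  have hn := T.one_le_deg i
  have hv : l ∈ valid ℓ (deg i) := alive_subset_valid hℓ hl
  have hrow := T.diffRel_base hr hv
  have h₁ := succ_le_of_not_plain hℓ hn
  obtain ⟨a, b, c⟩ := l
  rcases lt_trichotomy r (deg i + 1) with hr' | rfl | hr'
  · have hs : (a, b, c) ∉ src ℓ (deg i) r := by
      simp only [src, Set.mem_ofPred_eq]
      grind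
    refine ⟨0, fun h => absurd h hs, fun _ => rfl, ?_⟩
    have hx := (T.transgresses_x i).diffRel_of_lt hr hr'
    simpa [loc] using (hx.pow_zero hr a).mul_zero hrow
  · -- On page `|x| + 1` the differential is `x^a y^b z^c ↦ a x^{a-1} y^{b+1} z^c`.
    have hx : S.DiffRel (deg i + 1) (T.x i ^ a) ((a : ZMod ℓ) • (T.x i ^ (a - 1) * T.y i)) := by
      by_cases hp : Plain ℓ (deg i)
      · have ha : a ≤ 1 := by simp only [valid, Set.mem_ofPred_eq] at hv; tauto
        rcases Nat.le_one_iff_eq_zero_or_eq_one.1 ha with rfl | rfl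
        · simpa using diffRel_one hr
        · simpa using (T.transgresses_x i).diffRel
      · exact T.diffRel_x_pow (even_of_not_plain hp) a
    have hd := hx.mul_zero hrow
    have e : (a : ZMod ℓ) • (T.x i ^ (a - 1) * T.y i) * (T.y i ^ b * T.z i ^ c) =
        (a : ZMod ℓ) • T.loc i (up (deg i) (deg i + 1) (a, b, c)) := by
      simp only [up, loc, if_true, smul_mul_assoc, pow_succ', mul_assoc]
    by_cases hs : (a, b, c) ∈ src ℓ (deg i) (deg i + 1)
    · exact ⟨a, fun _ => by simp [coef], fun h => absurd hs h, e ▸ hd⟩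
    · refine ⟨0, fun h => absurd h hs, fun _ => rfl, ?_⟩
      have hab : a = 0 ∨ (¬Plain ℓ (deg i) ∧ b ≠ 0) := by
        simp only [src, Set.mem_ofPred_eq] at hs
        tauto
      rw [zero_smul]
      suffices h0 : (a : ZMod ℓ) • (T.x i ^ (a - 1) * T.y i) * (T.y i ^ b * T.z i ^ c) = 0 from
        h0 ▸ hd
      rcases hab with rfl | ⟨hp, hb⟩
      · simp
      · obtain ⟨b, rfl⟩ := Nat.exists_eq_succ_of_ne_zero hb
        have : T.y i * (T.y i ^ (b + 1) * T.z i ^ c) = 0 := by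
          rw [pow_succ', mul_assoc, ← mul_assoc, T.y_mul_y hp, zero_mul]
        rw [Nat.succ_eq_add_one, smul_mul_assoc, mul_assoc, this, mul_zero, smul_zero]
  · -- On the later pages only `x^{ℓ-1} y z^c` can support a differential.
    by_cases hab : a = 0 ∧ b = 0
    · obtain ⟨rfl, rfl⟩ := hab
      have hs : (0, 0, c) ∉ src ℓ (deg i) r := by
        simp only [src, Set.mem_ofPred_eq]
        grind
      refine ⟨0, fun h => absurd h hs, fun _ => rfl, ?_⟩
      simpa [loc] using hrow
    · have hu : ¬Plain ℓ (deg i) ∧ r ≤ (ℓ - 1) * deg i + 1 ∧ a = ℓ - 1 ∧ b = 1 := by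
        simp only [alive, Set.mem_ofPred_eq, Prod.mk_eq_zero] at hl
        grind
      obtain ⟨hp, hrN, rfl, rfl⟩ := hu
      have hz : S.DiffRel r (T.z i ^ c) 0 := by
        have := T.z_pow_mem hv
        exact diffRel_of_mem_row hr this
      have e : T.loc i (ℓ - 1, 1, c) = T.y i * T.x i ^ (ℓ - 1) * T.z i ^ c := by
        have hc : Commute (T.x i) (T.y i) := T.x_mul_y (even_of_not_plain hp)
        simp only [loc, pow_one]
        rw [← mul_assoc, (hc.pow_left (ℓ - 1)).eq]
      rw [e]
      rcases hrN.lt_or_eq with hlt | rfl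
      · have hs : (ℓ - 1, 1, c) ∉ src ℓ (deg i) r := by
          simp only [src, Set.mem_ofPred_eq]
          grind
        refine ⟨0, fun h => absurd h hs, fun _ => rfl, ?_⟩
        have := ((T.transgresses_z i hp).diffRel_of_lt hr hlt).mul_zero hz
        simpa using this
      · have hs : (ℓ - 1, 1, c) ∈ src ℓ (deg i) ((ℓ - 1) * deg i + 1) :=
          .inr ⟨hp, rfl, rfl, rfl⟩
        refine ⟨1, fun _ => (if_neg hr'.ne').symm, fun h => absurd hs h, ?_⟩
        have := (T.transgresses_z i hp).diffRel.mul_zero hz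
        rw [one_smul, up, if_neg hr'.ne']
        simpa [loc, pow_succ'] using this

end TransgressiveFamily

end SpectralSeq

theorem orderedProd_update_smul {I : Type*} [LinearOrder I] {F A : Type*} [CommRing F] [Ring A]
    [Algebra F A] (a : I → A) (c : F) (u : A) {s : Finset I} {i : I} (hi : i ∈ s) :
    orderedProd s (Function.update a i (c • u)) = c • orderedProd s (Function.update a i u) := by
  induction s using Finset.induction_on_min with
  | empty => exact absurd hi (Finset.notMem_empty i)
  | insert k s hk ih =>
    rw [orderedProd_insert _ hk, orderedProd_insert _ hk]
    rcases eq_or_ne i k with rfl | hik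
    · rw [Function.update_self, Function.update_self, smul_mul_assoc]
      congr 2
      exact orderedProd_congr fun j hj => by
        rw [Function.update_of_ne (hk j hj).ne', Function.update_of_ne (hk j hj).ne']
    · rw [Function.update_of_ne hik.symm, Function.update_of_ne hik.symm,
        ih (Finset.mem_of_mem_insert_of_ne hi hik), mul_smul_comm]

theorem Finsupp.sum_update_add_apply {I L : Type*} [Zero L] (m : I →₀ L) (i : I) (l : L)
    (g : I → L → ℕ) (hg : ∀ i, g i 0 = 0) :
    (m.update i l).sum g + g i (m i) = m.sum g + g i l := by
  classical
  rw [← Finsupp.add_sum_erase' m i _ hg, ← Finsupp.add_sum_erase' (m.update i l) i _ hg,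
    Finsupp.erase_update_eq_erase, Finsupp.update_apply, if_pos rfl]
  ring

theorem Finsupp.le_sum {I L : Type*} [Zero L] (m : I →₀ L) (i : I) (g : I → L → ℕ)
    (hg : ∀ i, g i 0 = 0) : g i (m i) ≤ m.sum g := by
  by_cases hi : i ∈ m.support
  · exact Finset.single_le_sum (f := fun i => g i (m i)) (fun _ _ => Nat.zero_le _) hi
  · rw [Finsupp.notMem_support_iff.1 hi, hg]
    exact Nat.zero_le _

/-! ### Homogeneous bases -/

/-- A basis of a graded vector space consisting of homogeneous elements. -/
structure HomogeneousBasis {F : Type*} [Field F] {H : Type*} [AddCommGroup H] [Module F H]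
    (𝓗 : ℕ → Submodule F H) (β : Type*) where
  basis : Module.Basis β F H
  deg : β → ℕ
  mem : ∀ b, basis b ∈ 𝓗 (deg b)

theorem exists_homogeneousBasis {F : Type*} [Field F] {H : Type u} [Ring H] [Algebra F H]
    (𝓗 : ℕ → Submodule F H) [GradedAlgebra 𝓗] :
    ∃ β : Type u, Nonempty (HomogeneousBasis 𝓗 β) := by
  have hi := DirectSum.Decomposition.isInternal 𝓗
  let v := fun n => Module.Basis.ofVectorSpace F (𝓗 n)
  exact ⟨_, ⟨hi.collectedBasis v, Sigma.fst, fun b => hi.collectedBasis_mem v b⟩⟩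

theorem HomogeneousBasis.repr_mem {F : Type*} [Field F] {H : Type*} [Ring H] [Algebra F H]
    {𝓗 : ℕ → Submodule F H} [GradedAlgebra 𝓗] {β : Type*} (B : HomogeneousBasis 𝓗 β) {n : ℕ}
    {h : H} (hh : h ∈ 𝓗 n) : B.basis.repr h ∈ Finsupp.supported F F {b | B.deg b = n} := by
  have key : ∀ h, B.basis.repr (GradedAlgebra.proj 𝓗 n h) ∈
      Finsupp.supported F F {b | B.deg b = n} := by
    intro h
    induction B.basis.mem_span h using Submodule.span_induction with
    | zero => simp
    | add x y _ _ hx hy => rw [map_add, map_add]; exact add_mem hx hy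
    | smul c x _ hx => rw [map_smul, map_smul]; exact Submodule.smul_mem _ _ hx
    | mem x hx =>
      obtain ⟨b, rfl⟩ := hx
      rw [GradedAlgebra.proj_apply]
      by_cases hb : B.deg b = n
      · rw [← hb, DirectSum.decompose_of_mem_same _ (B.mem b), B.basis.repr_self]
        exact Finsupp.single_mem_supported _ _ rfl
      · rw [DirectSum.decompose_of_mem_ne _ (B.mem b) hb, map_zero]
        exact zero_mem _
  have := key h
  rwa [GradedAlgebra.proj_apply, DirectSum.decompose_of_mem_same _ hh] at this

namespace SpectralSeq

open BorelModel

variable {ℓ : ℕ} [Fact ℓ.Prime] {H : Type u} [Ring H] [Algebra (ZMod ℓ) H]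
  {𝓗 : ℕ → Submodule (ZMod ℓ) H} {S : SpectralSeq.{u, v} 𝓗} {I : Type w}

namespace TransgressiveFamily

/-! ### The model given by a transgressive family -/

variable {deg : I → ℕ} (T : S.TransgressiveFamily deg) {β : Type*} (B : HomogeneousBasis 𝓗 β)

variable (deg) in
/-- The base degree of a monomial. -/
def baseDeg (m : I →₀ ℕ × ℕ × ℕ) : ℕ := m.sum fun i l => (bideg ℓ (deg i) l).1

variable (deg) in
/-- The fibre degree of a monomial. -/
def fibreDeg (m : I →₀ ℕ × ℕ × ℕ) : ℕ := m.sum fun i l => (bideg ℓ (deg i) l).2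

include T in
theorem bideg_update_up {r : ℕ} {m : I →₀ ℕ × ℕ × ℕ} {i : I} {l : ℕ × ℕ × ℕ}
    (h : m i ∈ src ℓ (deg i) r) (hl : up (deg i) r (m i) = l) :
    baseDeg (ℓ := ℓ) deg (m.update i l) = baseDeg (ℓ := ℓ) deg m + r ∧
      fibreDeg (ℓ := ℓ) deg (m.update i l) + r = fibreDeg (ℓ := ℓ) deg m + 1 := by
  have h₁ := Finsupp.sum_update_add_apply m i l (fun i l => (bideg ℓ (deg i) l).1)
    fun i => by simp [bideg]
  have h₂ := Finsupp.sum_update_add_apply m i l (fun i l => (bideg ℓ (deg i) l).2)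
    fun i => by simp [bideg]
  have h₃ := bideg_up (Fact.out : ℓ.Prime).two_le (T.one_le_deg i) h
  rw [hl] at h₃
  unfold baseDeg fibreDeg
  omega

include T in
theorem eq_zero_of_alive {r : ℕ} {m : I →₀ ℕ × ℕ × ℕ} (hm : ∀ i, m i ∈ alive ℓ (deg i) r)
    (hp : baseDeg (ℓ := ℓ) deg m < r) (hq : fibreDeg (ℓ := ℓ) deg m + 1 < r) : m = 0 := by
  ext1 i
  by_contra h0
  have h₁ := Finsupp.le_sum m i (fun i l => (bideg ℓ (deg i) l).1) fun i => by simp [bideg]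
  have h₂ := Finsupp.le_sum m i (fun i l => (bideg ℓ (deg i) l).2) fun i => by simp [bideg]
  have h₃ := le_of_mem_alive (Fact.out : ℓ.Prime).two_le (T.one_le_deg i) (hm i) h0
  unfold baseDeg at hp
  unfold fibreDeg at hq
  omega

include T in
/-- On the limit page only the cells given by the basis of `H` are alive. -/
theorem limit_cells {r p q : ℕ} (hr : max p (q + 1) < r) (m : (I →₀ ℕ × ℕ × ℕ) × β)
    (hm : (∀ i, m.1 i ∈ alive ℓ (deg i) r) ∧
      (baseDeg (ℓ := ℓ) deg m.1 + B.deg m.2, fibreDeg (ℓ := ℓ) deg m.1) = (p, q)) :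
    m.1 = 0 ∧ B.deg m.2 = p ∧ q = 0 := by
  obtain ⟨h₁, h₂⟩ := Prod.mk.inj hm.2
  have h0 := T.eq_zero_of_alive hm.1 (by omega) (by omega)
  refine ⟨h0, ?_, ?_⟩
  · rw [h0] at h₁
    simpa [baseDeg] using h₁
  · rw [h0] at h₂
    simpa [fibreDeg] using h₂.symm

variable [LinearOrder I]

/-- The monomial in the `x_i`, `y_i`, `z_i` with the exponents `m`. -/
noncomputable def monomial (m : I →₀ ℕ × ℕ × ℕ) : S.E 2 :=
  orderedProd m.support fun i => T.loc i (m i)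

/-- The linear map sending the cell `(m, b)` to the product of the monomial `m` with the basis
element `b` of `H`. -/
noncomputable def cellMap : ((I →₀ ℕ × ℕ × ℕ) × β →₀ ZMod ℓ) →ₗ[ZMod ℓ] S.E 2 :=
  Finsupp.linearCombination (ZMod ℓ) fun j => T.monomial j.1 * S.η 2 (B.basis j.2)

theorem cellMap_single (m : I →₀ ℕ × ℕ × ℕ) (b : β) (c : ZMod ℓ) :
    T.cellMap B (Finsupp.single (m, b) c) = c • (T.monomial m * S.η 2 (B.basis b)) := by
  simp [cellMap]

theorem monomial_mem {m : I →₀ ℕ × ℕ × ℕ} (h : ∀ i, m i ∈ valid ℓ (deg i)) :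
    T.monomial m ∈ S.gr 2 (baseDeg (ℓ := ℓ) deg m, fibreDeg (ℓ := ℓ) deg m) := by
  have := orderedProd_mem_graded (S.gr 2) (a := fun i => T.loc i (m i))
    (d := fun i => bideg ℓ (deg i) (m i)) (s := m.support) fun i _ => T.loc_mem (h i)
  rw [monomial]
  convert this using 2
  exact Prod.ext (Prod.fst_sum).symm (Prod.snd_sum).symm

/-- The map of cells commutes with the differentials. -/
theorem diffRel_cellMap {r : ℕ} (hr : 2 ≤ r) {m : I →₀ ℕ × ℕ × ℕ}
    (hm : ∀ i, m i ∈ alive ℓ (deg i) r) (b : β) :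
    S.DiffRel r (T.cellMap B (Finsupp.single (m, b) 1))
      (T.cellMap B ((matching ℓ T.one_le_deg r).diff β (Finsupp.single (m, b) 1))) := by
  have hv : ∀ i, m i ∈ valid ℓ (deg i) := fun i =>
    alive_subset_valid (Fact.out : ℓ.Prime).two_le (hm i)
  choose c hc hc' hd using fun i => T.diffRel_loc hr (hm i)
  have h₁ := (diffRel_orderedProd hr (s := m.support) (fun i _ => T.loc_mem (hv i))
    fun i _ => hd i).mul_zero (diffRel_η hr (B.basis b))
  rw [cellMap_single, one_smul, monomial]
  convert h₁ using 1
  rw [MatchingFamily.diff_single, one_smul, map_sum, Finset.sum_mul]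
  refine Finset.sum_congr rfl fun i hi => ?_
  rw [orderedProd_update_smul _ _ _ hi, smul_smul]
  by_cases hs : m i ∈ src ℓ (deg i) r
  · have hs' : m i ∈ (matching ℓ T.one_le_deg r).src i := hs
    rw [MatchingFamily.term_of_mem _ _ hs', cellMap_single, smul_mul_assoc, hc i hs, monomial,
      MatchingFamily.support_update_up _ hs']
    congr 2
    refine orderedProd_congr fun j _ => ?_
    rcases eq_or_ne j i with rfl | hj
    · rw [Function.update_self, MatchingFamily.update_apply_self]
      rfl
    · rw [Function.update_of_ne hj, MatchingFamily.update_apply_of_ne hj]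
  · rw [MatchingFamily.term_of_notMem _ _ hs, hc' i hs, map_zero, mul_zero, zero_smul, zero_mul]

theorem cellMap_mapDomain (c : β →₀ ZMod ℓ) :
    T.cellMap B (c.mapDomain fun b => (0, b)) =
      S.η 2 (Finsupp.linearCombination (ZMod ℓ) B.basis c) := by
  induction c using Finsupp.induction_linear with
  | zero => simp
  | add x y hx hy => rw [Finsupp.mapDomain_add, map_add, hx, hy, map_add, map_add]
  | single b c =>
    rw [Finsupp.mapDomain_single, cellMap_single]
    simp [monomial]

/-- The tensor product of `H` and the elementary complexes of all generators, as a model of the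
spectral sequence. -/
noncomputable def model [GradedAlgebra 𝓗] (conv : S.ConvergesToBase) :
    S.CellularModel ((I →₀ ℕ × ℕ × ℕ) × β) where
  f := T.cellMap B
  bideg j := (baseDeg (ℓ := ℓ) deg j.1 + B.deg j.2, fibreDeg (ℓ := ℓ) deg j.1)
  alive r := {j | ∀ i, j.1 i ∈ alive ℓ (deg i) r}
  D r := (matching ℓ T.one_le_deg r).diff β
  f_mem := by
    rintro ⟨m, b⟩ h
    rw [cellMap_single, one_smul]
    exact SetLike.GradedMul.mul_mem
      (T.monomial_mem fun i => alive_subset_valid (Fact.out : ℓ.Prime).two_le (h i))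
      (S.η_mem 2 le_rfl _ _ (B.mem b))
  alive_succ_subset r _ j hj i :=
    ((alive_succ_iff (Fact.out : ℓ.Prime).two_le (T.one_le_deg i)).1 (hj i)).1
  diffRel r hr j hj := T.diffRel_cellMap B hr hj j.2
  D_mem := by
    rintro r hr ⟨m, b⟩ hm
    refine MatchingFamily.diff_single_mem _ fun i hi => ?_
    have ht := up_mem (Fact.out : ℓ.Prime).two_le (T.one_le_deg i) hi
    obtain ⟨h₁, h₂⟩ := T.bideg_update_up (m := m) hi rfl
    refine ⟨fun j => ?_, fun h => ?_, ?_, h₂⟩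
    · rcases eq_or_ne j i with rfl | hj
      · rw [MatchingFamily.update_apply_self]
        exact tgt_subset_alive ht
      · rw [MatchingFamily.update_apply_of_ne hj]
        exact hm j
    · have := h i
      rw [MatchingFamily.update_apply_self] at this
      exact ((alive_succ_iff (Fact.out : ℓ.Prime).two_le (T.one_le_deg i)).1 this).2.2 ht
    · exact (congrArg (· + B.deg b) h₁).trans (Nat.add_right_comm _ _ _)
  D_D r _ m _ := MatchingFamily.diff_diff _ m
  D_eq_zero := by
    rintro r hr ⟨m, b⟩ hm
    exact MatchingFamily.diff_single_of_isCritical _ (fun i =>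
      ((alive_succ_iff (Fact.out : ℓ.Prime).two_le (T.one_le_deg i)).1 (hm i)).2) b 1
  exact r hr p q z hz hD := by
    refine ⟨(matching ℓ T.one_le_deg r).contraction z, ?_, ?_⟩
    · refine MatchingFamily.contraction_mem _ ?_ hz
      rintro m b ⟨hm, hpq⟩ i hi
      have hs := down_mem (Fact.out : ℓ.Prime).two_le (T.one_le_deg i) hi
      obtain ⟨h₁, h₂⟩ := T.bideg_update_up (m := m.update i (down ℓ (deg i) r (m i))) (i := i)
        (r := r) (by rwa [MatchingFamily.update_apply_self])
        (by rw [MatchingFamily.update_apply_self,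
          up_down (Fact.out : ℓ.Prime).two_le (T.one_le_deg i) hi])
      rw [Finsupp.update_idem, Finsupp.update_self] at h₁ h₂
      obtain ⟨h₃, h₄⟩ := Prod.mk.inj hpq
      dsimp only at h₃ h₄
      refine ⟨fun j => ?_, ?_, ?_⟩
      · rcases eq_or_ne j i with rfl | hj
        · dsimp only
          rw [MatchingFamily.update_apply_self]
          exact src_subset_alive hs
        · dsimp only
          rw [MatchingFamily.update_apply_of_ne hj]
          exact hm j
      · change baseDeg (ℓ := ℓ) deg (m.update i (down ℓ (deg i) r (m i))) + B.deg b + r = p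
        omega
      · change fibreDeg (ℓ := ℓ) deg (m.update i (down ℓ (deg i) r (m i))) + 1 = q + r
        omega
    · refine Finsupp.supported_mono ?_ (MatchingFamily.sub_diff_contraction_mem _ hz hD)
      rintro m ⟨⟨hm, hpq⟩, hc⟩
      exact ⟨fun i => (alive_succ_iff (Fact.out : ℓ.Prime).two_le (T.one_le_deg i)).2
        ⟨hm i, hc i⟩, hpq⟩
  limit_injective r p q hr _ m hm h := by
    have hinj : Function.Injective fun b : β => ((0 : I →₀ ℕ × ℕ × ℕ), b) :=
      fun _ _ h => (Prod.mk.inj h).2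
    have hcell := T.limit_cells B hr
    let c : β →₀ ZMod ℓ := m.comapDomain (fun b => (0, b)) hinj.injOn
    have hmc : c.mapDomain (fun b => (0, b)) = m := by
      refine Finsupp.mapDomain_comapDomain _ hinj m fun j hj => ?_
      exact ⟨j.2, Prod.ext (hcell j (hm hj)).1.symm rfl⟩
    by_cases hq : q = 0
    · subst hq
      rw [← hmc, T.cellMap_mapDomain] at h
      have h0 := (survives_η h.two_le _).unique h
      have hmem : Finsupp.linearCombination (ZMod ℓ) B.basis c ∈ 𝓗 p := by
        rw [Finsupp.linearCombination_apply]
        refine sum_mem fun b hb => Submodule.smul_mem _ _ ?_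
        have hb' : ((0 : I →₀ ℕ × ℕ × ℕ), b) ∈ m.support := by
          simpa [c] using hb
        exact (hcell _ (hm hb')).2.1 ▸ B.mem b
      have hc := eq_zero_of_η_eq_zero conv hr hmem h0
      rw [← hmc, linearIndependent_iff.1 B.basis.linearIndependent c hc, Finsupp.mapDomain_zero]
    · by_contra hne
      obtain ⟨j, hj⟩ := Finsupp.support_nonempty_iff.2 hne
      exact hq (hcell j (hm hj)).2.2
  limit_surjective r p q hr hr2 e he := by
    by_cases hq : q = 0
    · subst hq
      obtain ⟨h, hh, rfl⟩ := exists_η_eq conv hr he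
      refine ⟨(B.basis.repr h).mapDomain fun b => (0, b), ?_, ?_⟩
      · intro j hj
        classical
        obtain ⟨b, hb, rfl⟩ := Finset.mem_image.1 (Finsupp.mapDomain_support hj)
        refine ⟨fun i => .inl rfl, ?_⟩
        have : B.deg b = p := B.repr_mem hh hb
        simp [baseDeg, fibreDeg, this]
      · rw [T.cellMap_mapDomain, B.basis.linearCombination_repr]
        exact survives_η hr2 h
    · rw [limit_eq_zero conv hr hq he]
      exact ⟨0, zero_mem _, by rw [map_zero]; exact survives_zero hr2⟩

end TransgressiveFamily

end SpectralSeq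

namespace SpectralSeq

variable {F : Type} [Field F] {H : Type u} [Ring H] [Algebra F H] {𝓗 : ℕ → Submodule F H}
  {S : SpectralSeq.{u, v} 𝓗} {β : Type*} (B : HomogeneousBasis 𝓗 β)

/-! ### Freeness of `E_2` over the base -/

/-- The linear map with value `(-1)^{nk} h` at `h ∈ H^k`, which describes the commutation of `H`
with elements of degree `n`. -/
noncomputable def twist (n : ℕ) : H →ₗ[F] H :=
  B.basis.constr F fun b => (-1 : F) ^ (n * B.deg b) • B.basis b

theorem twist_basis (n : ℕ) (b : β) :
    twist B n (B.basis b) = (-1 : F) ^ (n * B.deg b) • B.basis b := by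
  simp [twist]

theorem twist_twist (n : ℕ) (h : H) : twist B n (twist B n h) = h := by
  suffices (twist B n).comp (twist B n) = LinearMap.id from LinearMap.congr_fun this h
  refine B.basis.ext fun b => ?_
  rw [LinearMap.comp_apply, twist_basis, map_smul, twist_basis, smul_smul, ← mul_pow]
  simp

theorem mul_η_eq {n : ℕ} {x : S.E 2} (hx : x ∈ S.gr 2 (0, n)) (h : H) :
    x * S.η 2 h = S.η 2 (twist B n h) * x := by
  induction B.basis.mem_span h using Submodule.span_induction with
  | zero => simp
  | add a b _ _ ha hb => simp only [map_add, mul_add, add_mul, ha, hb]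
  | smul c a _ ha => simp only [map_smul, mul_smul_comm, smul_mul_assoc, ha]
  | mem a ha =>
    obtain ⟨b, rfl⟩ := ha
    rw [twist_basis, map_smul, smul_mul_assoc,
      S.comm 2 le_rfl _ _ _ hx _ (S.η_mem 2 le_rfl _ _ (B.mem b))]
    simp

theorem mem_V_of_mem {p : ℕ} {v : S.E 2} (hv : v ∈ S.gr 2 (p, 0)) : v ∈ S.V :=
  Submodule.mem_iSup_of_mem (p := fun p => S.gr 2 (p, 0)) p hv

theorem induction_V {motive : S.E 2 → Prop} (zero : motive 0)
    (mem : ∀ p, ∀ v ∈ S.gr 2 (p, 0), motive v)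
    (add : ∀ v w, motive v → motive w → motive (v + w)) {v : S.E 2} (hv : v ∈ S.V) : motive v :=
  Submodule.iSup_induction (fun p => S.gr 2 (p, 0)) (motive := motive) hv mem zero add

theorem proj_mul {q : ℕ} {x : S.E 2} (hx : x ∈ S.gr 2 (0, q)) (n q' : ℕ) {v : S.E 2}
    (hv : v ∈ S.V) : GradedAlgebra.proj (S.gr 2) (n, q') (x * v) =
      if q = q' then x * GradedAlgebra.proj (S.gr 2) (n, 0) v else 0 := by
  refine induction_V (motive := fun v => GradedAlgebra.proj (S.gr 2) (n, q') (x * v) =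
      if q = q' then x * GradedAlgebra.proj (S.gr 2) (n, 0) v else 0) (by simp) ?_ ?_ hv
  · intro p v hv
    have hxv : x * v ∈ S.gr 2 (p, q) := by
      simpa using SetLike.GradedMul.mul_mem hx hv
    by_cases hpq : (p, q) = (n, q')
    · obtain ⟨rfl, rfl⟩ := Prod.mk.inj hpq
      rw [S.proj_of_mem hxv, S.proj_of_mem hv, if_pos rfl]
    · rw [S.proj_of_mem_ne hxv hpq]
      split_ifs with hq
      · rw [S.proj_of_mem_ne hv, mul_zero]
        rintro h
        obtain ⟨rfl, -⟩ := Prod.mk.inj h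
        exact hpq (by rw [hq])
      · rfl
  · intro v w hv hw
    rw [mul_add, map_add, map_add, hv, hw]
    split_ifs
    · rw [mul_add]
    · rw [add_zero]

include B in
/-- If the left `H`-module `W` is free on homogeneous elements `ω a`, then so is the right
`H`-module `W`. -/
theorem exists_rightCoordinates {A : Type*} (ω : A → S.W) (deg : A → ℕ)
    (hω : ∀ a, (ω a : S.E 2) ∈ S.gr 2 (0, deg a))
    (hb : Function.Bijective fun c : A →₀ H => c.sum fun a h => S.toW h * ω a) :
    ∃ R : (A →₀ H) ≃ₗ[F] S.W, ∀ a h, R (Finsupp.single a h) = ω a * S.toW h := by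
  let Λ : (A →₀ H) →ₗ[F] S.W := Finsupp.lsum F fun a =>
    (LinearMap.mulRight F (ω a)).comp S.toW.toLinearMap
  have hΛ : Function.Bijective Λ := by
    have : ⇑Λ = fun c : A →₀ H => c.sum fun a h => S.toW h * ω a := by
      funext c
      rw [Finsupp.lsum_apply]
      rfl
    rwa [this]
  let t : (A →₀ H) →ₗ[F] (A →₀ H) := Finsupp.lsum F fun a =>
    (Finsupp.lsingle a).comp (twist B (deg a))
  have ht : Function.Involutive t := by
    intro c
    suffices t.comp t = LinearMap.id from LinearMap.congr_fun this c
    ext a h : 2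
    simp [t, twist_twist]
  refine ⟨(LinearEquiv.ofInvolutive t ht).trans (LinearEquiv.ofBijective Λ hΛ), fun a h => ?_⟩
  apply Subtype.ext
  have := mul_η_eq B (hω a) h
  simpa [t, Λ, toW] using this.symm

/-- If `E_2 = W ⊗_H V` and the left `H`-module `W` is free on homogeneous elements `ω a`, then
`E_2` is a free right `V`-module on the `ω a`. -/
theorem bijective_sum_mul [GradedAlgebra 𝓗] (split : S.SplitsE2) {A : Type*} (ω : A → S.W)
    (deg : A → ℕ) (hω : ∀ a, (ω a : S.E 2) ∈ S.gr 2 (0, deg a))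
    (hb : Function.Bijective fun c : A →₀ H => c.sum fun a h => S.toW h * ω a) :
    Function.Bijective fun c : A →₀ S.V => c.sum fun a v => (ω a : S.E 2) * v := by
  obtain ⟨β, ⟨B⟩⟩ := exists_homogeneousBasis 𝓗
  obtain ⟨R, hR⟩ := exists_rightCoordinates B ω deg hω hb
  let K : (A →₀ H) →ₗ[F] S.V →ₗ[F] (A →₀ S.V) := Finsupp.lsum F fun a =>
    ((LinearMap.mul F S.V).comp S.toV.toLinearMap).compr₂ (Finsupp.lsingle a)
  have hK : ∀ a h v, K (Finsupp.single a h) v = Finsupp.single a (S.toV h * v) := by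
    intro a h v
    simp [K]
  -- The coordinates `w ⊗ v ↦ (h_a v)_a` for `w = ∑ ω a * h_a`, which factor over `W ⊗_H V`.
  let Θ : S.W ⊗[F] S.V →ₗ[F] (A →₀ S.V) := TensorProduct.lift (K.comp R.symm.toLinearMap)
  have hΘ : S.balance ≤ LinearMap.ker Θ := by
    refine Submodule.span_le.2 ?_
    rintro _ ⟨w, h, v, rfl⟩
    obtain ⟨c, rfl⟩ := R.surjective w
    have key : R c * S.toW h = R (c.mapRange (· * h) (zero_mul h)) := by
      induction c using Finsupp.induction_linear with
      | zero => simp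
      | add a b ha hb =>
        rw [map_add, add_mul, ha, hb, Finsupp.mapRange_add (fun x y => add_mul x y h), map_add]
      | single a k => rw [Finsupp.mapRange_single, hR, hR, map_mul, mul_assoc]
    change Θ _ = 0
    rw [map_sub, sub_eq_zero, key]
    simp only [Θ, TensorProduct.lift.tmul, LinearMap.comp_apply, LinearEquiv.coe_coe,
      LinearEquiv.symm_apply_apply]
    clear key
    induction c using Finsupp.induction_linear with
    | zero => simp
    | add a b ha hb =>
      rw [Finsupp.mapRange_add (fun x y => add_mul x y h), map_add, map_add, LinearMap.add_apply,
        LinearMap.add_apply, ha, hb]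
    | single a k => rw [Finsupp.mapRange_single, hK, hK, map_mul, mul_assoc]
  have hΘω : ∀ a v, Θ (ω a ⊗ₜ v) = Finsupp.single a v := by
    intro a v
    have : ω a = R (Finsupp.single a 1) := by rw [hR, map_one, mul_one]
    simp [Θ, this, hK]
  let t : (A →₀ S.V) →ₗ[F] S.W ⊗[F] S.V :=
    Finsupp.lsum F fun a => TensorProduct.mk F S.W S.V (ω a)
  have ht : ∀ a v, t (Finsupp.single a v) = ω a ⊗ₜ v := by intro a v; simp [t]
  have hΘt : ∀ c, Θ (t c) = c := by
    intro c
    induction c using Finsupp.induction_linear with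
    | zero => simp
    | add a b ha hb => rw [map_add, map_add, ha, hb]
    | single a k => rw [ht, hΘω]
  have hmul : (fun c : A →₀ S.V => c.sum fun a v => (ω a : S.E 2) * v) = S.mulWV.comp t := by
    funext c
    simp only [t, LinearMap.comp_apply, Finsupp.lsum_apply, Finsupp.sum, map_sum]
    simp [mulWV]
  rw [hmul]
  constructor
  · rw [← LinearMap.ker_eq_bot, LinearMap.ker_eq_bot']
    intro c hc
    have h1 : S.balance.liftQ S.mulWV S.balance_le_ker (Submodule.Quotient.mk (t c)) = 0 := hc
    have h2 := split.1 (h1.trans (map_zero _).symm)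
    rw [Submodule.Quotient.mk_eq_zero] at h2
    rw [← hΘt c]
    exact hΘ h2
  · intro e
    obtain ⟨s, rfl⟩ := split.2 e
    obtain ⟨s, rfl⟩ := Submodule.Quotient.mk_surjective _ s
    change ∃ c, S.mulWV (t c) = S.mulWV s
    induction s using TensorProduct.induction_on with
    | zero => exact ⟨0, by simp⟩
    | add a b ha hb =>
      obtain ⟨c, hc⟩ := ha
      obtain ⟨d, hd⟩ := hb
      exact ⟨c + d, by simp only [map_add, hc, hd]⟩
    | tmul w v =>
      obtain ⟨c, rfl⟩ := R.surjective w
      induction c using Finsupp.induction_linear with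
      | zero => exact ⟨0, by simp⟩
      | add a b ha hb =>
        obtain ⟨c, hc⟩ := ha
        obtain ⟨d, hd⟩ := hb
        exact ⟨c + d, by simp only [map_add, TensorProduct.add_tmul, hc, hd]⟩
      | single a k =>
        refine ⟨Finsupp.single a (S.toV k * v), ?_⟩
        rw [ht, hR]
        simp [mulWV, toV, toW, mul_assoc]

end SpectralSeq

namespace SpectralSeq

open BorelModel

variable {ℓ : ℕ} [Fact ℓ.Prime] {H : Type u} [Ring H] [Algebra (ZMod ℓ) H]
  {𝓗 : ℕ → Submodule (ZMod ℓ) H} {S : SpectralSeq.{u, v} 𝓗} {I : Type w}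

namespace TransgressiveFamily

/-! ### Comparison on the second page -/

/-- The exponents of the `x_i` in a monomial. -/
noncomputable def fibrePart (m : I →₀ ℕ × ℕ × ℕ) : I →₀ ℕ := m.mapRange Prod.fst rfl

/-- The part of a monomial in the `y_i` and `z_i`. -/
noncomputable def basePart (m : I →₀ ℕ × ℕ × ℕ) : I →₀ ℕ × ℕ × ℕ :=
  m.mapRange (fun l => (0, l.2)) rfl

/-- The monomial with given fibre part and base part. -/
noncomputable def combine (a : I →₀ ℕ) (m : I →₀ ℕ × ℕ × ℕ) : I →₀ ℕ × ℕ × ℕ :=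
  Finsupp.zipWith (fun k l => (k, l.2)) rfl a m

theorem fibrePart_combine (a : I →₀ ℕ) (m : I →₀ ℕ × ℕ × ℕ) : fibrePart (combine a m) = a := by
  ext i; simp [fibrePart, combine]

theorem basePart_combine (a : I →₀ ℕ) (m : I →₀ ℕ × ℕ × ℕ) :
    basePart (combine a m) = basePart m := by
  ext i <;> simp [basePart, combine]

theorem ext_parts {m n : I →₀ ℕ × ℕ × ℕ} (h : fibrePart m = fibrePart n)
    (h' : basePart m = basePart n) : m = n := by
  ext1 i
  have h₁ : (m i).1 = (n i).1 := DFunLike.congr_fun h i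
  have h₂ : ((0 : ℕ), (m i).2) = (0, (n i).2) := DFunLike.congr_fun h' i
  exact Prod.ext h₁ (Prod.mk.inj h₂).2

theorem basePart_valid {deg : I → ℕ} {m : I →₀ ℕ × ℕ × ℕ} (h : ∀ i, m i ∈ valid ℓ (deg i))
    (i : I) : basePart m i ∈ valid ℓ (deg i) := by
  have := h i
  have hℓ := (Fact.out : ℓ.Prime).pos
  simp only [valid, basePart, Finsupp.mapRange_apply, Set.mem_ofPred_eq] at *
  grind

theorem fibrePart_simple {deg : I → ℕ} {m : I →₀ ℕ × ℕ × ℕ} (h : ∀ i, m i ∈ valid ℓ (deg i))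
    (i : I) : fibrePart m i < ℓ ∧ (Odd (deg i) → fibrePart m i ≤ 1) := by
  have := h i
  have hℓ := (Fact.out : ℓ.Prime).two_le
  simp only [valid, fibrePart, Finsupp.mapRange_apply, Set.mem_ofPred_eq, Plain] at *
  grind

omit [Fact ℓ.Prime] in
theorem combine_valid {deg : I → ℕ} {a : I →₀ ℕ} {m : I →₀ ℕ × ℕ × ℕ}
    (ha : ∀ i, a i < ℓ ∧ (Odd (deg i) → a i ≤ 1)) (h : ∀ i, m i ∈ valid ℓ (deg i)) (i : I) :
    combine a m i ∈ valid ℓ (deg i) := by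
  have := h i
  have := ha i
  simp only [valid, combine, Finsupp.zipWith_apply, Set.mem_ofPred_eq, Plain] at *
  grind

omit [Fact ℓ.Prime] in
theorem baseDeg_basePart (deg : I → ℕ) (m : I →₀ ℕ × ℕ × ℕ) :
    baseDeg (ℓ := ℓ) deg (basePart m) = baseDeg (ℓ := ℓ) deg m := by
  unfold baseDeg basePart
  rw [Finsupp.sum_mapRange_index (fun i => by simp [bideg])]
  rfl

omit [Fact ℓ.Prime] in
theorem fibreDeg_basePart (deg : I → ℕ) (m : I →₀ ℕ × ℕ × ℕ) :
    fibreDeg (ℓ := ℓ) deg (basePart m) = 0 := by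
  unfold fibreDeg basePart
  rw [Finsupp.sum_mapRange_index (fun i => by simp [bideg])]
  simp [bideg]

omit [Fact ℓ.Prime] in
theorem fibreDeg_eq (deg : I → ℕ) (m : I →₀ ℕ × ℕ × ℕ) :
    fibreDeg (ℓ := ℓ) deg m = (fibrePart m).sum fun i k => k * deg i := by
  unfold fibreDeg fibrePart
  rw [Finsupp.sum_mapRange_index (fun i => by simp)]
  rfl

variable {deg : I → ℕ} (T : S.TransgressiveFamily deg) {β : Type*} (B : HomogeneousBasis 𝓗 β)

include T in
theorem basePart_eq_self {m : I →₀ ℕ × ℕ × ℕ} (h : fibreDeg (ℓ := ℓ) deg m = 0) :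
    basePart m = m := by
  ext1 i
  have h₁ := Finsupp.le_sum m i (fun i l => (bideg ℓ (deg i) l).2) fun i => by simp [bideg]
  have h₂ : (m i).1 * deg i = 0 := Nat.le_zero.1 (h₁.trans_eq h)
  have h₃ : (m i).1 = 0 :=
    (Nat.mul_eq_zero.1 h₂).resolve_right (by have := T.one_le_deg i; omega)
  exact Prod.ext h₃.symm rfl

variable [LinearOrder I]

theorem orderedMonomial_mem (a : I →₀ ℕ) :
    orderedMonomial T.x a ∈ S.gr 2 (0, a.sum fun i k => k * deg i) := by
  have := orderedProd_mem_graded (S.gr 2) (a := fun i => T.x i ^ a i)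
    (d := fun i => (0, a i * deg i)) (s := a.support) fun i _ => T.x_pow_mem i (a i)
  rw [orderedMonomial_eq]
  convert this using 2
  exact Prod.ext (by simp [Prod.fst_sum]) (by simp [Prod.snd_sum, Finsupp.sum])

/-- The factors of a monomial can be separated, up to a sign. -/
theorem monomial_eqUpToSign {m : I →₀ ℕ × ℕ × ℕ} (h : ∀ i, m i ∈ valid ℓ (deg i)) :
    EqUpToSign (ZMod ℓ) (T.monomial m)
      (orderedMonomial T.x (fibrePart m) * T.monomial (basePart m)) := by
  have h₁ : orderedMonomial T.x (fibrePart m) =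
      orderedProd m.support fun i => T.x i ^ (m i).1 := by
    rw [orderedMonomial_eq]
    refine orderedProd_subset _ Finsupp.support_mapRange fun i _ hi => ?_
    rw [Finsupp.notMem_support_iff.1 hi, pow_zero]
  have h₂ : T.monomial (basePart m) =
      orderedProd m.support fun i => T.y i ^ (m i).2.1 * T.z i ^ (m i).2.2 := by
    refine (orderedProd_subset _ (t := m.support) Finsupp.support_mapRange
      fun i _ hi => ?_).trans (orderedProd_congr fun i _ => by simp [loc, basePart])
    rw [basePart, Finsupp.notMem_support_iff.1 hi, T.loc_zero]
  rw [h₁, h₂]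
  exact orderedProd_mul fun i _ j _ => eqUpToSign_comm (T.base_mem (h i)) (T.x_pow_mem j _)

variable [GradedAlgebra 𝓗] (conv : S.ConvergesToBase)
  (hΨ : Function.Bijective fun c : SimpleExponent ℓ deg →₀ S.V =>
    c.sum fun a v => orderedMonomial T.x a.1 * (v : S.E 2))

theorem mem_page_two {n q : ℕ} {m : (I →₀ ℕ × ℕ × ℕ) × β →₀ ZMod ℓ} :
    m ∈ (T.model B conv).page 2 n q ↔ ∀ j ∈ m.support, (∀ i, j.1 i ∈ valid ℓ (deg i)) ∧
      baseDeg (ℓ := ℓ) deg j.1 + B.deg j.2 = n ∧ fibreDeg (ℓ := ℓ) deg j.1 = q := by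
  refine forall₂_congr fun j _ => and_congr (forall_congr' fun i => ?_) Prod.mk_inj
  exact ⟨fun h => alive_subset_valid (Fact.out : ℓ.Prime).two_le h,
    fun h => valid_subset_alive_two (T.one_le_deg i) h⟩

include hΨ in
theorem surj_two {n : ℕ} (hs : (T.model B conv).Surj 2 n 0) (q : ℕ) :
    (T.model B conv).Surj 2 n q := by
  intro e he
  suffices ∃ m ∈ (T.model B conv).page 2 n q, T.cellMap B m = e by
    obtain ⟨m, hm, h⟩ := this
    exact ⟨m, hm, survives_two_iff.2 h.symm⟩
  change e ∈ Submodule.map (T.cellMap B) ((T.model B conv).page 2 n q)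
  obtain ⟨c, hc⟩ := hΨ.2 e
  replace hc : (c.sum fun a v => orderedMonomial T.x a.1 * (v : S.E 2)) = e := hc
  rw [← S.proj_of_mem he, ← hc, Finsupp.sum, map_sum]
  refine sum_mem fun a _ => ?_
  rw [proj_mul (T.orderedMonomial_mem a.1) n q (c a).2]
  split_ifs with hq
  · obtain ⟨m, hm, hme⟩ := hs _ (S.proj_mem (n, 0) (c a : S.E 2))
    rw [survives_two_iff.1 hme]
    change orderedMonomial T.x a.1 * T.cellMap B m ∈ _
    refine supported_induction (T := {j | j ∈ (T.model B conv).alive 2 ∧ _})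
      (motive := fun m => orderedMonomial T.x a.1 * T.cellMap B m ∈
      Submodule.map (T.cellMap B) ((T.model B conv).page 2 n q)) (by simp) ?_ ?_ ?_ hm
    · rintro ⟨m, b⟩ hj
      have hj' : Finsupp.single (m, b) 1 ∈ (T.model B conv).page 2 n 0 :=
        Finsupp.single_mem_supported _ _ hj
      rw [mem_page_two] at hj'
      obtain ⟨hv, hb, hf⟩ := hj' (m, b) (by simp)
      have hv' := combine_valid a.2 hv
      have hsgn := T.monomial_eqUpToSign hv'
      rw [fibrePart_combine, basePart_combine, T.basePart_eq_self hf] at hsgn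
      obtain ⟨k, hk⟩ := hsgn.symm
      rw [cellMap_single, one_smul, ← mul_assoc, hk, smul_mul_assoc]
      refine Submodule.smul_mem _ _ ⟨Finsupp.single (combine a.1 m, b) 1, ?_, ?_⟩
      · rw [SetLike.mem_coe, mem_page_two]
        intro j hj
        obtain rfl : j = (combine a.1 m, b) := by simpa using hj
        refine ⟨hv', ?_, ?_⟩
        · rw [← hb, ← baseDeg_basePart deg (combine a.1 m), basePart_combine, baseDeg_basePart]
        · rw [fibreDeg_eq, fibrePart_combine, hq]
      · rw [cellMap_single, one_smul]
    · intro m m' hm hm'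
      rw [map_add, mul_add]
      exact add_mem hm hm'
    · intro k m hm
      rw [map_smul, mul_smul_comm]
      exact Submodule.smul_mem _ _ hm
  · exact zero_mem _

include hΨ in
theorem inj_two {n : ℕ} (hi : (T.model B conv).Inj 2 n 0) (q : ℕ) :
    (T.model B conv).Inj 2 n q := by
  classical
  intro m hm hfm
  have hfm' : T.cellMap B m = 0 := (survives_two_iff.1 hfm).symm
  rw [mem_page_two] at hm
  choose! k hk using fun (m : I →₀ ℕ × ℕ × ℕ) (h : ∀ i, m i ∈ valid ℓ (deg i)) =>
    T.monomial_eqUpToSign h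
  -- The coefficient of `m` at the `x`-monomial `a`, as an element of the model in the base row.
  let N : (I →₀ ℕ) → ((I →₀ ℕ × ℕ × ℕ) × β →₀ ZMod ℓ) := fun a =>
    ∑ j ∈ m.support with fibrePart j.1 = a,
      Finsupp.single (basePart j.1, j.2) (m j * (-1) ^ k j.1)
  have hN : ∀ a, N a ∈ (T.model B conv).page 2 n 0 := by
    intro a
    refine sum_mem fun j hj => ?_
    rw [mem_page_two]
    intro j' hj'
    obtain rfl : j' = (basePart j.1, j.2) := by
      simpa using Finsupp.support_single_subset hj'
    obtain ⟨h₁, h₂, -⟩ := hm j (Finset.mem_filter.1 hj).1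
    exact ⟨basePart_valid h₁, by rw [baseDeg_basePart, h₂], fibreDeg_basePart _ _⟩
  have hfN : ∀ a, T.cellMap B (N a) ∈ S.V := fun a =>
    mem_V_of_mem (CellularModel.f_mem_gr (M := T.model B conv) le_rfl (hN a))
  have hsum : T.cellMap B m =
      ∑ a ∈ m.support.image fun j => fibrePart j.1, orderedMonomial T.x a * T.cellMap B (N a) := by
    rw [cellMap, Finsupp.linearCombination_apply, Finsupp.sum,
      ← Finset.sum_fiberwise_of_maps_to (g := fun j => fibrePart j.1)
        fun j hj => Finset.mem_image_of_mem (fun j => fibrePart j.1) hj]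
    refine Finset.sum_congr rfl fun a _ => ?_
    rw [map_sum, Finset.mul_sum]
    refine Finset.sum_congr rfl fun j hj => ?_
    obtain ⟨hj', rfl⟩ := Finset.mem_filter.1 hj
    have := T.cellMap_single B (basePart j.1) j.2 (m j * (-1) ^ k j.1)
    rw [cellMap] at this
    rw [this, hk _ (hm j hj').1, mul_smul_comm, ← mul_assoc, smul_mul_assoc, smul_smul]
  have hzero : ∀ j ∈ m.support, T.cellMap B (N (fibrePart j.1)) = 0 := by
    let c : SimpleExponent ℓ deg →₀ S.V := Finsupp.onFinset
      ((m.support.image fun j => fibrePart j.1).subtype _)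
      (fun a => if a.1 ∈ m.support.image fun j => fibrePart j.1 then ⟨_, hfN a.1⟩ else 0)
      (fun a ha => by
        rw [Finset.mem_subtype]
        by_contra h
        exact ha (if_neg h))
    have hc : c = 0 := by
      refine hΨ.1 ?_
      simp only [Finsupp.sum_zero_index]
      rw [← hfm', hsum, Finsupp.onFinset_sum _ (fun a => by simp)]
      rw [← Finset.sum_subtype_of_mem (p := fun m : I →₀ ℕ =>
        ∀ i, m i < ℓ ∧ (Odd (deg i) → m i ≤ 1))
        (fun a => orderedMonomial T.x a * T.cellMap B (N a))]
      · refine Finset.sum_congr rfl fun a ha => ?_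
        rw [if_pos (Finset.mem_subtype.1 ha)]
      · intro a ha
        obtain ⟨j, hj, rfl⟩ := Finset.mem_image.1 ha
        exact fibrePart_simple (hm j hj).1
    intro j hj
    have := DFunLike.congr_fun hc ⟨fibrePart j.1, fibrePart_simple (hm j hj).1⟩
    rw [Finsupp.onFinset_apply,
      if_pos (Finset.mem_image_of_mem (fun j => fibrePart j.1) hj)] at this
    exact congrArg Subtype.val this
  ext j
  by_contra hne
  have hj : j ∈ m.support := Finsupp.mem_support_iff.2 hne
  have h0 := hi _ (hN (fibrePart j.1)) (survives_two_iff.2 (hzero j hj).symm)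
  have h1 := DFunLike.congr_fun h0 (basePart j.1, j.2)
  simp only [N, Finsupp.finsetSum_apply, Finsupp.zero_apply] at h1
  rw [Finset.sum_eq_single j] at h1
  · rw [Finsupp.single_eq_same] at h1
    exact hne ((mul_eq_zero.1 h1).resolve_right (pow_ne_zero _ (neg_ne_zero.2 one_ne_zero)))
  · intro j' hj' hjj
    obtain ⟨-, hf⟩ := Finset.mem_filter.1 hj'
    refine Finsupp.single_eq_of_ne fun h => hjj ?_
    obtain ⟨h₁, h₂⟩ := Prod.mk.inj h
    exact Prod.ext (ext_parts hf h₁.symm) h₂.symm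
  · exact fun h => (h (Finset.mem_filter.2 ⟨hj, rfl⟩)).elim

include hΨ in
/-- The base row of `E_2` is isomorphic to that of the model. -/
theorem base_row (n : ℕ) : (T.model B conv).Inj 2 n 0 ∧ (T.model B conv).Surj 2 n 0 := by
  induction n using Nat.strong_induction_on with
  | _ n ih =>
    exact CellularModel.comparison (fun p hp q => T.inj_two B conv hΨ (ih p hp).1 q)
      fun p hp q => T.surj_two B conv hΨ (ih p hp).2 q

end TransgressiveFamily

end SpectralSeq

/-! ### Monomials in the free graded-commutative algebra -/

namespace FreeGC

open BorelModel

variable {ℓ : ℕ} [Fact ℓ.Prime] {I : Type w} (deg : I → ℕ)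

/-- The generator `y_i` of the free graded-commutative algebra. -/
def genY (i : I) : FreeGC (ZMod ℓ) (genDeg ℓ deg) := gen (ZMod ℓ) (genDeg ℓ deg) (.inl i)

open Classical in
/-- The generator `z_i` of the free graded-commutative algebra, or `0` if there is none. -/
noncomputable def genZ (i : I) : FreeGC (ZMod ℓ) (genDeg ℓ deg) :=
  if h : ℓ ≠ 2 ∧ Even (deg i) then gen (ZMod ℓ) (genDeg ℓ deg) (.inr ⟨i, h⟩) else 0

/-- The factor `y_i^b z_i^c` of a monomial. -/
noncomputable def factor (m : I →₀ ℕ × ℕ × ℕ) (i : I) : FreeGC (ZMod ℓ) (genDeg ℓ deg) :=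
  genY deg i ^ (m i).2.1 * genZ deg i ^ (m i).2.2

/-- The monomial in the `y_i` and `z_i` with exponents `m` (the exponents of the `x_i` being
ignored). -/
noncomputable def monomial [LinearOrder I] (m : I →₀ ℕ × ℕ × ℕ) :
    FreeGC (ZMod ℓ) (genDeg ℓ deg) :=
  orderedProd m.support (factor deg m)

variable {deg}

theorem gen_mul_gen (a b : I ⊕ EvenIndex ℓ deg) :
    gen (ZMod ℓ) (genDeg ℓ deg) a * gen (ZMod ℓ) (genDeg ℓ deg) b =
      (-1 : ZMod ℓ) ^ (genDeg ℓ deg a * genDeg ℓ deg b) •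
        (gen (ZMod ℓ) (genDeg ℓ deg) b * gen (ZMod ℓ) (genDeg ℓ deg) a) := by
  have := RingQuot.mkAlgHom_rel (ZMod ℓ) (FreeGCRel.swap (F := ZMod ℓ) (deg := genDeg ℓ deg) a b)
  rwa [map_mul, map_smul, map_mul] at this

theorem gen_mul_genY (a : I ⊕ EvenIndex ℓ deg) (i : I) :
    EqUpToSign (ZMod ℓ) (gen (ZMod ℓ) (genDeg ℓ deg) a * genY deg i)
      (genY deg i * gen (ZMod ℓ) (genDeg ℓ deg) a) := ⟨_, gen_mul_gen a _⟩

theorem gen_mul_genZ (a : I ⊕ EvenIndex ℓ deg) (i : I) :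
    EqUpToSign (ZMod ℓ) (gen (ZMod ℓ) (genDeg ℓ deg) a * genZ deg i)
      (genZ deg i * gen (ZMod ℓ) (genDeg ℓ deg) a) := by
  unfold genZ
  split_ifs with h
  · exact ⟨_, gen_mul_gen a _⟩
  · rw [mul_zero, zero_mul]
    exact EqUpToSign.refl 0

theorem gen_mul_factor (a : I ⊕ EvenIndex ℓ deg) (m : I →₀ ℕ × ℕ × ℕ) (i : I) :
    EqUpToSign (ZMod ℓ) (gen (ZMod ℓ) (genDeg ℓ deg) a * factor deg m i)
      (factor deg m i * gen (ZMod ℓ) (genDeg ℓ deg) a) :=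
  .comm_mul ((gen_mul_genY a i).comm_pow _) ((gen_mul_genZ a i).comm_pow _)

theorem genY_mul_genY {i : I} (hi : ¬Plain ℓ (deg i)) :
    (genY deg i : FreeGC (ZMod ℓ) (genDeg ℓ deg)) * genY deg i = 0 := by
  have h := gen_mul_gen (ℓ := ℓ) (deg := deg) (.inl i) (.inl i)
  have hodd : Odd (genDeg ℓ deg (.inl i) * genDeg ℓ deg (.inl i)) :=
    Odd.mul (even_of_not_plain hi).add_one (even_of_not_plain hi).add_one
  rw [hodd.neg_one_pow] at h
  exact eq_zero_of_eq_neg_one_smul (two_ne_zero_of_not_plain hi) h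

variable [LinearOrder I]

variable (ℓ deg) in
/-- The exponents of the monomials in the `y_i` and `z_i`. -/
def baseExponents : Set (I →₀ ℕ × ℕ × ℕ) := {m | ∀ i, m i ∈ valid ℓ (deg i) ∧ (m i).1 = 0}

omit [Fact ℓ.Prime] in
theorem monomial_update {m : I →₀ ℕ × ℕ × ℕ} (i : I) (l : ℕ × ℕ × ℕ) :
    monomial (ℓ := ℓ) deg (m.update i l) = orderedProd (insert i m.support)
      (Function.update (factor deg m) i (genY deg i ^ l.2.1 * genZ deg i ^ l.2.2)) := by
  classical
  rw [monomial, orderedProd_subset _ (t := insert i m.support)]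
  · refine orderedProd_congr fun j _ => ?_
    rcases eq_or_ne j i with rfl | hj
    · rw [Function.update_self, factor, MatchingFamily.update_apply_self]
    · rw [Function.update_of_ne hj, factor, factor, MatchingFamily.update_apply_of_ne hj]
  · intro j hj
    rw [Finset.mem_insert]
    rcases eq_or_ne j i with rfl | hji
    · exact .inl rfl
    · rw [Finsupp.mem_support_iff, MatchingFamily.update_apply_of_ne hji] at hj
      exact .inr (Finsupp.mem_support_iff.2 hj)
  · intro j _ hj
    rw [factor, Finsupp.notMem_support_iff.1 hj]
    simp

theorem gen_mul_monomial (a : I ⊕ EvenIndex ℓ deg) (m : I →₀ ℕ × ℕ × ℕ) (i : I) :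
    EqUpToSign (ZMod ℓ) (gen (ZMod ℓ) (genDeg ℓ deg) a * monomial deg m)
      (orderedProd (insert i m.support)
        (Function.update (factor deg m) i (gen (ZMod ℓ) (genDeg ℓ deg) a * factor deg m i))) := by
  rw [monomial, orderedProd_subset _ (Finset.subset_insert i m.support)]
  · exact mul_orderedProd (fun j _ => gen_mul_factor a m j) (Finset.mem_insert_self _ _)
  · intro j _ hj
    rw [factor, Finsupp.notMem_support_iff.1 hj]
    simp

omit [Fact ℓ.Prime] in
theorem baseExponents_update {m : I →₀ ℕ × ℕ × ℕ} (hm : m ∈ baseExponents ℓ deg) {i : I}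
    {b c : ℕ} (h : (0, b, c) ∈ valid ℓ (deg i)) : m.update i (0, b, c) ∈ baseExponents ℓ deg := by
  intro j
  rcases eq_or_ne j i with rfl | hj
  · rw [MatchingFamily.update_apply_self]
    exact ⟨h, rfl⟩
  · rw [MatchingFamily.update_apply_of_ne hj]
    exact hm j

theorem gen_mul_monomial_mem (a : I ⊕ EvenIndex ℓ deg) {m : I →₀ ℕ × ℕ × ℕ}
    (hm : m ∈ baseExponents ℓ deg) : gen (ZMod ℓ) (genDeg ℓ deg) a * monomial deg m ∈
      Submodule.span (ZMod ℓ) (monomial deg '' baseExponents ℓ deg) := by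
  rcases a with i | ⟨i, hi⟩
  · obtain ⟨k, hk⟩ := gen_mul_monomial (ℓ := ℓ) (deg := deg) (.inl i) m i
    rw [hk]
    refine Submodule.smul_mem _ _ ?_
    have e : gen (ZMod ℓ) (genDeg ℓ deg) (.inl i) * factor deg m i =
        genY deg i ^ ((m i).2.1 + 1) * genZ deg i ^ (m i).2.2 := by
      rw [factor, ← mul_assoc, pow_succ']
      rfl
    rw [e]
    by_cases hv : (0, (m i).2.1 + 1, (m i).2.2) ∈ valid ℓ (deg i)
    · exact Submodule.subset_span ⟨_, baseExponents_update hm hv, monomial_update i _⟩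
    · have hp : ¬Plain ℓ (deg i) ∧ (m i).2.1 = 1 := by
        have h₁ := (hm i).1
        have hℓ := (Fact.out : ℓ.Prime).pos
        simp only [valid, Set.mem_ofPred_eq] at h₁ hv
        grind
      rw [hp.2, one_add_one_eq_two, pow_two, genY_mul_genY hp.1, zero_mul,
        ← zero_smul (ZMod ℓ) (1 : FreeGC (ZMod ℓ) (genDeg ℓ deg)),
        orderedProd_update_smul _ _ _ (Finset.mem_insert_self _ _), zero_smul]
      exact zero_mem _
  · have hz : gen (ZMod ℓ) (genDeg ℓ deg) (.inr ⟨i, hi⟩) = genZ deg i := by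
      rw [genZ, dif_pos hi]
    obtain ⟨k, hk⟩ := gen_mul_monomial (ℓ := ℓ) (deg := deg) (.inr ⟨i, hi⟩) m i
    rw [hk]
    refine Submodule.smul_mem _ _ ?_
    obtain ⟨k', hk'⟩ := ((gen_mul_genY (.inr ⟨i, hi⟩) i).comm_pow (m i).2.1).mul_right
      (genZ deg i ^ (m i).2.2)
    rw [factor, ← mul_assoc, hk', hz, mul_assoc, ← pow_succ',
      orderedProd_update_smul _ _ _ (Finset.mem_insert_self _ _)]
    refine Submodule.smul_mem _ _ (Submodule.subset_span
      ⟨m.update i (0, (m i).2.1, (m i).2.2 + 1), baseExponents_update hm ?_, monomial_update i _⟩)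
    have h₁ := (hm i).1
    have hℓ := (Fact.out : ℓ.Prime).pos
    have hp := not_plain_iff.2 hi
    simp only [valid, Set.mem_ofPred_eq] at h₁ ⊢
    grind

theorem gen_mul_mem_span (a : I ⊕ EvenIndex ℓ deg) {s : FreeGC (ZMod ℓ) (genDeg ℓ deg)}
    (hs : s ∈ Submodule.span (ZMod ℓ) (monomial deg '' baseExponents ℓ deg)) :
    gen (ZMod ℓ) (genDeg ℓ deg) a * s ∈
      Submodule.span (ZMod ℓ) (monomial deg '' baseExponents ℓ deg) := by
  induction hs using Submodule.span_induction with
  | zero => rw [mul_zero]; exact zero_mem _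
  | add x y _ _ hx hy => rw [mul_add]; exact add_mem hx hy
  | smul c x _ hx => rw [mul_smul_comm]; exact Submodule.smul_mem _ _ hx
  | mem x hx =>
    obtain ⟨m, hm, rfl⟩ := hx
    exact gen_mul_monomial_mem a hm

theorem span_monomial :
    Submodule.span (ZMod ℓ) (monomial (ℓ := ℓ) deg '' baseExponents ℓ deg) = ⊤ := by
  rw [eq_top_iff]
  rintro s -
  have key : ∀ (f : FreeAlgebra (ZMod ℓ) (I ⊕ EvenIndex ℓ deg)),
      ∀ s ∈ Submodule.span (ZMod ℓ) (monomial (ℓ := ℓ) deg '' baseExponents ℓ deg),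
        RingQuot.mkAlgHom (ZMod ℓ) (FreeGCRel (ZMod ℓ) (genDeg ℓ deg)) f * s ∈
          Submodule.span (ZMod ℓ) (monomial (ℓ := ℓ) deg '' baseExponents ℓ deg) := by
    intro f
    induction f using FreeAlgebra.induction with
    | grade0 r =>
      intro s hs
      rw [AlgHom.commutes, ← Algebra.smul_def]
      exact Submodule.smul_mem _ _ hs
    | grade1 a => exact fun s hs => gen_mul_mem_span a hs
    | mul f g hf hg =>
      intro s hs
      rw [map_mul, mul_assoc]
      exact hf _ (hg s hs)
    | add f g hf hg =>
      intro s hs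
      rw [map_add, add_mul]
      exact add_mem (hf s hs) (hg s hs)
  obtain ⟨f, rfl⟩ := RingQuot.mkAlgHom_surjective (ZMod ℓ) (FreeGCRel (ZMod ℓ) (genDeg ℓ deg)) s
  rw [← mul_one (RingQuot.mkAlgHom _ _ f)]
  refine key f 1 (Submodule.subset_span ⟨0, fun i => ⟨?_, rfl⟩, ?_⟩)
  · exact zero_mem_valid (Fact.out : ℓ.Prime).two_le
  · simp [monomial]

end FreeGC

namespace SpectralSeq

open BorelModel

variable {ℓ : ℕ} [Fact ℓ.Prime] {H : Type u} [Ring H] [Algebra (ZMod ℓ) H]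
  {𝓗 : ℕ → Submodule (ZMod ℓ) H} {S : SpectralSeq.{u, v} 𝓗} {I : Type w} [LinearOrder I]

namespace TransgressiveFamily

variable {deg : I → ℕ} (T : S.TransgressiveFamily deg) {β : Type*} (B : HomogeneousBasis 𝓗 β)

/-! ### The base row as a tensor product -/

variable (ℓ deg β) in
/-- The cells of the model in the base row. -/
def rowCells : Set ((I →₀ ℕ × ℕ × ℕ) × β) :=
  {j | (∀ i, j.1 i ∈ valid ℓ (deg i)) ∧ fibreDeg (ℓ := ℓ) deg j.1 = 0}

variable [GradedAlgebra 𝓗] (conv : S.ConvergesToBase)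

/-- The map of cells is injective on the base row, being so in each degree. -/
theorem cellMap_injOn (hinj : ∀ n, (T.model B conv).Inj 2 n 0)
    {m : (I →₀ ℕ × ℕ × ℕ) × β →₀ ZMod ℓ}
    (hm : m ∈ Finsupp.supported (ZMod ℓ) (ZMod ℓ) (rowCells ℓ deg β))
    (h : T.cellMap B m = 0) : m = 0 := by
  classical
  obtain ⟨d, hd⟩ : ∃ d : (I →₀ ℕ × ℕ × ℕ) × β → ℕ,
      ∀ a b, d (a, b) = baseDeg (ℓ := ℓ) deg a + B.deg b :=
    ⟨fun j => baseDeg (ℓ := ℓ) deg j.1 + B.deg j.2, fun _ _ => rfl⟩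
  have hpart : ∀ n, T.cellMap B (m.filter fun j => d j = n) =
      GradedAlgebra.proj (S.gr 2) (n, 0) (T.cellMap B m) := by
    intro n
    refine supported_induction (motive := fun m => T.cellMap B (m.filter fun j => d j = n) =
      GradedAlgebra.proj (S.gr 2) (n, 0) (T.cellMap B m))
      (by rw [Finsupp.filter_zero, map_zero, map_zero]) ?_ ?_ ?_ hm
    · rintro ⟨a, b⟩ ⟨hv, hf⟩
      have hmem : T.monomial a * S.η 2 (B.basis b) ∈ S.gr 2 (d (a, b), 0) := by
        have hf' : fibreDeg (ℓ := ℓ) deg a = 0 := hf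
        have := SetLike.GradedMul.mul_mem (T.monomial_mem hv)
          (S.η_mem 2 le_rfl _ _ (B.mem b))
        rw [hd]
        rwa [hf'] at this
      by_cases hn : d (a, b) = n
      · rw [Finsupp.filter_single_of_pos (fun j => d j = n) hn, T.cellMap_single, one_smul, ← hn]
        exact (S.proj_of_mem hmem).symm
      · rw [Finsupp.filter_single_of_neg (fun j => d j = n) hn, map_zero, T.cellMap_single,
          one_smul]
        exact (S.proj_of_mem_ne hmem fun h => hn (Prod.mk.inj h).1).symm
    · intro x y hx hy
      rw [Finsupp.filter_add, map_add, map_add, map_add, hx, hy]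
    · intro c x hx
      rw [Finsupp.filter_smul, map_smul, map_smul, map_smul, hx]
  ext j
  have h0 := hinj (d j) (m.filter fun k => d k = d j) ?_ ?_
  · have h1 := DFunLike.congr_fun h0 j
    rwa [Finsupp.filter_apply_pos (fun k => d k = d j) m rfl] at h1
  · rw [mem_page_two]
    rintro ⟨a, b⟩ hk
    rw [Finsupp.support_filter, Finset.mem_filter] at hk
    obtain ⟨h₁, h₂⟩ := hm hk.1
    exact ⟨h₁, (hd a b).symm.trans hk.2, h₂⟩
  · exact survives_two_iff.2 ((hpart _).trans (by rw [h, map_zero])).symm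

theorem V_le_map_cellMap (hsurj : ∀ n, (T.model B conv).Surj 2 n 0) {v : S.E 2} (hv : v ∈ S.V) :
    v ∈ (Finsupp.supported (ZMod ℓ) (ZMod ℓ) (rowCells ℓ deg β)).map (T.cellMap B) := by
  refine induction_V (motive := fun v =>
    v ∈ (Finsupp.supported (ZMod ℓ) (ZMod ℓ) (rowCells ℓ deg β)).map (T.cellMap B))
    (zero_mem _) ?_ (fun _ _ => add_mem) hv
  intro p v hv
  obtain ⟨m, hm, hmv⟩ := hsurj p v hv
  rw [mem_page_two] at hm
  exact ⟨m, fun j hj => ⟨(hm j hj).1, (hm j hj).2.2⟩, (survives_two_iff.1 hmv).symm⟩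

/-- The map sending a cell `(m, b)` to `b ⊗ m`, with the sign of the commutation of `b` and `m`. -/
noncomputable def toTensor : ((I →₀ ℕ × ℕ × ℕ) × β →₀ ZMod ℓ) →ₗ[ZMod ℓ]
    H ⊗[ZMod ℓ] FreeGC (ZMod ℓ) (genDeg ℓ deg) :=
  Finsupp.linearCombination (ZMod ℓ) fun j =>
    (-1 : ZMod ℓ) ^ (B.deg j.2 * baseDeg (ℓ := ℓ) deg j.1) •
      (B.basis j.2 ⊗ₜ[ZMod ℓ] FreeGC.monomial deg j.1)

omit [GradedAlgebra 𝓗] in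
theorem toTensor_single (m : I →₀ ℕ × ℕ × ℕ) (b : β) (c : ZMod ℓ) :
    toTensor (deg := deg) B (Finsupp.single (m, b) c) =
      c • (-1 : ZMod ℓ) ^ (B.deg b * baseDeg (ℓ := ℓ) deg m) •
        (B.basis b ⊗ₜ[ZMod ℓ] FreeGC.monomial deg m) := by
  simp [toTensor]

omit [GradedAlgebra 𝓗] in
theorem exists_toTensor_eq (t : H ⊗[ZMod ℓ] FreeGC (ZMod ℓ) (genDeg ℓ deg)) :
    t ∈ (Finsupp.supported (ZMod ℓ) (ZMod ℓ) (rowCells ℓ deg β)).map (toTensor B) := by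
  induction t using TensorProduct.induction_on with
  | zero => exact zero_mem _
  | add x y hx hy => exact add_mem hx hy
  | tmul h s =>
    have hs : s ∈ Submodule.span (ZMod ℓ)
        (FreeGC.monomial (ℓ := ℓ) deg '' FreeGC.baseExponents ℓ deg) := by
      rw [FreeGC.span_monomial]; trivial
    induction B.basis.mem_span h using Submodule.span_induction with
    | zero => rw [TensorProduct.zero_tmul]; exact zero_mem _
    | add x y _ _ hx hy => rw [TensorProduct.add_tmul]; exact add_mem hx hy
    | smul c x _ hx => rw [← TensorProduct.smul_tmul']; exact Submodule.smul_mem _ _ hx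
    | mem x hx =>
      obtain ⟨b, rfl⟩ := hx
      induction hs using Submodule.span_induction with
      | zero => rw [TensorProduct.tmul_zero]; exact zero_mem _
      | add x y _ _ hx hy => rw [TensorProduct.tmul_add]; exact add_mem hx hy
      | smul c x _ hx => rw [TensorProduct.tmul_smul]; exact Submodule.smul_mem _ _ hx
      | mem s hs =>
        obtain ⟨m, hm, rfl⟩ := hs
        refine ⟨Finsupp.single (m, b) ((-1) ^ (B.deg b * baseDeg (ℓ := ℓ) deg m)),
          Finsupp.single_mem_supported _ _ ⟨fun i => (hm i).1, ?_⟩, ?_⟩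
        · exact Finset.sum_eq_zero fun i _ => by simp [bideg, (hm i).2]
        · rw [toTensor_single, smul_smul, ← mul_pow]
          simp

theorem tensorToAlg_toTensor (φ : FreeGC (ZMod ℓ) (genDeg ℓ deg) →ₐ[ZMod ℓ] S.V)
    (hy : ∀ i, (φ (FreeGC.genY deg i) : S.E 2) = T.y i)
    (hz : ∀ i, ¬Plain ℓ (deg i) → (φ (FreeGC.genZ deg i) : S.E 2) = T.z i)
    {m : (I →₀ ℕ × ℕ × ℕ) × β →₀ ZMod ℓ}
    (hm : m ∈ Finsupp.supported (ZMod ℓ) (ZMod ℓ) (rowCells ℓ deg β)) :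
    (tensorToAlg S.toV φ (toTensor B m) : S.E 2) = T.cellMap B m := by
  refine supported_induction (motive := fun m =>
    (tensorToAlg S.toV φ (toTensor B m) : S.E 2) = T.cellMap B m) (by simp) ?_ ?_ ?_ hm
  · rintro ⟨m, b⟩ ⟨hv, hf⟩
    have hf' : fibreDeg (ℓ := ℓ) deg m = 0 := hf
    have hmem := T.monomial_mem hv
    rw [hf'] at hmem
    have hφ : (φ (FreeGC.monomial deg m) : S.E 2) = T.monomial m := by
      change S.V.val (φ _) = _
      rw [FreeGC.monomial, map_orderedProd, map_orderedProd, monomial]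
      refine orderedProd_congr fun i _ => ?_
      have hx : (m i).1 = 0 := by
        rw [← T.basePart_eq_self hf']
        simp [basePart]
      rw [loc, hx, pow_zero, one_mul, FreeGC.factor]
      simp only [map_mul, map_pow, Subalgebra.coe_val, hy]
      rcases hv i with ⟨-, -, hc⟩ | ⟨hp, -⟩
      · rw [hc, pow_zero, pow_zero]
      · rw [hz i hp]
    have hcomm := S.comm 2 le_rfl _ _ _ (S.η_mem 2 le_rfl _ _ (B.mem b)) _ hmem
    simp only [add_zero] at hcomm
    rw [toTensor_single, T.cellMap_single, one_smul, one_smul, map_smul]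
    change (-1 : ZMod ℓ) ^ (B.deg b * baseDeg (ℓ := ℓ) deg m) •
      (S.η 2 (B.basis b) * (φ (FreeGC.monomial deg m) : S.E 2)) = _
    rw [hφ, hcomm, smul_smul, ← mul_pow]
    simp
  · intro x y hx hy
    rw [map_add, map_add, map_add, ← hx, ← hy]
    rfl
  · intro c x hx
    rw [map_smul, map_smul, map_smul, ← hx]
    rfl

omit [GradedAlgebra 𝓗] in
/-- The algebra map from the free graded-commutative algebra to `V` with prescribed values on the
generators. -/
theorem exists_algHom {G : Type*} (d : G → ℕ) (g : G → S.V)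
    (hg : ∀ a, (g a : S.E 2) ∈ S.gr 2 (d a, 0)) :
    ∃ φ : FreeGC (ZMod ℓ) d →ₐ[ZMod ℓ] S.V, ∀ a, φ (FreeGC.gen (ZMod ℓ) d a) = g a := by
  refine ⟨RingQuot.liftAlgHom (ZMod ℓ) ⟨FreeAlgebra.lift (ZMod ℓ) g, ?_⟩, fun a => ?_⟩
  · rintro _ _ ⟨a, b⟩
    apply Subtype.ext
    have := S.comm 2 le_rfl _ _ _ (hg a) _ (hg b)
    simpa using this
  · simp [FreeGC.gen]

end TransgressiveFamily

end SpectralSeq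

theorem mainTheorem12 (ℓ : ℕ) [Fact ℓ.Prime]
    {H : Type u} [Ring H] [Algebra (ZMod ℓ) H] (𝓗 : ℕ → Submodule (ZMod ℓ) H) [GradedAlgebra 𝓗]
    (H_comm : IsGradedCommutative (fun n : ℕ => n) 𝓗)
    (H_zero : Function.Bijective (algebraMap (ZMod ℓ) (𝓗 0)))
    (S : SpectralSeq.{u, v} 𝓗) (conv : S.ConvergesToBase)
    (split : S.SplitsE2)
    {I : Type w} [LinearOrder I] (deg : I → ℕ) (x : I → S.W)
    (simple : IsSimpleSystem ℓ (S.toW : H →+* S.W) deg x)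
    (y : I → S.V) (hy : ∀ i, S.Transgresses 0 (deg i) (x i) (y i))
    (z : EvenIndex ℓ deg → S.V)
    (hz : ∀ j : EvenIndex ℓ deg, S.Transgresses (deg j.1 + 1) ((ℓ - 1) * deg j.1)
      ((y j.1 : S.E 2) * (x j.1 : S.E 2) ^ (ℓ - 1)) (z j)) :
    ∃ φ : FreeGC (ZMod ℓ) (genDeg ℓ deg) →ₐ[ZMod ℓ] S.V,
      (∀ i, φ (FreeGC.gen (ZMod ℓ) (genDeg ℓ deg) (Sum.inl i)) = y i) ∧
      (∀ j, φ (FreeGC.gen (ZMod ℓ) (genDeg ℓ deg) (Sum.inr j)) = z j) ∧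
      Function.Bijective (tensorToAlg S.toV φ) := by
  classical
  let T : S.TransgressiveFamily deg :=
    { x := fun i => x i
      y := fun i => y i
      z := fun i => if h : ℓ ≠ 2 ∧ Even (deg i) then z ⟨i, h⟩ else 0
      transgresses_x := hy
      transgresses_z := fun i hi => by
        have hi' := BorelModel.not_plain_iff.1 hi
        rw [dif_pos hi']
        exact hz ⟨i, hi'⟩ }
  obtain ⟨β, ⟨B⟩⟩ := exists_homogeneousBasis 𝓗
  have hΨ : Function.Bijective fun c : SimpleExponent ℓ deg →₀ S.V =>
      c.sum fun a v => orderedMonomial T.x a.1 * (v : S.E 2) := by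
    have hx : ∀ a : I →₀ ℕ, ((orderedMonomial x a : S.W) : S.E 2) = orderedMonomial T.x a := by
      intro a
      change S.W.val _ = _
      rw [orderedMonomial_eq, orderedMonomial_eq, map_orderedProd]
      simp [T]
    have := SpectralSeq.bijective_sum_mul split
      (fun a : SimpleExponent ℓ deg => orderedMonomial x a.1)
      (fun a => a.1.sum fun i k => k * deg i)
      (fun a => by rw [hx]; exact T.orderedMonomial_mem a.1) simple
    simpa only [hx] using this
  obtain ⟨φ, hφ⟩ := SpectralSeq.TransgressiveFamily.exists_algHom (S := S) (genDeg ℓ deg)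
    (Sum.elim y z) (by
      rintro (i | ⟨i, hi⟩)
      · exact T.y_mem i
      · have := T.z_mem (BorelModel.not_plain_iff.2 hi)
        simpa [T, hi, genDeg] using this)
  refine ⟨φ, fun i => hφ (.inl i), fun j => hφ (.inr j), ?_⟩
  have key := fun m hm => T.tensorToAlg_toTensor B φ (m := m)
    (fun i => congrArg Subtype.val (hφ (.inl i)))
    (fun i hi => by
      have hi' := BorelModel.not_plain_iff.1 hi
      rw [FreeGC.genZ, dif_pos hi', hφ]
      simp [T, hi']) hm
  have hrow := T.base_row B conv hΨ
  constructor
  · rw [← LinearMap.ker_eq_bot, LinearMap.ker_eq_bot']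
    intro t ht
    obtain ⟨m, hm, rfl⟩ := SpectralSeq.TransgressiveFamily.exists_toTensor_eq B t
    have h0 := key m hm
    rw [ht] at h0
    rw [T.cellMap_injOn B conv (fun n => (hrow n).1) hm h0.symm, map_zero]
  · intro v
    obtain ⟨m, hm, hmv⟩ := T.V_le_map_cellMap B conv (fun n => (hrow n).2) v.2
    exact ⟨_, Subtype.ext ((key m hm).trans hmv)⟩
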